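/- **Setting.** Call an open set $D\subset\mathbb R^3$ *uniformly $C^3$* if there are constants $K,\sigma_0>0$ such that for every $x_0\in\partial D$ there are Cartesian coordinates $(x',x_3)$, $x'=(x_1,x_2)$, with origin $x_0$ and a $C^3$ function $g$ on $\{|x'|<\sigma_0\}$ with $|\nabla^i g(x')|\le K|x'|^{2-i}$ for $i=0,1,2$ and $|\nabla^3 g(x')|\le K$, such that inside $\{|x'|<\sigma_0,\ |x_3|<K\sigma_0^2\}$ the set $D$ coincides with $\{x_3>g(x')\}$. Let $\Omega\subset\mathbb R^3$ be a uniformly $C^3$ domain and let $S_0\subset\Omega$ be a bounded uniformly $C^3$ domain (domains are nonempty, open and connected). Let $0<T<\infty$. The rigid body $S(t)\subset\Omega$, $t\in[0,T)$, consists of the points $x(t)$ that solve $$\frac{dx}{dt}=u_*(t)+\omega(t)\times(x(t)-x_*(t)),\qquad x(0)\in S_0,$$ (in integrated form), where $u_*,\omega\in L^\infty(0,T;\mathbb R^3)$ and $x_*(t)\in\overline{S(t)}$ is a reference point. Put $F(t)=\Omega\setminus\overline{S(t)}$ and $h(t)=\operatorname{dist}(S(t),\partial\Omega)$. For points $P\in\partial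 S(t)$, $Q\in\partial\Omega$ with $|PQ|=h(t)>0$, take Cartesian coordinates $(x',x_3)$ with origin $Q$ in which $P=(0,0,h(t))$. For a constant $k>0$ and $\sigma>0$ put $$\mathcal C_\sigma=\{\,|x'|<\sigma,\ -k\sigma^2<x_3<h(t)+2k\sigma^2\,\}.$$ **Statement.** There are constants $c_0,k>0$ depending only on $\Omega$ and $S_0$ such that the following holds with $\sigma_h:=c_0h^{1/2}$, for every $T$ and every motion of the body as above. Let $u$ be a vector field with $$u\in L^\infty(0,T;L^2(\Omega))\cap L^1(0,T;W^{1,2}_0(\Omega)),\qquad \operatorname{div}u=0,$$ such that for almost every $t\in(0,T)$ $$u(x,t)=u_*(t)+\omega(t)\times(x-x_*(t))\quad\text{for a.e. }x\in S(t),$$ and assume that for almost every $t\in(0,T)$ the weak derivatives $\nabla^2u(\cdot,t)$ exist in $F(t)$ and that $$\int_0^t\|\nabla^2u\|_{L^2(F(s))}\,ds<\infty\qquad\text{for all }t\in[0,T).$$ If $h(0)>0$, then $h(t)>0$ for all $t\in[0,T)$. If moreover $\liminf_{t\to T}h(t)=0$, then, for every choice of points $P(t)\in\partial S(t)$, $Q(t)\in\partial\Omega$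 realizing the distance $h(t)$, $t\in[0,T)$, and with the cylinders $\mathcal C_{\sigma_{h}(t)}$ they determine, $$\lim_{t\to T}\int_0^t h^{1/2}(\tau)\,\|\nabla^2u\|_{L^2(\mathcal C_{\sigma_h(\tau)}\cap F(\tau))}\,d\tau=\infty .$$ -/

import Mathlib

open MeasureTheory Set Filter Topology
open scoped ContDiff ENNReal NNReal

namespace RigidFluid

/-- Euclidean three-space. -/
abbrev E3 : Type := EuclideanSpace ℝ (Fin 3)

/-- The Euclidean plane of the variables `x' = (x₁, x₂)`. -/
abbrev E2 : Type := EuclideanSpace ℝ (Fin 2)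

/-- The point `(x', s)` of three-space. -/
noncomputable def joinPt (x : E2) (s : ℝ) : E3 := !₂[x 0, x 1, s]

/-- The vector product `a × b`. -/
noncomputable def cross (a b : E3) : E3 :=
  WithLp.toLp 2 (crossProduct (WithLp.ofLp a) (WithLp.ofLp b))

/-! ### Uniformly `C³` domains -/

/-- `D` is uniformly of class `C³` with constants `K` and `σ₀`: around each boundary point `x₀`
there are Euclidean coordinates with origin `x₀` in which, inside the cylinder `|x'| < σ₀`,
`|x₃| < K σ₀²`, the set `D` is the part above the graph of a `C³` function `g` with
`|∇ⁱ g(x')| ≤ K |x'|^(2-i)` for `i = 0, 1, 2` and `|∇³ g(x')| ≤ K`. The graph stays inside the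
cylinder, since `|g(x')| ≤ K |x'|² < K σ₀²`. -/
def IsUniformlyC3With (K σ₀ : ℝ) (D : Set E3) : Prop :=
  ∀ x₀ ∈ frontier D, ∃ (R : E3 ≃ᵃⁱ[ℝ] E3) (g : E2 → ℝ),
    R 0 = x₀ ∧
    ContDiffOn ℝ 3 g (Metric.ball 0 σ₀) ∧
    (∀ x ∈ Metric.ball (0 : E2) σ₀, ∀ i ≤ 2,
      ‖iteratedFDeriv ℝ i g x‖ ≤ K * ‖x‖ ^ (2 - i)) ∧
    (∀ x ∈ Metric.ball (0 : E2) σ₀, ‖iteratedFDeriv ℝ 3 g x‖ ≤ K) ∧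
    (∀ x ∈ Metric.ball (0 : E2) σ₀, ∀ s : ℝ, |s| < K * σ₀ ^ 2 →
      (R (joinPt x s) ∈ D ↔ g x < s))

/-- `D` is uniformly of class `C³`: the constants are the same for all boundary points. -/
def IsUniformlyC3 (D : Set E3) : Prop :=
  ∃ K σ₀ : ℝ, 0 < K ∧ 0 < σ₀ ∧ IsUniformlyC3With K σ₀ D

/-! ### Sobolev spaces -/

/-- `G` is the weak (distributional) gradient of `v` in the open set `U`. -/
def HasWeakGradient {V : Type} [NormedAddCommGroup V] [NormedSpace ℝ V]
    (U : Set E3) (v : E3 → V) (G : E3 → E3 →L[ℝ] V) : Prop :=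
  LocallyIntegrableOn v U volume ∧ LocallyIntegrableOn G U volume ∧
  ∀ φ : E3 → ℝ, ContDiff ℝ ∞ φ → HasCompactSupport φ → tsupport φ ⊆ U →
    ∀ e : E3, ∫ x in U, (fderiv ℝ φ x e) • v x = - ∫ x in U, φ x • G x e

/-- `v` lies in `W^{1,2}_0(Ω)`, the closure of the smooth vector fields with compact support
in `Ω` with respect to the `W^{1,2}` norm, and `G` is the gradient of `v`. -/
def MemW012 (Ω : Set E3) (v : E3 → E3) (G : E3 → E3 →L[ℝ] E3) : Prop :=
  MemLp v 2 (volume.restrict Ω) ∧ MemLp G 2 (volume.restrict Ω) ∧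
  ∃ φ : ℕ → E3 → E3,
    (∀ n, ContDiff ℝ ∞ (φ n) ∧ HasCompactSupport (φ n) ∧ tsupport (φ n) ⊆ Ω) ∧
    Tendsto (fun n => eLpNorm (fun x => v x - φ n x) 2 (volume.restrict Ω)) atTop (𝓝 0) ∧
    Tendsto (fun n => eLpNorm (fun x => G x - fderiv ℝ (φ n) x) 2 (volume.restrict Ω))
      atTop (𝓝 0)

/-- `u ∈ L^∞(0,T; L²(Ω))`. -/
def MemLinftyL2 (T : ℝ) (Ω : Set E3) (u : ℝ → E3 → E3) : Prop :=
  AEStronglyMeasurable (fun p : ℝ × E3 => u p.1 p.2)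
    ((volume.restrict (Ioo 0 T)).prod (volume.restrict Ω)) ∧
  ∃ M : ℝ≥0, ∀ᵐ t ∂(volume.restrict (Ioo 0 T)), eLpNorm (u t) 2 (volume.restrict Ω) ≤ M

/-- `u ∈ L¹(0,T; W^{1,2}_0(Ω))`, with spatial gradient `Du`. -/
def MemL1W012 (T : ℝ) (Ω : Set E3) (u : ℝ → E3 → E3) (Du : ℝ → E3 → E3 →L[ℝ] E3) : Prop :=
  AEStronglyMeasurable (fun p : ℝ × E3 => u p.1 p.2)
    ((volume.restrict (Ioo 0 T)).prod (volume.restrict Ω)) ∧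
  AEStronglyMeasurable (fun p : ℝ × E3 => Du p.1 p.2)
    ((volume.restrict (Ioo 0 T)).prod (volume.restrict Ω)) ∧
  (∀ᵐ t ∂(volume.restrict (Ioo 0 T)), MemW012 Ω (u t) (Du t)) ∧
  ∫⁻ t in Ioo 0 T, (eLpNorm (u t) 2 (volume.restrict Ω) +
    eLpNorm (Du t) 2 (volume.restrict Ω)) < ⊤

/-- The divergence of a vector field with gradient `G` (the trace of `G`) vanishes in `Ω`. -/
def DivFree (Ω : Set E3) (G : E3 → E3 →L[ℝ] E3) : Prop :=
  ∀ᵐ x ∂(volume.restrict Ω), ∑ i : Fin 3, (G x (EuclideanSpace.single i 1)) i = 0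

/-! ### The moving body -/

/-- The rigid velocity field `u_*(t) + ω(t) × (x - x_*(t))`. -/
noncomputable def rigidVelocity (ustar om xstar : ℝ → E3) (t : ℝ) (x : E3) : E3 :=
  ustar t + cross (om t) (x - xstar t)

/-- `x` solves `dx/dt = v(t, x)` on `[0,T)` in the sense of Carathéodory. -/
def IsTrajectory (T : ℝ) (v : ℝ → E3 → E3) (x : ℝ → E3) : Prop :=
  ∀ t ∈ Ico 0 T, IntervalIntegrable (fun s => v s (x s)) volume 0 t ∧
    x t = x 0 + ∫ s in (0 : ℝ)..t, v s (x s)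

/-- `X t` maps the initial position of each particle of the body `S₀` to its position at time
`t`; the particles are carried by the rigid velocity field with bounded coefficients `ustar`, `om`
and reference point `xstar t` in the closed body, and the body `S(t) = X t '' S₀` stays
in `Ω`. -/
structure IsBodyMotion (Ω S₀ : Set E3) (T : ℝ) (ustar om xstar : ℝ → E3)
    (X : ℝ → E3 → E3) : Prop where
  ustar_bounded : MemLp ustar ⊤ (volume.restrict (Ioo 0 T))
  omega_bounded : MemLp om ⊤ (volume.restrict (Ioo 0 T))
  initial : ∀ x ∈ S₀, X 0 x = x
  trajectory : ∀ x ∈ S₀, IsTrajectory T (rigidVelocity ustar om xstar) (fun t => X t x)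
  xstar_mem : ∀ t ∈ Ico 0 T, xstar t ∈ closure (X t '' S₀)
  subset : ∀ t ∈ Ico 0 T, X t '' S₀ ⊆ Ω

/-- The fluid region `Ω ∖ closure S`. -/
def fluid (Ω S : Set E3) : Set E3 := Ω \ closure S

/-- `u` is the rigid velocity field on the body, for almost all times. -/
def IsRigidOnBody (S₀ : Set E3) (T : ℝ) (ustar om xstar : ℝ → E3) (X : ℝ → E3 → E3)
    (u : ℝ → E3 → E3) : Prop :=
  ∀ᵐ t ∂(volume.restrict (Ioo 0 T)), ∀ᵐ x ∂(volume.restrict (X t '' S₀)),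
    u t x = rigidVelocity ustar om xstar t x

/-! ### Distance to the boundary and the cylinder in the gap -/

/-- The distance `inf {|a - b| : a ∈ A, b ∈ B}` of two nonempty sets. -/
noncomputable def setDist (A B : Set E3) : ℝ := sInf (Set.image2 dist A B)

/-- `h(t)`, the distance of the body at time `t` to the boundary of `Ω`. -/
noncomputable def gap (Ω S₀ : Set E3) (X : ℝ → E3 → E3) (t : ℝ) : ℝ :=
  setDist (X t '' S₀) (frontier Ω)

/-- `P ∈ ∂S` and `Q ∈ ∂Ω` realize the distance of `S` to `∂Ω`. -/
def IsClosestPair (Ω S : Set E3) (P Q : E3) : Prop :=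
  P ∈ frontier S ∧ Q ∈ frontier Ω ∧ dist P Q = setDist S (frontier Ω)

/-- The coordinate `x₃` of `x`, for the origin `Q` and the axis directed from `Q` to `P`. -/
noncomputable def axialCoord (P Q x : E3) : ℝ :=
  inner ℝ (x - Q) (‖P - Q‖⁻¹ • (P - Q))

/-- The distance `|x'|` of `x` to the axis through `Q` and `P`. -/
noncomputable def radialCoord (P Q x : E3) : ℝ :=
  ‖(x - Q) - axialCoord P Q x • (‖P - Q‖⁻¹ • (P - Q))‖

/-- The cylinder `|x'| < σ`, `-k σ² < x₃ < h + 2 k σ²`, where `h = |P - Q|`. -/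
def cylinder (k : ℝ) (P Q : E3) (σ : ℝ) : Set E3 :=
  {x | radialCoord P Q x < σ ∧ -(k * σ ^ 2) < axialCoord P Q x ∧
    axialCoord P Q x < dist P Q + 2 * k * σ ^ 2}

end RigidFluid

open RigidFluid

/-! Let `V` be the velocity of the body at the point `P` closest to the wall, `n` the unit vector
from `Q` to `P` and `ω` the angular velocity. Almost everywhere `h' = V·n`, and everything rests on
the estimate `|V·n| ≤ C h (h^{1/2} ‖∇²u‖ + |V| + |ω|)` for small `h`, with the `L²` norm taken over
the fluid part of the cylinder (`exists_gap_velocity_bound`). Since `V` and `ω` are bounded, `-(log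
h)'` is at most `C h^{1/2} ‖∇²u‖` plus a constant, so `log h` is bounded below as long as the
integral of `h^{1/2} ‖∇²u‖` is. On `[0,t]` with `t < T` this integral is finite by assumption, which
excludes contact; were it bounded up to `T`, then `h` would stay away from `0`, against `liminf h =
0`.

The estimate is a flux balance. A body approaching the wall pushes the fluid out sideways: testing
`div u = 0` with `ψ(x') χ(x₃)`, `ψ = (σ² - |x'|²)₊²`, expresses `V·n ∫ψ` through the weighted
horizontal flux `∫ ∇ψ·u'`. On a vertical segment between the wall `s = a` and the body `s = b`, with
midpoint `c` and half-length `d`, the trapezoidal rule gives the integral of `u'` as `d` times the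
sum of the two end values, up to `∫ ½(d² - (s-c)²) ∂ₛ²u'`. The kernel is of size `h²`; `u'` vanishes
at the wall and is rigid at the body. Besides the second derivatives only explicit terms in `V` and
`ω` remain (`abs_integral_moment_le`, `gap_flux_estimate`).

Symmetry makes the explicit terms small. The gradient of `ψ` is odd and radial, and `C³` graphs are
even up to `O(|x'|³)`, so the horizontal part of `V` contributes `O(h σ⁶)` instead of `O(h σ⁵)`;
without this gain only `|V·n| ≲ h^{1/2}` would follow, which does not exclude contact in finite
time. Rotation about the normal contributes nothing. With `K σ² = h/4` the graphs stay within `h/4`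
of their tangent planes. Cauchy–Schwarz on a cylinder of volume of order `σ² h`, and division by
`∫ψ`, of order `σ⁶`, give the estimate.

No traces are used: the field and its gradient are extended by zero across the wall and integrated
by parts against Lipschitz functions (`MemW012.integral_lineDeriv_mul`). The common coordinates at
`P` and `Q` come from `exists_gap_frame`, the formula for `h'` from
`IsBodyMotion.ae_hasDerivAt_gap`, the logarithmic integration from `exp_neg_mul_le_of_deriv`. -/

namespace RigidFluid

/-! ### Weak derivatives tested with Lipschitz functions. -/

open Convolution ContinuousLinearMap in
/-- Convolution of a Lipschitz function with a bump function: derivative in a direction. -/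
theorem hasLineDerivAt_bump_convolution (φ : ContDiffBump (0 : E3)) {θ : E3 → ℝ} {C : ℝ≥0}
    (hθ : LipschitzWith C θ) (e x : E3) :
    HasLineDerivAt ℝ (φ.normed volume ⋆[lsmul ℝ ℝ, volume] θ)
      ((φ.normed volume ⋆[lsmul ℝ ℝ, volume] fun z => lineDeriv ℝ θ z e) x) x e := by
  unfold HasLineDerivAt
  have hcont := hθ.continuous
  have hφc : Continuous (φ.normed (volume : Measure E3)) := φ.continuous_normed
  have hφs : HasCompactSupport (φ.normed (volume : Measure E3)) := φ.hasCompactSupport_normed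
  have hint : Integrable (fun t => φ.normed volume t) (volume : Measure E3) := φ.integrable_normed
  -- Differentiation under the integral with the derivative falling on `θ`: the Lipschitz constant
  -- dominates the difference quotients, and `θ` is differentiable along `e` almost everywhere.
  have key := hasDerivAt_integral_of_dominated_loc_of_lip (μ := (volume : Measure E3))
    (F := fun (s : ℝ) t => φ.normed volume t * θ (x + s • e - t))
    (F' := fun t => φ.normed volume t * lineDeriv ℝ θ (x - t) e)
    (x₀ := (0 : ℝ)) (s := Set.univ) (bound := fun t => φ.normed volume t * (C * ‖e‖))
    univ_mem ?_ ?_ ?_ ?_ ?_ ?_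
  · exact key.2
  · refine Eventually.of_forall fun s => Continuous.aestronglyMeasurable ?_
    fun_prop
  · refine Continuous.integrable_of_hasCompactSupport (by fun_prop) ?_
    exact hφs.mul_right
  · refine hφc.aestronglyMeasurable.mul ?_
    have h1 : Measurable fun z => lineDeriv ℝ θ z e := measurable_lineDeriv hcont
    exact (h1.comp (measurable_const.sub measurable_id)).aestronglyMeasurable
  · refine Eventually.of_forall fun t => ?_
    refine LipschitzOnWith.of_dist_le_mul fun s _ s' _ => ?_
    rw [Real.dist_eq, ← mul_sub, abs_mul, abs_of_nonneg (φ.nonneg_normed t)]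
    have h1 : |θ (x + s • e - t) - θ (x + s' • e - t)| ≤ C * (‖e‖ * |s - s'|) := by
      have := hθ.dist_le_mul (x + s • e - t) (x + s' • e - t)
      rw [Real.dist_eq] at this
      refine this.trans (le_of_eq ?_)
      rw [dist_eq_norm, show x + s • e - t - (x + s' • e - t) = (s - s') • e by module, norm_smul,
        Real.norm_eq_abs]
      ring
    calc φ.normed volume t * |θ (x + s • e - t) - θ (x + s' • e - t)|
        ≤ φ.normed volume t * (C * (‖e‖ * |s - s'|)) := by
          gcongr
          exact φ.nonneg_normed t
      _ = _ := by
          have hn : 0 ≤ φ.normed volume t * (C * ‖e‖) :=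
            mul_nonneg (φ.nonneg_normed t) (by positivity)
          rw [Real.coe_nnabs, abs_of_nonneg hn, Real.dist_eq]
          ring
  · exact hint.mul_const _
  · have h1 := hθ.ae_lineDifferentiableAt (μ := (volume : Measure E3)) e
    have h2 : ∀ᵐ t : E3, LineDifferentiableAt ℝ θ (x - t) e :=
      (Measure.measurePreserving_sub_left volume x).quasiMeasurePreserving.ae h1
    filter_upwards [h2] with t ht
    have h3 := (ht.hasLineDerivAt)
    unfold HasLineDerivAt at h3
    have := h3.const_mul (φ.normed volume t)
    refine this.congr_of_eventuallyEq (Eventually.of_forall fun s => ?_)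
    simp only
    rw [show x + s • e - t = x - t + s • e by abel]

open Convolution ContinuousLinearMap in
/-- A weak derivative may be tested with Lipschitz functions. -/
theorem integral_lineDeriv_mul_of_forall_contDiff {U : Set E3} (hU : IsOpen U) {f g : E3 → ℝ}
    (hf : LocallyIntegrableOn f U) (hg : LocallyIntegrableOn g U) (e : E3)
    (H : ∀ φ : E3 → ℝ, ContDiff ℝ ∞ φ → HasCompactSupport φ → tsupport φ ⊆ U →
      ∫ x in U, fderiv ℝ φ x e * f x = - ∫ x in U, φ x * g x)
    {θ : E3 → ℝ} {C : ℝ≥0} (hθ : LipschitzWith C θ) (hc : HasCompactSupport θ)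
    (hs : tsupport θ ⊆ U) :
    ∫ x in U, lineDeriv ℝ θ x e * f x = - ∫ x in U, θ x * g x := by
  -- A compact collar `K` of the support still lies in `U`. All mollifications at scale at most `δ`
  -- are supported in `K`, so local integrability of `f` and `g` is enough.
  obtain ⟨δ, δpos, hδ⟩ := hc.isCompact.exists_cthickening_subset_open hU hs
  set K := Metric.cthickening δ (tsupport θ) with hK
  have hKc : IsCompact K := hc.isCompact.cthickening
  let φ : ℕ → ContDiffBump (0 : E3) := fun n =>
    ⟨δ / (2 * (n + 1)), δ / (n + 1), by positivity, by
      apply div_lt_div_of_pos_left δpos (by positivity)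
      have : (0 : ℝ) < n + 1 := by positivity
      linarith⟩
  have hφ0 : Tendsto (fun n => (φ n).rOut) atTop (𝓝 0) := by
    have := tendsto_one_div_add_atTop_nhds_zero_nat (𝕜 := ℝ)
    have := this.const_mul δ
    simpa [φ, div_eq_mul_inv] using this
  have hφδ : ∀ n, (φ n).rOut ≤ δ := fun n => by
    simp only [φ]
    apply div_le_self δpos.le
    have : (0 : ℝ) ≤ n := by positivity
    linarith
  have hφK : ∀ᶠ n in atTop, (φ n).rOut ≤ 2 * (φ n).rIn := Eventually.of_forall fun n => by
    simp only [φ]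
    apply le_of_eq
    field_simp
  let θn : ℕ → E3 → ℝ := fun n => (φ n).normed volume ⋆[lsmul ℝ ℝ, volume] θ
  have hsm : ∀ n, ContDiff ℝ ∞ (θn n) := fun n =>
    (φ n).hasCompactSupport_normed.contDiff_convolution_left _ (φ n).contDiff_normed
      hθ.continuous.locallyIntegrable
  have hsupp : ∀ n, tsupport (θn n) ⊆ K := fun n => by
    refine closure_minimal ?_ Metric.isClosed_cthickening
    refine (support_convolution_subset _).trans ?_
    rintro _ ⟨p, hp, q, hq, rfl⟩
    rw [(φ n).support_normed_eq] at hp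
    refine Metric.mem_cthickening_of_dist_le _ q _ _ (subset_tsupport _ hq) ?_
    have := Metric.mem_ball.1 hp
    simp only [dist_eq_norm, sub_zero] at this ⊢
    simpa using this.le.trans (hφδ n)
  have hcs : ∀ n, HasCompactSupport (θn n) := fun n =>
    hKc.of_isClosed_subset (isClosed_tsupport _) (hsupp n)
  have hderiv : ∀ n x, fderiv ℝ (θn n) x e =
      ((φ n).normed volume ⋆[lsmul ℝ ℝ, volume] fun z => lineDeriv ℝ θ z e) x := fun n x => by
    have h1 := ((hsm n).differentiable (by simp) x).hasFDerivAt.hasLineDerivAt e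
    exact h1.lineDeriv.symm.trans (hasLineDerivAt_bump_convolution (φ n) hθ e x).lineDeriv
  have hbd : ∀ n x, ‖fderiv ℝ (θn n) x e‖ ≤ C * ‖e‖ := fun n x => by
    rw [hderiv, convolution_def]
    calc ‖∫ t, (φ n).normed volume t • lineDeriv ℝ θ (x - t) e‖
        ≤ ∫ t, (φ n).normed volume t * (C * ‖e‖) := by
          refine norm_integral_le_of_norm_le ((φ n).integrable_normed.mul_const _) ?_
          refine Eventually.of_forall fun t => ?_
          rw [norm_smul, Real.norm_of_nonneg ((φ n).nonneg_normed t)]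
          gcongr
          · exact (φ n).nonneg_normed t
          · exact norm_lineDeriv_le_of_lipschitz ℝ hθ
      _ = C * ‖e‖ := by
          rw [integral_mul_const, (φ n).integral_normed, one_mul]
  obtain ⟨B, hB⟩ := hθ.continuous.bounded_above_of_compact_support hc
  have hbd0 : ∀ n x, ‖θn n x‖ ≤ B := fun n x => by
    simp only [θn, convolution_def]
    calc ‖∫ t, (φ n).normed volume t • θ (x - t)‖
        ≤ ∫ t, (φ n).normed volume t * B := by
          refine norm_integral_le_of_norm_le ((φ n).integrable_normed.mul_const _) ?_
          refine Eventually.of_forall fun t => ?_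
          rw [norm_smul, Real.norm_of_nonneg ((φ n).nonneg_normed t)]
          gcongr
          · exact (φ n).nonneg_normed t
          · exact hB _
      _ = B := by
          rw [integral_mul_const, (φ n).integral_normed, one_mul]
  have hfK : IntegrableOn f K := hf.integrableOn_compact_subset hδ hKc
  have hgK : IntegrableOn g K := hg.integrableOn_compact_subset hδ hKc
  have hKm : MeasurableSet K := hKc.measurableSet
  have red : ∀ (F : E3 → ℝ), (∀ x ∉ K, F x = 0) → ∫ x in U, F x = ∫ x in K, F x := by
    intro F hF
    rw [setIntegral_eq_integral_of_forall_compl_eq_zero fun x hx => hF x fun h => hx (hδ h),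
      setIntegral_eq_integral_of_forall_compl_eq_zero fun x hx => hF x hx]
  have hθK : ∀ x ∉ K, θ x = 0 := fun x hx =>
    image_eq_zero_of_notMem_tsupport fun h => hx (Metric.self_subset_cthickening _ h)
  have hθnK : ∀ n, ∀ x ∉ K, θn n x = 0 := fun n x hx =>
    image_eq_zero_of_notMem_tsupport fun h => hx (hsupp n h)
  have hdθnK : ∀ n, ∀ x ∉ K, fderiv ℝ (θn n) x e = 0 := fun n x hx => by
    have : fderiv ℝ (θn n) x = 0 := by
      apply image_eq_zero_of_notMem_tsupport
      exact fun h => hx (hsupp n (tsupport_fderiv_subset ℝ h))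
    simp [this]
  have hdθK : ∀ x ∉ K, lineDeriv ℝ θ x e = 0 := fun x hx => by
    have h0 : θ =ᶠ[𝓝 x] 0 := by
      rw [← notMem_tsupport_iff_eventuallyEq]
      exact fun h => hx (Metric.self_subset_cthickening _ h)
    have hl : HasFDerivAt θ (0 : E3 →L[ℝ] ℝ) x :=
      (hasFDerivAt_const (0 : ℝ) x).congr_of_eventuallyEq h0
    simpa using (hl.hasLineDerivAt e).lineDeriv
  -- The derivatives of the mollifications are bounded uniformly by `C * ‖e‖` and converge almost
  -- everywhere, being mollifications of the derivative of `θ`.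
  have t1 : Tendsto (fun n => ∫ x in K, fderiv ℝ (θn n) x e * f x) atTop
      (𝓝 (∫ x in K, lineDeriv ℝ θ x e * f x)) := by
    refine tendsto_integral_of_dominated_convergence (fun x => C * ‖e‖ * ‖f x‖) ?_ ?_ ?_ ?_
    · intro n
      refine AEStronglyMeasurable.mul ?_ hfK.aestronglyMeasurable
      exact (((hsm n).continuous_fderiv (by simp)).clm_apply continuous_const).aestronglyMeasurable
    · exact hfK.norm.const_mul _
    · intro n
      refine Eventually.of_forall fun x => ?_
      rw [norm_mul]
      gcongr
      exact hbd n x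
    · have := ContDiffBump.ae_convolution_tendsto_right_of_locallyIntegrable hφ0 hφK
        (hθ.locallyIntegrable_lineDeriv (μ := (volume : Measure E3)) e)
      filter_upwards [ae_restrict_of_ae this] with x hx
      simp only [hderiv]
      exact hx.mul_const _
  have t2 : Tendsto (fun n => ∫ x in K, θn n x * g x) atTop (𝓝 (∫ x in K, θ x * g x)) := by
    refine tendsto_integral_of_dominated_convergence (fun x => B * ‖g x‖) ?_ ?_ ?_ ?_
    · intro n
      exact (hsm n).continuous.aestronglyMeasurable.mul hgK.aestronglyMeasurable
    · exact hgK.norm.const_mul _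
    · intro n
      refine Eventually.of_forall fun x => ?_
      rw [norm_mul]
      gcongr
      exact hbd0 n x
    · refine Eventually.of_forall fun x => ?_
      exact (ContDiffBump.convolution_tendsto_right_of_continuous hφ0 hθ.continuous x).mul_const _
  rw [red _ fun x hx => by rw [hdθK x hx, zero_mul], red _ fun x hx => by rw [hθK x hx, zero_mul]]
  refine tendsto_nhds_unique t1 (t2.neg.congr fun n => ?_)
  have := H (θn n) (hsm n) (hcs n) ((hsupp n).trans hδ)
  rw [red _ fun x hx => by rw [hdθnK n x hx, zero_mul],
    red _ fun x hx => by rw [hθnK n x hx, zero_mul]] at this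
  exact this.symm

/-- Hölder's inequality: strong `L²` convergence passes to pairings with a fixed `L²` function. It
transfers identities from the smooth approximants to a `W^{1,2}_0` field and its gradient. -/
theorem tendsto_integral_mul_of_tendsto_eLpNorm {α V : Type*} [MeasurableSpace α]
    [NormedAddCommGroup V] [NormedSpace ℝ V]
    {μ : Measure α} {g : α → ℝ} (hg : MemLp g 2 μ) {F : α → V} {Fn : ℕ → α → V}
    (hF : MemLp F 2 μ) (hFn : ∀ n, MemLp (Fn n) 2 μ)
    (h : Tendsto (fun n => eLpNorm (fun x => F x - Fn n x) 2 μ) atTop (𝓝 0)) (l : V →L[ℝ] ℝ) :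
    Tendsto (fun n => ∫ x, g x * l (Fn n x) ∂μ) atTop (𝓝 (∫ x, g x * l (F x) ∂μ)) := by
  have hint : ∀ {f : α → V}, MemLp f 2 μ → Integrable (fun x => g x * l (f x)) μ := fun hf =>
    MemLp.integrable_mul hg (l.comp_memLp' hf)
  refine tendsto_integral_of_L1' _ (hint hF).aestronglyMeasurable
    (Eventually.of_forall fun n => hint (hFn n)) ?_
  have hlim : Tendsto (fun n => (‖l‖₊ : ℝ≥0∞) * eLpNorm g 2 μ *
      eLpNorm (fun x => F x - Fn n x) 2 μ) atTop (𝓝 0) := by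
    have := ENNReal.Tendsto.const_mul (a := (‖l‖₊ : ℝ≥0∞) * eLpNorm g 2 μ) h
      (Or.inr (ENNReal.mul_ne_top (by simp) hg.eLpNorm_ne_top))
    simpa using this
  refine tendsto_of_tendsto_of_tendsto_of_le_of_le tendsto_const_nhds hlim (fun _ => zero_le) ?_
  intro n
  refine eLpNorm_le_eLpNorm_mul_eLpNorm_of_nnnorm (p := 2) (q := 2) (r := 1) hg.aestronglyMeasurable
    (hF.sub (hFn n)).aestronglyMeasurable (fun a b => - (a * l b)) ‖l‖₊
    (Eventually.of_forall fun x => ?_) |>.trans_eq' ?_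
  · simp only [nnnorm_neg, nnnorm_mul]
    calc ‖g x‖₊ * ‖l (F x - Fn n x)‖₊ ≤ ‖g x‖₊ * (‖l‖₊ * ‖F x - Fn n x‖₊) := by
          gcongr
          exact l.le_opNNNorm _
      _ = _ := by simp only [Pi.sub_apply]; ring
  · congr 1
    ext x
    simp only [Pi.sub_apply, map_sub]
    ring

/-- Integration by parts in `W^{1,2}_0(Ω)` against Lipschitz functions, which need not vanish on
the boundary of `Ω`. -/
theorem MemW012.integral_lineDeriv_mul {Ω : Set E3} {v : E3 → E3} {G : E3 → E3 →L[ℝ] E3}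
    (hv : MemW012 Ω v G) {θ : E3 → ℝ} {C : ℝ≥0} (hθ : LipschitzWith C θ)
    (hc : HasCompactSupport θ) (e w : E3) :
    ∫ x in Ω, lineDeriv ℝ θ x e * inner ℝ w (v x) = - ∫ x in Ω, θ x * inner ℝ w (G x e) := by
  obtain ⟨hv2, hG2, φ, hφ, hφv, hφG⟩ := hv
  have hdc : HasCompactSupport fun x => lineDeriv ℝ θ x e := by
    refine HasCompactSupport.intro hc (fun x hx => ?_)
    have h0 : θ =ᶠ[𝓝 x] 0 := notMem_tsupport_iff_eventuallyEq.1 hx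
    have hl : HasFDerivAt θ (0 : E3 →L[ℝ] ℝ) x :=
      (hasFDerivAt_const (0 : ℝ) x).congr_of_eventuallyEq h0
    simpa using (hl.hasLineDerivAt e).lineDeriv
  have hθ2 : MemLp θ 2 (volume.restrict Ω) :=
    (hθ.continuous.memLp_of_hasCompactSupport hc).restrict _
  have hd2 : MemLp (fun x => lineDeriv ℝ θ x e) 2 (volume.restrict Ω) := by
    refine MemLp.restrict _ ?_
    have h1 : MemLp (fun x => lineDeriv ℝ θ x e) ⊤ (volume : Measure E3) := hθ.memLp_lineDeriv e
    have h3 : MemLp (fun x => lineDeriv ℝ θ x e) 2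
        ((volume : Measure E3).restrict (tsupport fun x => lineDeriv ℝ θ x e)) := by
      have : IsFiniteMeasure
          ((volume : Measure E3).restrict (tsupport fun x => lineDeriv ℝ θ x e)) :=
        ⟨by simpa using hdc.isCompact.measure_lt_top⟩
      exact (h1.restrict _).mono_exponent le_top
    have h4 := (memLp_indicator_iff_restrict (isClosed_tsupport _).measurableSet).2 h3
    rwa [indicator_eq_self.2 (subset_tsupport _)] at h4
  have hφ2 : ∀ n, MemLp (φ n) 2 (volume.restrict Ω) := fun n =>
    ((hφ n).1.continuous.memLp_of_hasCompactSupport (hφ n).2.1).restrict _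
  have hDφ2 : ∀ n, MemLp (fderiv ℝ (φ n)) 2 (volume.restrict Ω) := fun n =>
    (((hφ n).1.continuous_fderiv (by simp)).memLp_of_hasCompactSupport
      ((hφ n).2.1.fderiv ℝ)).restrict _
  have t1 := tendsto_integral_mul_of_tendsto_eLpNorm hd2 hv2 hφ2 hφv (innerSL ℝ w)
  have t2 := tendsto_integral_mul_of_tendsto_eLpNorm hθ2 hG2 hDφ2 hφG
    ((innerSL ℝ w).comp (ContinuousLinearMap.apply ℝ E3 e))
  simp only [innerSL_apply_apply, ContinuousLinearMap.comp_apply,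
    ContinuousLinearMap.apply_apply] at t1 t2
  refine tendsto_nhds_unique t1 (t2.neg.congr fun n => ?_)
  -- The approximants are compactly supported in `Ω`, so for them the integrals run over the whole
  -- space and the boundary of `Ω` plays no role. This is how the zero boundary value enters.
  have hz : ∀ x ∉ Ω, φ n x = 0 := fun x hx =>
    image_eq_zero_of_notMem_tsupport fun h => hx ((hφ n).2.2 h)
  have hdz : ∀ x ∉ Ω, fderiv ℝ (φ n) x = 0 := fun x hx =>
    image_eq_zero_of_notMem_tsupport fun h => hx ((hφ n).2.2 (tsupport_fderiv_subset ℝ h))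
  rw [setIntegral_eq_integral_of_forall_compl_eq_zero fun x hx => by simp [hdz x hx],
    setIntegral_eq_integral_of_forall_compl_eq_zero fun x hx => by simp [hz x hx]]
  have hw : ContDiff ℝ ∞ fun x => inner ℝ w (φ n x) := contDiff_const.inner ℝ (hφ n).1
  have hwc : HasCompactSupport fun x => inner ℝ w (φ n x) :=
    (hφ n).2.1.mono fun x hx h => hx (by simp [h])
  obtain ⟨D, hD⟩ := ContDiff.lipschitzWith_of_hasCompactSupport (n := ∞) hwc hw (by simp)
  have := hθ.integral_lineDeriv_mul_eq (μ := (volume : Measure E3)) hD hwc e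
  rw [this, ← integral_neg]
  congr 1
  ext x
  have hd : HasFDerivAt (φ n) (fderiv ℝ (φ n) x) x :=
    ((hφ n).1.differentiable (by simp) x).hasFDerivAt
  have hd' : HasFDerivAt (fun x => inner ℝ w (φ n x)) ((innerSL ℝ w).comp (fderiv ℝ (φ n) x)) x :=
    (innerSL ℝ w).hasFDerivAt.comp x hd
  rw [(hd'.hasLineDerivAt (-e)).lineDeriv]
  simp
  ring

/-- The weak gradient of a `W^{1,2}_0` field which is affine on an open set. -/
theorem MemW012.ae_eq_of_ae_eq_affine {Ω S : Set E3} {v : E3 → E3} {G : E3 → E3 →L[ℝ] E3}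
    (hv : MemW012 Ω v G) (hS : IsOpen S) (hSΩ : S ⊆ Ω) {c : E3} {A : E3 →L[ℝ] E3}
    (h : ∀ᵐ x ∂(volume.restrict S), v x = c + A x) (e w : E3) :
    ∀ᵐ x, x ∈ S → inner ℝ w (G x e) - inner ℝ w (A e) = 0 := by
  have hGi : LocallyIntegrableOn (fun x => inner ℝ w (G x e)) S := by
    have h1 : MemLp (fun x => ((innerSL ℝ w).comp (ContinuousLinearMap.apply ℝ E3 e)) (G x)) 2
        (volume.restrict S) :=
      (((innerSL ℝ w).comp (ContinuousLinearMap.apply ℝ E3 e)).comp_memLp' hv.2.1).mono_measure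
        (Measure.restrict_mono hSΩ le_rfl)
    exact locallyIntegrableOn_of_locallyIntegrable_restrict
      (h1.locallyIntegrable (by norm_num))
  -- By the fundamental lemma of the calculus of variations it suffices to test with smooth `g`
  -- supported in `S`. There the integration by parts for `v` and the one for the affine function
  -- have the same left side.
  refine hS.ae_eq_zero_of_integral_contDiff_smul_eq_zero
    (hGi.sub (continuousOn_const.locallyIntegrableOn hS.measurableSet)) fun g hg hgc hgs => ?_
  obtain ⟨D, hD⟩ := ContDiff.lipschitzWith_of_hasCompactSupport (n := ∞) hgc hg (by simp)
  have hz : ∀ x ∉ S, g x = 0 := fun x hx => image_eq_zero_of_notMem_tsupport fun h => hx (hgs h)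
  have hdz : ∀ x ∉ S, lineDeriv ℝ g x e = 0 := fun x hx => by
    rw [((hg.differentiable (by simp) x).hasFDerivAt.hasLineDerivAt e).lineDeriv]
    have : fderiv ℝ g x = 0 :=
      image_eq_zero_of_notMem_tsupport fun h => hx (hgs (tsupport_fderiv_subset ℝ h))
    simp [this]
  have i1 := hv.integral_lineDeriv_mul hD hgc e w
  have redS : ∀ (F : E3 → ℝ), (∀ x ∉ S, F x = 0) → ∫ x in Ω, F x = ∫ x in S, F x := by
    intro F hF
    rw [setIntegral_eq_integral_of_forall_compl_eq_zero fun x hx => hF x fun h => hx (hSΩ h),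
      setIntegral_eq_integral_of_forall_compl_eq_zero fun x hx => hF x hx]
  rw [redS _ fun x hx => by rw [hdz x hx, zero_mul],
    redS _ fun x hx => by rw [hz x hx, zero_mul]] at i1
  have i2 : ∫ x in S, lineDeriv ℝ g x e * inner ℝ w (v x) =
      ∫ x in S, lineDeriv ℝ g x e * (inner ℝ w c + inner ℝ w (A x)) := by
    refine integral_congr_ae ?_
    filter_upwards [h] with x hx
    rw [hx, inner_add_right]
  let f : E3 → ℝ := fun x => inner ℝ w c + inner ℝ w (A x)
  have hf : ∀ x, HasFDerivAt f ((innerSL ℝ w).comp A) x := fun x =>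
    ((innerSL ℝ w).comp A).hasFDerivAt.const_add _
  have hfl : LipschitzWith ‖(innerSL ℝ w).comp A‖₊ f := by
    refine lipschitzWith_of_nnnorm_fderiv_le (𝕜 := ℝ) (fun x => (hf x).differentiableAt) fun x => ?_
    rw [(hf x).fderiv]
  have i3 := hfl.integral_lineDeriv_mul_eq (μ := (volume : Measure E3)) hD hgc (-e)
  have i4 : ∀ x, lineDeriv ℝ f x (-e) = - inner ℝ w (A e) := fun x => by
    rw [((hf x).hasLineDerivAt (-e)).lineDeriv]; simp
  simp only [i4, neg_neg] at i3
  rw [i2, setIntegral_eq_integral_of_forall_compl_eq_zero fun x hx => by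
    rw [hdz x hx, zero_mul]] at i1
  have hGint : Integrable (fun x => g x * inner ℝ w (G x e)) (volume.restrict S) := by
    have := hGi.integrableOn_compact_subset hgs hgc.isCompact
    have h2 : IntegrableOn (fun x => g x * inner ℝ w (G x e)) (tsupport g) :=
      this.continuousOn_mul hg.continuous.continuousOn hgc.isCompact
    refine Integrable.restrict ?_
    refine (integrableOn_iff_integrable_of_support_subset ?_).1 h2
    intro x hx
    exact subset_tsupport _ fun h0 => hx (by simp [h0])
  have hcint : Integrable (fun x => g x * inner ℝ w (A e)) (volume : Measure E3) :=
    (hg.continuous.integrable_of_hasCompactSupport hgc).mul_const _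
  rw [← setIntegral_eq_integral_of_forall_compl_eq_zero (s := S) fun x hx => by
    rw [hz x hx, zero_smul]]
  simp only [smul_eq_mul, mul_sub]
  rw [integral_sub hGint hcint.restrict,
    setIntegral_eq_integral_of_forall_compl_eq_zero (s := S) (f := fun x => g x * inner ℝ w (A e))
      fun x hx => by rw [hz x hx, zero_mul]]
  have i5 : ∫ x, g x * inner ℝ w (A e) = ∫ x, inner ℝ w (A e) * g x := by
    simp only [mul_comm]
  have i6 : ∫ x, -inner ℝ w (A e) * g x = - ∫ x, inner ℝ w (A e) * g x := by
    simp only [neg_mul, integral_neg]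
  rw [i6] at i3
  rw [i5]
  simp only [f] at i3
  linarith

/-! ### Bounded Lipschitz functions and truncation. -/

/-- Bounded Lipschitz real functions; they form an algebra and a lattice. -/
def IsBddLip {α : Type*} [PseudoMetricSpace α] (f : α → ℝ) : Prop :=
  (∃ C : ℝ≥0, LipschitzWith C f) ∧ ∃ B : ℝ, ∀ x, |f x| ≤ B

namespace IsBddLip

variable {α β : Type*} [PseudoMetricSpace α] [PseudoMetricSpace β] {f g : α → ℝ}

theorem continuous (hf : IsBddLip f) : Continuous f := hf.1.choose_spec.continuous

theorem const (c : ℝ) : IsBddLip fun _ : α => c :=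
  ⟨⟨0, LipschitzWith.const c⟩, |c|, fun _ => le_rfl⟩

theorem add (hf : IsBddLip f) (hg : IsBddLip g) : IsBddLip fun x => f x + g x := by
  obtain ⟨⟨C, hC⟩, B, hB⟩ := hf
  obtain ⟨⟨C', hC'⟩, B', hB'⟩ := hg
  exact ⟨⟨_, hC.add hC'⟩, B + B', fun x => (abs_add_le _ _).trans (add_le_add (hB x) (hB' x))⟩

theorem neg (hf : IsBddLip f) : IsBddLip fun x => -f x := by
  obtain ⟨⟨C, hC⟩, B, hB⟩ := hf
  exact ⟨⟨_, hC.neg⟩, B, fun x => by rw [abs_neg]; exact hB x⟩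

theorem sub (hf : IsBddLip f) (hg : IsBddLip g) : IsBddLip fun x => f x - g x := by
  simpa only [sub_eq_add_neg] using hf.add hg.neg

/-- The product rule for increments needs bounds on both factors; this is why boundedness is part of
the notion. -/
theorem mul (hf : IsBddLip f) (hg : IsBddLip g) : IsBddLip fun x => f x * g x := by
  obtain ⟨⟨C, hC⟩, B, hB⟩ := hf
  obtain ⟨⟨C', hC'⟩, B', hB'⟩ := hg
  refine ⟨⟨Real.toNNReal B * C' + C * Real.toNNReal B', ?_⟩, B * B', fun x => ?_⟩
  · refine LipschitzWith.of_dist_le_mul fun x y => ?_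
    have h1 := hC.dist_le_mul x y
    have h2 := hC'.dist_le_mul x y
    rw [Real.dist_eq] at h1 h2 ⊢
    have hBp : 0 ≤ B := (abs_nonneg _).trans (hB x)
    have hBp' : 0 ≤ B' := (abs_nonneg _).trans (hB' x)
    calc |f x * g x - f y * g y| = |f x * (g x - g y) + (f x - f y) * g y| := by ring_nf
      _ ≤ |f x| * |g x - g y| + |f x - f y| * |g y| := by
          rw [← abs_mul, ← abs_mul]; exact abs_add_le _ _
      _ ≤ B * (C' * dist x y) + C * dist x y * B' := by
          gcongr
          · exact hB x
          · exact hB' y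
      _ = _ := by
          push_cast
          rw [Real.coe_toNNReal _ hBp, Real.coe_toNNReal _ hBp']
          ring
  · rw [abs_mul]
    exact mul_le_mul (hB x) (hB' x) (abs_nonneg _) ((abs_nonneg _).trans (hB x))

theorem comp (hf : IsBddLip f) {C : ℝ≥0} {k : β → α} (hk : LipschitzWith C k) :
    IsBddLip fun x => f (k x) := by
  obtain ⟨⟨C', hC'⟩, B, hB⟩ := hf
  exact ⟨⟨_, hC'.comp hk⟩, B, fun x => hB _⟩

theorem fst (hf : IsBddLip f) : IsBddLip fun x : α × β => f x.1 := hf.comp LipschitzWith.prod_fst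

theorem snd (hf : IsBddLip f) : IsBddLip fun x : β × α => f x.2 := hf.comp LipschitzWith.prod_snd

end IsBddLip

/-- The truncation of `x` to the interval `[-r, r]`. -/
noncomputable def clamp (r x : ℝ) : ℝ := max (-r) (min r x)

theorem abs_clamp_le {r : ℝ} (hr : 0 ≤ r) (x : ℝ) : |clamp r x| ≤ r := by
  unfold clamp; rw [abs_le]; constructor
  · exact le_max_left _ _
  · exact max_le (by linarith) (min_le_left _ _)

theorem clamp_of_abs_le {r x : ℝ} (h : |x| ≤ r) : clamp r x = x := by
  obtain ⟨h1, h2⟩ := abs_le.1 h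
  unfold clamp; rw [min_eq_right h2, max_eq_right h1]

theorem clamp_of_le {r x : ℝ} (hr : 0 ≤ r) (h : r ≤ x) : clamp r x = r := by
  unfold clamp; rw [min_eq_left h, max_eq_right (by linarith)]

theorem clamp_of_le_neg {r x : ℝ} (hr : 0 ≤ r) (h : x ≤ -r) : clamp r x = -r := by
  unfold clamp; rw [min_eq_right (by linarith), max_eq_left h]

theorem IsBddLip.clamp {α : Type*} [PseudoMetricSpace α] {r f : α → ℝ} (hr : IsBddLip r)
    (h0 : ∀ x, 0 ≤ r x) {C : ℝ≥0} (hf : LipschitzWith C f) :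
    IsBddLip fun x => clamp (r x) (f x) := by
  obtain ⟨⟨D, hD⟩, B, hB⟩ := hr
  refine ⟨⟨_, hD.neg.max (hD.min hf)⟩, B, fun x => ?_⟩
  exact (abs_clamp_le (h0 x) _).trans ((le_abs_self _).trans (hB x))

theorem hasDerivAt_clamp_of_lt {r x : ℝ} (h : |x| < r) : HasDerivAt (clamp r) 1 x := by
  refine (hasDerivAt_id x).congr_of_eventuallyEq ?_
  have : ∀ᶠ y in 𝓝 x, |y| < r := continuous_abs.continuousAt.eventually_lt continuousAt_const h
  filter_upwards [this] with y hy
  exact clamp_of_abs_le hy.le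

theorem hasDerivAt_clamp_of_gt {r x : ℝ} (hr : 0 ≤ r) (h : r < |x|) :
    HasDerivAt (clamp r) 0 x := by
  rcases lt_abs.1 h with h | h
  · refine (hasDerivAt_const x r).congr_of_eventuallyEq ?_
    filter_upwards [lt_mem_nhds h] with y hy
    exact clamp_of_le hr hy.le
  · refine (hasDerivAt_const x (-r)).congr_of_eventuallyEq ?_
    filter_upwards [gt_mem_nhds (show x < -r by linarith)] with y hy
    exact clamp_of_le_neg hr hy.le

/-! ### Vertical derivatives and the moment between two graphs. -/

theorem hasLineDerivAt_vertical {f : E2 × ℝ → ℝ} {f' : ℝ} {z : E2 × ℝ}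
    (h : HasDerivAt (fun s => f (z.1, s)) f' z.2) :
    HasLineDerivAt ℝ f f' z ((0 : E2), (1 : ℝ)) := by
  unfold HasLineDerivAt
  have h2 : HasDerivAt (fun t : ℝ => z.2 + t) 1 0 := (hasDerivAt_id 0).const_add _
  have h3 : HasDerivAt (fun s => f (z.1, s)) f' (z.2 + 0) := by simpa using h
  have := h3.comp (0 : ℝ) h2
  simp only [mul_one] at this
  refine this.congr_of_eventuallyEq (Eventually.of_forall fun t => ?_)
  simp only [Function.comp_apply]
  congr 1
  ext <;> simp

/-- By Fubini a graph is a null set. This discards the points at which truncated functions have a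
kink. -/
theorem ae_snd_ne_of_continuous {g : E2 → ℝ} (hg : Continuous g) :
    ∀ᵐ z : E2 × ℝ, z.2 ≠ g z.1 := by
  have hm : MeasurableSet {z : E2 × ℝ | z.2 = g z.1} :=
    (isClosed_eq continuous_snd (hg.comp continuous_fst)).measurableSet
  rw [ae_iff]
  simp only [not_not]
  rw [Measure.volume_eq_prod, Measure.measure_prod_null hm]
  refine Eventually.of_forall fun y => ?_
  have : Prod.mk y ⁻¹' {z : E2 × ℝ | z.2 = g z.1} = {g y} := by ext s; simp
  simp only [this, Pi.zero_apply]; simp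

theorem hasCompactSupport_of_bounds {θ : E2 × ℝ → ℝ} (σ B : ℝ)
    (h1 : ∀ z, σ < ‖z.1‖ → θ z = 0) (h2 : ∀ z, B < |z.2| → θ z = 0) : HasCompactSupport θ := by
  refine HasCompactSupport.intro
    ((isCompact_closedBall (0 : E2) σ).prod (isCompact_closedBall (0 : ℝ) B)) fun z hz => ?_
  by_contra h
  apply hz
  refine ⟨?_, ?_⟩
  · rw [mem_closedBall_zero_iff]; by_contra hc; exact h (h1 z (not_le.1 hc))
  · rw [mem_closedBall_zero_iff, Real.norm_eq_abs]; by_contra hc; exact h (h2 z (not_le.1 hc))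

/-- Integration by parts against the kernel `½ (d² - (s - c)²)`, which vanishes on the two graphs
`s = c ± d`: the first moment of a vertical derivative between the graphs is controlled by the
second derivative there. -/
theorem abs_integral_moment_le {σ P δ Dm Cm N : ℝ} (hδ : 0 < δ) {p c d : E2 → ℝ} (hp : IsBddLip p)
    (hp0 : ∀ y, σ ≤ ‖y‖ → p y = 0) (hpP : ∀ y, |p y| ≤ P) (hc : IsBddLip c) (hd : IsBddLip d)
    (hdδ : ∀ y, δ ≤ d y) (hdD : ∀ y, d y ≤ Dm) (hcC : ∀ y, |c y| ≤ Cm)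
    {G : E2 × ℝ → ℝ} (hG : LocallyIntegrable G)
    (hN : ∀ (θ : E2 × ℝ → ℝ) (C : ℝ≥0), LipschitzWith C θ → HasCompactSupport θ →
      (∀ z, σ ≤ ‖z.1‖ → θ z = 0) → tsupport θ ⊆ {z | |z.2 - c z.1| < d z.1} →
      ∀ B, (∀ z, |θ z| ≤ B) → |∫ z, lineDeriv ℝ θ z ((0 : E2), (1 : ℝ)) * G z| ≤ B * N) :
    |∫ z, {z : E2 × ℝ | |z.2 - c z.1| < d z.1}.indicator (fun z => p z.1 * (c z.1 - z.2)) z * G z|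
      ≤ P * (Dm ^ 2 / 2) * N := by
  have hP : 0 ≤ P := (abs_nonneg _).trans (hpP 0)
  have hDm : 0 < Dm := hδ.trans_le ((hdδ 0).trans (hdD 0))
  -- Shrinking the half-width `d` to `r = d - ε` moves the support strictly inside the gap, as `hN`
  -- demands. The denominator `n + 2` gives `ε < δ ≤ d` from `n = 0` on, so that `r > 0`.
  let ε : ℕ → ℝ := fun n => δ / (n + 2)
  have hε0 : ∀ n, 0 < ε n := fun n => by positivity
  have hεδ : ∀ n, ε n < δ := fun n => by
    apply div_lt_self hδ
    have : (0 : ℝ) ≤ n := by positivity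
    linarith
  have hεt : Tendsto ε atTop (𝓝 0) := by
    have : Tendsto (fun n : ℕ => (n : ℝ) + 2) atTop atTop :=
      tendsto_atTop_add_const_right _ _ tendsto_natCast_atTop_atTop
    exact this.const_div_atTop δ
  let r : ℕ → E2 → ℝ := fun n y => d y - ε n
  have hr0 : ∀ n y, 0 < r n y := fun n y => by have := hdδ y; have := hεδ n; simp only [r]; linarith
  have hrl : ∀ n, IsBddLip (r n) := fun n => hd.sub (IsBddLip.const _)
  obtain ⟨⟨Cc, hCc⟩, -⟩ := id hc
  let w : ℕ → E2 × ℝ → ℝ := fun n z => clamp (r n z.1) (z.2 - c z.1)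
  have hw : ∀ n, IsBddLip (w n) := fun n =>
    (hrl n).fst.clamp (fun z => (hr0 n z.1).le)
      (LipschitzWith.prod_snd.sub (hCc.comp LipschitzWith.prod_fst))
  -- Since `w` is `s - c` truncated at `± r`, the factor `½ (r² - w²)` is the kernel inside the
  -- strip and zero outside it.
  let θ : ℕ → E2 × ℝ → ℝ := fun n z =>
    p z.1 * (1 / 2 * (r n z.1 * r n z.1 - w n z * w n z))
  have hθ : ∀ n, IsBddLip (θ n) := fun n =>
    hp.fst.mul ((IsBddLip.const _).mul (((hrl n).fst.mul (hrl n).fst).sub ((hw n).mul (hw n))))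
  have hwout : ∀ n z, r n z.1 ≤ |z.2 - c z.1| → w n z * w n z = r n z.1 * r n z.1 := fun n z h => by
    rcases le_abs.1 h with h | h
    · simp only [w, clamp_of_le (hr0 n z.1).le h]
    · simp only [w, clamp_of_le_neg (hr0 n z.1).le (show z.2 - c z.1 ≤ -r n z.1 by linarith)]
      ring
  have hθ0 : ∀ n z, σ ≤ ‖z.1‖ → θ n z = 0 := fun n z h => by simp only [θ, hp0 z.1 h, zero_mul]
  have hθout : ∀ n z, r n z.1 ≤ |z.2 - c z.1| → θ n z = 0 := fun n z h => by
    simp only [θ, hwout n z h, sub_self, mul_zero]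
  have hθs : ∀ n, tsupport (θ n) ⊆ {z | |z.2 - c z.1| ≤ r n z.1} := fun n => by
    refine closure_minimal (fun z hz => ?_) ?_
    · by_contra h
      exact hz (hθout n z (not_le.1 h).le)
    · exact isClosed_le (by have := hc.continuous; fun_prop)
        (by have := (hrl n).continuous; fun_prop)
  have hθc : ∀ n, HasCompactSupport (θ n) := fun n =>
    hasCompactSupport_of_bounds σ (Cm + Dm) (fun z h => hθ0 n z h.le) fun z h => hθout n z (by
      have h1 := hcC z.1
      have h2 := hdD z.1
      have h3 := hε0 n
      have h4 : |z.2| - |c z.1| ≤ |z.2 - c z.1| := abs_sub_abs_le_abs_sub _ _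
      simp only [r]; linarith)
  have hθB : ∀ n z, |θ n z| ≤ P * (Dm ^ 2 / 2) := fun n z => by
    simp only [θ, abs_mul]
    refine mul_le_mul (hpP _) ?_ (by positivity) hP
    have h1 : |w n z| ≤ r n z.1 := abs_clamp_le (hr0 n z.1).le _
    have h2 : w n z * w n z ≤ r n z.1 * r n z.1 := by
      rw [← abs_mul_abs_self (w n z)]
      exact mul_self_le_mul_self (abs_nonneg _) h1
    have h3 : r n z.1 * r n z.1 ≤ Dm * Dm := by
      have := hdD z.1; have := hε0 n
      exact mul_self_le_mul_self (hr0 n z.1).le (by simp only [r]; linarith)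
    rw [abs_of_nonneg (sub_nonneg.2 h2), abs_of_nonneg (by norm_num)]
    nlinarith [mul_self_nonneg (w n z)]
  have hmain : ∀ n, |∫ z, lineDeriv ℝ (θ n) z ((0 : E2), (1 : ℝ)) * G z|
      ≤ P * (Dm ^ 2 / 2) * N := fun n => by
    obtain ⟨C, hC⟩ := (hθ n).1
    refine hN (θ n) C hC (hθc n) (hθ0 n) ((hθs n).trans fun z hz => ?_) _ (hθB n)
    have := hε0 n
    simp only [mem_ofPred_eq, r] at hz ⊢
    linarith
  let K : Set (E2 × ℝ) := Metric.closedBall (0 : E2) σ ×ˢ Metric.closedBall (0 : ℝ) (Cm + Dm)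
  have hK : IsCompact K := (isCompact_closedBall _ _).prod (isCompact_closedBall _ _)
  -- Away from the two graphs `s = c ± r` the derivative of the kernel is `c - s` inside the strip
  -- and `0` outside.
  have hder : ∀ n, ∀ᵐ z : E2 × ℝ, lineDeriv ℝ (θ n) z ((0 : E2), (1 : ℝ)) =
      {z : E2 × ℝ | |z.2 - c z.1| < r n z.1}.indicator (fun z => p z.1 * (c z.1 - z.2)) z := by
    intro n
    have c1 : Continuous fun y => c y + r n y := hc.continuous.add (hrl n).continuous
    have c2 : Continuous fun y => c y - r n y := hc.continuous.sub (hrl n).continuous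
    filter_upwards [ae_snd_ne_of_continuous c1, ae_snd_ne_of_continuous c2] with z h1 h2
    apply HasLineDerivAt.lineDeriv
    apply hasLineDerivAt_vertical
    have hs : HasDerivAt (fun s => s - c z.1) 1 z.2 := (hasDerivAt_id _).sub_const _
    rcases lt_trichotomy |z.2 - c z.1| (r n z.1) with h | h | h
    · rw [indicator_of_mem (by exact h)]
      have hwd : HasDerivAt (fun s => w n (z.1, s)) (1 * 1) z.2 :=
        HasDerivAt.comp (h₂ := clamp (r n z.1)) z.2 (hasDerivAt_clamp_of_lt h) hs
      have := ((((hwd.mul hwd).const_sub (r n z.1 * r n z.1)).const_mul (1 / 2)).const_mul (p z.1))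
      refine this.congr_deriv ?_
      have hwz : w n (z.1, z.2) = z.2 - c z.1 := clamp_of_abs_le h.le
      rw [hwz]; ring
    · exfalso
      rcases (abs_eq (hr0 n z.1).le).1 h with h | h
      · exact h1 (by linarith)
      · exact h2 (by linarith)
    · rw [indicator_of_notMem (by simpa using h.le)]
      have hwd : HasDerivAt (fun s => w n (z.1, s)) (0 * 1) z.2 :=
        HasDerivAt.comp (h₂ := clamp (r n z.1)) z.2 (hasDerivAt_clamp_of_gt (hr0 n z.1).le h) hs
      have := ((((hwd.mul hwd).const_sub (r n z.1 * r n z.1)).const_mul (1 / 2)).const_mul (p z.1))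
      refine this.congr_deriv ?_
      ring
  have hlim : Tendsto (fun n => ∫ z, lineDeriv ℝ (θ n) z ((0 : E2), (1 : ℝ)) * G z) atTop
      (𝓝 (∫ z, {z : E2 × ℝ | |z.2 - c z.1| < d z.1}.indicator
        (fun z => p z.1 * (c z.1 - z.2)) z * G z)) := by
    refine tendsto_integral_of_dominated_convergence (K.indicator fun z => P * Dm * ‖G z‖)
      ?_ ?_ ?_ ?_
    · intro n
      obtain ⟨C, hC⟩ := (hθ n).1
      exact (measurable_lineDeriv hC.continuous).aestronglyMeasurable.mul hG.aestronglyMeasurable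
    · rw [integrable_indicator_iff hK.measurableSet]
      exact (hG.integrableOn_isCompact hK).norm.const_mul _
    · intro n
      filter_upwards [hder n] with z hz
      rw [hz]
      by_cases hm : |z.2 - c z.1| < r n z.1
      · rw [indicator_of_mem (by exact hm)]
        by_cases hy : σ ≤ ‖z.1‖
        · rw [hp0 z.1 hy]
          simp only [zero_mul, norm_zero]
          exact indicator_nonneg (fun x _ => by positivity) _
        · have hzD : |z.2 - c z.1| ≤ Dm := by
            have := hdD z.1; have := hε0 n; simp only [r] at hm; linarith
          have hzK : z ∈ K := by
            refine ⟨?_, ?_⟩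
            · rw [mem_closedBall_zero_iff]; exact (not_le.1 hy).le
            · rw [mem_closedBall_zero_iff, Real.norm_eq_abs]
              have h1 := hcC z.1
              have h4 : |z.2| - |c z.1| ≤ |z.2 - c z.1| := abs_sub_abs_le_abs_sub _ _
              linarith
          rw [indicator_of_mem hzK, norm_mul, Real.norm_eq_abs, abs_mul, abs_sub_comm]
          gcongr
          exact hpP _
      · rw [indicator_of_notMem (by exact hm)]
        simp only [zero_mul, norm_zero]
        exact indicator_nonneg (fun x _ => by positivity) _
    -- The strips increase to the open gap, so for each point the indicators are eventually constant
    -- in `n`.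
    · filter_upwards [ae_all_iff.2 hder] with z hz
      refine Tendsto.mul_const _ ?_
      refine tendsto_const_nhds.congr' ?_
      by_cases hm : |z.2 - c z.1| < d z.1
      · have : ∀ᶠ n in atTop, ε n < d z.1 - |z.2 - c z.1| := hεt.eventually_lt_const (by linarith)
        filter_upwards [this] with n hn
        rw [hz n, indicator_of_mem (by exact hm), indicator_of_mem]
        simp only [mem_ofPred_eq, r]; linarith
      · refine Eventually.of_forall fun n => ?_
        simp only
        rw [hz n, indicator_of_notMem (by exact hm), indicator_of_notMem]
        have := hε0 n
        simp only [mem_ofPred_eq, r] at hm ⊢; linarith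
  exact le_of_tendsto hlim.abs (Eventually.of_forall hmain)

/-! ### The horizontal weight and its symmetries. -/

theorem hasDerivAt_max_zero_sq (x : ℝ) :
    HasDerivAt (fun x : ℝ => (max 0 x) ^ 2) (2 * max 0 x) x := by
  rcases lt_trichotomy x 0 with h | h | h
  · rw [max_eq_left h.le, mul_zero]
    refine (hasDerivAt_const x (0 : ℝ)).congr_of_eventuallyEq ?_
    filter_upwards [gt_mem_nhds h] with y hy
    rw [max_eq_left hy.le]; simp
  · subst h
    rw [max_self, mul_zero, hasDerivAt_iff_isLittleO]
    simp only [max_self, ne_eq, OfNat.ofNat_ne_zero, not_false_eq_true, zero_pow, sub_zero,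
      smul_eq_mul, mul_zero]
    have h1 : (fun x : ℝ => max 0 x ^ 2) =O[𝓝 0] fun x => x ^ 2 := by
      refine Asymptotics.IsBigO.of_bound 1 (Eventually.of_forall fun x => ?_)
      simp only [norm_pow, Real.norm_eq_abs, one_mul]
      refine pow_le_pow_left₀ (abs_nonneg _) ?_ 2
      rw [abs_of_nonneg (le_max_left _ _)]
      exact max_le (abs_nonneg _) (le_abs_self _)
    refine h1.trans_isLittleO ?_
    simpa using Asymptotics.isLittleO_pow_pow (𝕜 := ℝ) (show 1 < 2 by norm_num)
  · rw [max_eq_right h.le]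
    refine (by simpa using hasDerivAt_pow 2 x : HasDerivAt (fun x : ℝ => x ^ 2) (2 * x) x)
      |>.congr_of_eventuallyEq ?_
    filter_upwards [lt_mem_nhds h] with y hy
    rw [max_eq_right hy.le]

/-- The radial profile `(σ² - |y|²)₊` in the plane. -/
noncomputable def capWeight (σ : ℝ) (y : E2) : ℝ := max 0 (σ ^ 2 - ‖y‖ ^ 2)

/-- The partial derivatives of `capWeight σ ^ 2`. -/
noncomputable def capGrad (σ : ℝ) (i : Fin 2) (y : E2) : ℝ := -4 * y i * capWeight σ y

section capWeight

variable {σ : ℝ}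

theorem capWeight_nonneg (y : E2) : 0 ≤ capWeight σ y := le_max_left _ _

theorem capWeight_le (y : E2) : capWeight σ y ≤ σ ^ 2 :=
  max_le (sq_nonneg _) (by have := sq_nonneg ‖y‖; linarith)

theorem capWeight_eq_zero (hσ : 0 < σ) {y : E2} (hy : σ ≤ ‖y‖) : capWeight σ y = 0 := by
  unfold capWeight
  exact max_eq_left (by nlinarith)

theorem capWeight_neg (y : E2) : capWeight σ (-y) = capWeight σ y := by simp [capWeight]

theorem capGrad_neg (i : Fin 2) (y : E2) : capGrad σ i (-y) = - capGrad σ i y := by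
  simp [capGrad, capWeight_neg]

theorem capGrad_eq_zero (hσ : 0 < σ) (i : Fin 2) {y : E2} (hy : σ ≤ ‖y‖) : capGrad σ i y = 0 := by
  simp [capGrad, capWeight_eq_zero hσ hy]

theorem abs_apply_le_norm (y : E2) (i : Fin 2) : |y i| ≤ ‖y‖ := by
  simpa using PiLp.norm_apply_le y i

theorem abs_capGrad_le (hσ : 0 < σ) (i : Fin 2) (y : E2) : |capGrad σ i y| ≤ 4 * σ ^ 3 := by
  rcases le_or_gt σ ‖y‖ with h | h
  · rw [capGrad_eq_zero hσ i h]; simp; positivity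
  · rw [capGrad, abs_mul, abs_mul, abs_of_nonneg (capWeight_nonneg y)]
    calc |(-4 : ℝ)| * |y i| * capWeight σ y ≤ 4 * σ * σ ^ 2 := by
          have := capWeight_le (σ := σ) y
          have h2 := (abs_apply_le_norm y i).trans h.le
          have h3 : |(-4 : ℝ)| = 4 := by norm_num
          rw [h3]
          gcongr
          exact capWeight_nonneg y
      _ = _ := by ring

theorem isBddLip_capWeight (hσ : 0 < σ) : IsBddLip (capWeight σ) := by
  have h1 : IsBddLip fun y : E2 => min ‖y‖ σ := by
    refine ⟨⟨1, lipschitzWith_one_norm.min_const σ⟩, σ, fun y => ?_⟩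
    rw [abs_of_nonneg (le_min (norm_nonneg _) hσ.le)]
    exact min_le_right _ _
  have h2 := (IsBddLip.const (α := E2) (σ ^ 2)).sub (h1.mul h1)
  have h3 : capWeight σ = fun y : E2 => σ ^ 2 - min ‖y‖ σ * min ‖y‖ σ := by
    ext y
    unfold capWeight
    rcases le_total σ ‖y‖ with h | h
    · rw [min_eq_right h, max_eq_left (by nlinarith)]; ring
    · have := norm_nonneg y
      rw [min_eq_left h, max_eq_right (by nlinarith)]; ring
  rw [h3]; exact h2

theorem isBddLip_capGrad (hσ : 0 < σ) (i : Fin 2) : IsBddLip (capGrad σ i) := by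
  have hl : LipschitzWith 1 fun y : E2 => y i := LipschitzWith.of_dist_le_mul fun x y => by
    rw [Real.dist_eq, dist_eq_norm, NNReal.coe_one, one_mul]
    exact abs_apply_le_norm (x - y) i
  have h1 : IsBddLip fun y : E2 => clamp σ (y i) :=
    IsBddLip.clamp (IsBddLip.const σ) (fun _ => hσ.le) hl
  have h2 := ((IsBddLip.const (α := E2) (-4)).mul h1).mul (isBddLip_capWeight hσ)
  have h3 : capGrad σ i = fun y : E2 => -4 * clamp σ (y i) * capWeight σ y := by
    ext y
    unfold capGrad
    rcases le_total σ ‖y‖ with h | h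
    · rw [capWeight_eq_zero hσ h]; ring
    · rw [clamp_of_abs_le ((abs_apply_le_norm y i).trans h)]
  rw [h3]; exact h2

/-- Squaring the positive part removes its kink, so the partial derivatives exist at every point. -/
theorem hasDerivAt_capWeight_sq (y : E2) (i : Fin 2) :
    HasDerivAt (fun t : ℝ => capWeight σ (y + t • EuclideanSpace.single i 1) ^ 2)
      (capGrad σ i y) 0 := by
  have h1 : HasDerivAt (fun t : ℝ => y + t • EuclideanSpace.single i (1 : ℝ))
      ((1 : ℝ) • EuclideanSpace.single i (1 : ℝ)) 0 :=
    ((hasDerivAt_id (0 : ℝ)).smul_const _).const_add y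
  have h2 := (h1.norm_sq).const_sub (σ ^ 2)
  have h3 := HasDerivAt.comp (h₂ := fun x : ℝ => (max 0 x) ^ 2) (0 : ℝ)
    (hasDerivAt_max_zero_sq _) h2
  refine h3.congr_deriv ?_
  simp only [zero_smul, add_zero, one_smul, EuclideanSpace.inner_single_right]
  unfold capGrad capWeight
  simp
  ring

theorem integral_ball_const (σ c : ℝ) (hσ : 0 ≤ σ) :
    ∫ y : E2, (Metric.ball (0 : E2) σ).indicator (fun _ => c) y = Real.pi * σ ^ 2 * c := by
  rw [integral_indicator Metric.isOpen_ball.measurableSet, setIntegral_const,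
    Measure.real, EuclideanSpace.volume_ball_fin_two]
  simp [ENNReal.toReal_ofReal hσ, ENNReal.toReal_ofReal Real.pi_pos.le, mul_comm]

theorem integrable_ball_const (σ c : ℝ) :
    Integrable fun y : E2 => (Metric.ball (0 : E2) σ).indicator (fun _ => c) y := by
  rw [integrable_indicator_iff Metric.isOpen_ball.measurableSet]
  exact integrableOn_const Metric.isBounded_ball.measure_lt_top.ne

theorem abs_integral_le_of_support_ball {f : E2 → ℝ} {σ B : ℝ} (hσ : 0 ≤ σ)
    (h0 : ∀ y, σ ≤ ‖y‖ → f y = 0) (hB : ∀ y, ‖y‖ < σ → |f y| ≤ B) :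
    |∫ y, f y| ≤ Real.pi * σ ^ 2 * B := by
  rw [← integral_ball_const σ B hσ, ← Real.norm_eq_abs]
  refine norm_integral_le_of_norm_le (integrable_ball_const σ B) (Eventually.of_forall fun y => ?_)
  by_cases h : ‖y‖ < σ
  · rw [indicator_of_mem (by simpa using h)]; exact hB y h
  · rw [indicator_of_notMem (by simpa using h), h0 y (not_lt.1 h)]; simp

theorem integrable_of_support_ball {f : E2 → ℝ} (hf : Continuous f) {σ : ℝ}
    (h0 : ∀ y, σ ≤ ‖y‖ → f y = 0) : Integrable f := by
  refine hf.integrable_of_hasCompactSupport ?_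
  refine HasCompactSupport.intro (isCompact_closedBall (0 : E2) σ) fun y hy => h0 y ?_
  rw [mem_closedBall_zero_iff, not_le] at hy
  exact hy.le

theorem integral_eq_zero_of_odd {f : E2 → ℝ} (h : ∀ y, f (-y) = - f y) : ∫ y, f y = 0 := by
  have h1 := integral_neg_eq_self f (volume : Measure E2)
  simp only [h, integral_neg] at h1
  linarith

/-- On the disc of radius `σ / 2` the weight is at least `¾ σ²`; squaring and multiplying by the
area `π σ² / 4` gives the constant `9/64`. -/
theorem le_integral_capWeight_sq (hσ : 0 < σ) :
    9 / 64 * Real.pi * σ ^ 6 ≤ ∫ y : E2, capWeight σ y ^ 2 := by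
  have h1 := integral_ball_const (σ / 2) (9 / 16 * σ ^ 4) (by positivity)
  have h2 : ∫ y : E2, (Metric.ball (0 : E2) (σ / 2)).indicator (fun _ => 9 / 16 * σ ^ 4) y ≤
      ∫ y : E2, capWeight σ y ^ 2 := by
    refine integral_mono (integrable_ball_const _ _) ?_ fun y => ?_
    · refine integrable_of_support_ball (σ := σ) ((isBddLip_capWeight hσ).continuous.pow 2)
        fun y hy => ?_
      rw [capWeight_eq_zero hσ hy]; simp
    · by_cases h : ‖y‖ < σ / 2
      · rw [indicator_of_mem (by simpa using h)]
        have h3 : 3 / 4 * σ ^ 2 ≤ capWeight σ y := by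
          refine le_trans ?_ (le_max_right _ _)
          nlinarith [norm_nonneg y]
        calc 9 / 16 * σ ^ 4 = (3 / 4 * σ ^ 2) ^ 2 := by ring
          _ ≤ _ := pow_le_pow_left₀ (by positivity) h3 2
      · rw [indicator_of_notMem (by simpa using h)]
        positivity
  linarith

end capWeight

/-! ### The vertical cutoff and the flux identity in the gap. -/

theorem lineDeriv_eq_zero_of_notMem_tsupport {E : Type*} [NormedAddCommGroup E] [NormedSpace ℝ E]
    {θ : E → ℝ} {x : E} (hx : x ∉ tsupport θ) (e : E) : lineDeriv ℝ θ x e = 0 := by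
  have h0 : θ =ᶠ[𝓝 x] 0 := notMem_tsupport_iff_eventuallyEq.1 hx
  have hl : HasFDerivAt θ (0 : E →L[ℝ] ℝ) x :=
    (hasFDerivAt_const (0 : ℝ) x).congr_of_eventuallyEq h0
  simpa using (hl.hasLineDerivAt e).lineDeriv

theorem integrable_lineDeriv_mul {θ u : E2 × ℝ → ℝ} {C : ℝ≥0} (hθ : LipschitzWith C θ)
    (hc : HasCompactSupport θ) (hu : LocallyIntegrable u) (e : E2 × ℝ) :
    Integrable fun z => lineDeriv ℝ θ z e * u z := by
  have h1 : IntegrableOn (fun z => lineDeriv ℝ θ z e * u z) (tsupport θ) :=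
    (hu.integrableOn_isCompact hc.isCompact).bdd_mul (c := C * ‖e‖)
      (measurable_lineDeriv hθ.continuous).aestronglyMeasurable
      (Eventually.of_forall fun z => norm_lineDeriv_le_of_lipschitz ℝ hθ)
  refine (integrableOn_iff_integrable_of_support_subset fun z hz => ?_).1 h1
  by_contra h
  exact hz (by simp [lineDeriv_eq_zero_of_notMem_tsupport h])

theorem integrable_mul_of_hasCompactSupport {θ u : E2 × ℝ → ℝ} (hθ : Continuous θ)
    (hc : HasCompactSupport θ) (hu : LocallyIntegrable u) :
    Integrable fun z => θ z * u z := by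
  have h1 : IntegrableOn (fun z => θ z * u z) (tsupport θ) :=
    (hu.integrableOn_isCompact hc.isCompact).continuousOn_mul hθ.continuousOn hc.isCompact
  refine (integrableOn_iff_integrable_of_support_subset fun z hz => ?_).1 h1
  by_contra h
  exact hz (by simp [image_eq_zero_of_notMem_tsupport h])

/-- A smooth cutoff which equals `1` on `[-h/4, 5h/4]` and vanishes outside `(-h/2, 3h/2)`. -/
noncomputable def gapCutoff {h : ℝ} (hh : 0 < h) : ContDiffBump (h / 2) where
  rIn := 3 * h / 4
  rOut := h
  rIn_pos := by positivity
  rIn_lt_rOut := by linarith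

section gapCutoff

variable {h : ℝ} (hh : 0 < h)

theorem isBddLip_gapCutoff : IsBddLip fun s => gapCutoff hh s := by
  obtain ⟨C, hC⟩ := ContDiff.lipschitzWith_of_hasCompactSupport (n := ∞)
    (gapCutoff hh).hasCompactSupport (gapCutoff hh).contDiff (by simp)
  exact ⟨⟨C, hC⟩, 1, fun s => by
    rw [abs_of_nonneg (gapCutoff hh).nonneg]; exact (gapCutoff hh).le_one⟩

theorem hasDerivAt_gapCutoff (s : ℝ) :
    HasDerivAt (fun s => gapCutoff hh s) (deriv (fun s => gapCutoff hh s) s) s :=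
  ((gapCutoff hh).contDiff (n := 1)).differentiable (by simp) s |>.hasDerivAt

theorem continuous_deriv_gapCutoff : Continuous (deriv fun s => gapCutoff hh s) :=
  ((gapCutoff hh).contDiff (n := 1)).continuous_deriv (by simp)

theorem gapCutoff_eq_one {s : ℝ} (h1 : -(h / 4) ≤ s) (h2 : s ≤ 5 * h / 4) :
    gapCutoff hh s = 1 := by
  refine (gapCutoff hh).one_of_mem_closedBall ?_
  rw [Metric.mem_closedBall, Real.dist_eq, abs_le]
  simp only [gapCutoff]; constructor <;> linarith

theorem gapCutoff_eq_zero {s : ℝ} (h1 : s ≤ -(h / 2) ∨ 3 * h / 2 ≤ s) :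
    gapCutoff hh s = 0 := by
  refine (gapCutoff hh).zero_of_le_dist ?_
  rw [Real.dist_eq, le_abs]
  simp only [gapCutoff]
  rcases h1 with h1 | h1
  · right; linarith
  · left; linarith

theorem deriv_gapCutoff_eq_zero_of_mem {s : ℝ} (h1 : -(h / 4) < s) (h2 : s < 5 * h / 4) :
    deriv (fun s => gapCutoff hh s) s = 0 := by
  have : (fun s => gapCutoff hh s) =ᶠ[𝓝 s] fun _ => (1 : ℝ) := by
    filter_upwards [Ioo_mem_nhds h1 h2] with t ht
    exact gapCutoff_eq_one hh ht.1.le ht.2.le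
  rw [this.deriv_eq]; simp

theorem deriv_gapCutoff_eq_zero {s : ℝ} (h1 : s ≤ -(h / 2) ∨ 3 * h / 2 ≤ s) :
    deriv (fun s => gapCutoff hh s) s = 0 := by
  have : IsLocalMin (fun s => gapCutoff hh s) s :=
    Eventually.of_forall fun t => by
      simp only [gapCutoff_eq_zero hh h1]
      exact (gapCutoff hh).nonneg
  exact this.deriv_eq_zero

/-- The cutoff is `1` from `b` up to `5h/4`, so `b` enters only through `-b`. The remaining constant
is later annihilated by the odd horizontal weight. -/
theorem integral_gapCutoff {b : ℝ} (h1 : 3 * h / 4 ≤ b) (h2 : b ≤ 5 * h / 4) :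
    ∫ s in b..(3 * h / 2), gapCutoff hh s =
      (5 * h / 4 + ∫ s in (5 * h / 4)..(3 * h / 2), gapCutoff hh s) - b := by
  have hc : Continuous fun s => gapCutoff hh s := (isBddLip_gapCutoff hh).continuous
  rw [← intervalIntegral.integral_add_adjacent_intervals (b := 5 * h / 4)
    (hc.intervalIntegrable _ _) (hc.intervalIntegrable _ _)]
  have : ∫ s in b..(5 * h / 4), gapCutoff hh s = ∫ s in b..(5 * h / 4), (1 : ℝ) := by
    refine intervalIntegral.integral_congr fun s hs => ?_
    rw [uIcc_of_le h2] at hs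
    exact gapCutoff_eq_one hh (by linarith [hs.1]) hs.2
  rw [this]; simp; ring

/-- The integrand is the derivative of the cutoff times the affine function; only the lower end
contributes, where the cutoff equals `1`. -/
theorem integral_deriv_gapCutoff_mul_affine {b : ℝ} (h1 : 3 * h / 4 ≤ b) (h2 : b ≤ 5 * h / 4)
    (α β : ℝ) :
    ∫ s in b..(3 * h / 2), (deriv (fun s => gapCutoff hh s) s * (α + β * (s - h)) +
      gapCutoff hh s * β) = - (α + β * (b - h)) := by
  have hc : Continuous fun s => gapCutoff hh s := (isBddLip_gapCutoff hh).continuous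
  have hd : ∀ s, HasDerivAt (fun s => α + β * (s - h)) β s := fun s => by
    simpa using (((hasDerivAt_id s).sub_const h).const_mul β).const_add α
  rw [intervalIntegral.integral_eq_sub_of_hasDerivAt
    (f := fun s => gapCutoff hh s * (α + β * (s - h)))
    (fun s _ => (hasDerivAt_gapCutoff hh s).mul (hd s))]
  · rw [gapCutoff_eq_zero hh (Or.inr le_rfl), gapCutoff_eq_one hh (by linarith) h2]; ring
  · have := continuous_deriv_gapCutoff hh
    exact Continuous.intervalIntegrable (by fun_prop) _ _

theorem abs_integral_gapCutoff_mul_le {b : ℝ} (h1 : 3 * h / 4 ≤ b) (h2 : b ≤ 5 * h / 4) :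
    |∫ s in b..(3 * h / 2), gapCutoff hh s * (s - h)| ≤ 3 / 8 * h ^ 2 := by
  have := intervalIntegral.norm_integral_le_of_norm_le_const (a := b) (b := 3 * h / 2)
    (f := fun s => gapCutoff hh s * (s - h)) (C := h / 2) fun s hs => by
      rw [uIoc_of_le (by linarith)] at hs
      rw [norm_mul, Real.norm_of_nonneg (gapCutoff hh).nonneg, Real.norm_eq_abs]
      have h3 : |s - h| ≤ h / 2 := abs_le.2 ⟨by linarith [hs.1], by linarith [hs.2]⟩
      calc gapCutoff hh s * |s - h| ≤ 1 * (h / 2) :=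
            mul_le_mul (gapCutoff hh).le_one h3 (abs_nonneg _) zero_le_one
        _ = h / 2 := one_mul _
  rw [Real.norm_eq_abs] at this
  refine this.trans ?_
  rw [abs_of_nonneg (by linarith)]
  nlinarith

end gapCutoff

/-- The contribution of the rigid body to the flux identity, on a vertical line. -/
theorem integral_rigid_profile {h : ℝ} (hh : 0 < h) {b d : ℝ} (h1 : 3 * h / 4 ≤ b)
    (h2 : b ≤ 5 * h / 4) (p0 p1 q α0 α1 α2 β0 β1 : ℝ) :
    ∫ s in b..(3 * h / 2),
      (gapCutoff hh s * (p0 * (α0 + β0 * (s - h)) + p1 * (α1 + β1 * (s - h)))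
        - d * (p0 * (deriv (fun s => gapCutoff hh s) s * (α0 + β0 * (s - h)) + gapCutoff hh s * β0)
          + p1 * (deriv (fun s => gapCutoff hh s) s * (α1 + β1 * (s - h)) + gapCutoff hh s * β1))
        + q * deriv (fun s => gapCutoff hh s) s * α2) =
      (p0 * α0 + p1 * α1) *
        ((5 * h / 4 + ∫ s in (5 * h / 4)..(3 * h / 2), gapCutoff hh s) - b + d)
      + (p0 * β0 + p1 * β1) *
        ((∫ s in b..(3 * h / 2), gapCutoff hh s * (s - h)) + d * (b - h)) - q * α2 := by
  have hc : Continuous fun s => gapCutoff hh s := (isBddLip_gapCutoff hh).continuous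
  have hdc := continuous_deriv_gapCutoff hh
  have e1 := integral_deriv_gapCutoff_mul_affine hh h1 h2 α0 β0
  have e2 := integral_deriv_gapCutoff_mul_affine hh h1 h2 α1 β1
  have e3 := integral_deriv_gapCutoff_mul_affine hh h1 h2 α2 0
  have e4 := integral_gapCutoff hh h1 h2
  simp only [zero_mul, add_zero, mul_zero] at e3
  have i1 : IntervalIntegrable (fun s => deriv (fun s => gapCutoff hh s) s * (α0 + β0 * (s - h)) + gapCutoff hh s * β0) volume b
      (3 * h / 2) := Continuous.intervalIntegrable (by fun_prop) _ _
  have i2 : IntervalIntegrable (fun s => deriv (fun s => gapCutoff hh s) s * (α1 + β1 * (s - h)) + gapCutoff hh s * β1) volume b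
      (3 * h / 2) := Continuous.intervalIntegrable (by fun_prop) _ _
  have i3 : IntervalIntegrable (fun s => deriv (fun s => gapCutoff hh s) s * α2) volume b (3 * h / 2) :=
    Continuous.intervalIntegrable (by fun_prop) _ _
  have i4 : IntervalIntegrable (fun s => gapCutoff hh s) volume b (3 * h / 2) := hc.intervalIntegrable _ _
  have i5 : IntervalIntegrable (fun s => gapCutoff hh s * (s - h)) volume b (3 * h / 2) :=
    Continuous.intervalIntegrable (by fun_prop) _ _
  have key : ∀ s, (gapCutoff hh s * (p0 * (α0 + β0 * (s - h)) + p1 * (α1 + β1 * (s - h)))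
        - d * (p0 * (deriv (fun s => gapCutoff hh s) s * (α0 + β0 * (s - h)) + gapCutoff hh s * β0)
          + p1 * (deriv (fun s => gapCutoff hh s) s * (α1 + β1 * (s - h)) + gapCutoff hh s * β1)) + q * deriv (fun s => gapCutoff hh s) s * α2) =
      ((((p0 * α0 + p1 * α1) * gapCutoff hh s + (p0 * β0 + p1 * β1) * (gapCutoff hh s * (s - h)))
        + (-d * p0) * (deriv (fun s => gapCutoff hh s) s * (α0 + β0 * (s - h)) + gapCutoff hh s * β0))
        + (-d * p1) * (deriv (fun s => gapCutoff hh s) s * (α1 + β1 * (s - h)) + gapCutoff hh s * β1)) + q * (deriv (fun s => gapCutoff hh s) s * α2) :=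
    fun s => by ring
  simp only [key]
  rw [intervalIntegral.integral_add
      ((((i4.const_mul _).add (i5.const_mul _)).add (i1.const_mul _)).add (i2.const_mul _))
      (i3.const_mul _),
    intervalIntegral.integral_add (((i4.const_mul _).add (i5.const_mul _)).add (i1.const_mul _))
      (i2.const_mul _),
    intervalIntegral.integral_add ((i4.const_mul _).add (i5.const_mul _)) (i1.const_mul _),
    intervalIntegral.integral_add (i4.const_mul _) (i5.const_mul _)]
  simp only [intervalIntegral.integral_const_mul]
  rw [e1, e2, e3, e4]
  ring

/-- The flux estimate in the gap between two graphs `s = a(y)` and `s = b(y)`: a divergence free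
field which vanishes below the gap and is a rigid velocity field above it. -/
theorem gap_flux_estimate {h σ N : ℝ} (hh : 0 < h) (hσ : 0 < σ) {a b : E2 → ℝ} {La Lb : ℝ≥0}
    (hal : LipschitzWith La a) (hbl : LipschitzWith Lb b)
    (ha : ∀ y, |a y| ≤ h / 4) (hb : ∀ y, |b y - h| ≤ h / 4)
    (hao : ∀ y, ‖y‖ < σ → |a y - a (-y)| ≤ h * σ / 4)
    (hbo : ∀ y, ‖y‖ < σ → |b y - b (-y)| ≤ h * σ / 4)
    {u : Fin 3 → E2 × ℝ → ℝ} {G : Fin 2 → E2 × ℝ → ℝ} {W : Fin 3 → ℝ} {A : Fin 3 → Fin 3 → ℝ}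
    (hA : ∀ i j, A i j = - A j i)
    (hu : ∀ i, LocallyIntegrable (u i)) (hG : ∀ i, LocallyIntegrable (G i))
    (hout : ∀ᵐ z : E2 × ℝ, ‖z.1‖ < σ → -(h / 2) < z.2 → z.2 < a z.1 →
      (∀ i, u i z = 0) ∧ ∀ i, G i z = 0)
    (hbody : ∀ᵐ z : E2 × ℝ, ‖z.1‖ < σ → b z.1 < z.2 → z.2 < 3 * h / 2 →
      (∀ i, u i z = W i + A i 0 * z.1 0 + A i 1 * z.1 1 + A i 2 * (z.2 - h)) ∧
        ∀ i : Fin 2, G i z = A i.castSucc 2)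
    (hdiv : ∀ (θ : E2 × ℝ → ℝ) (C : ℝ≥0), LipschitzWith C θ → HasCompactSupport θ →
      (∫ z, lineDeriv ℝ θ z (EuclideanSpace.single 0 1, (0 : ℝ)) * u 0 z) +
      (∫ z, lineDeriv ℝ θ z (EuclideanSpace.single 1 1, (0 : ℝ)) * u 1 z) +
      (∫ z, lineDeriv ℝ θ z ((0 : E2), (1 : ℝ)) * u 2 z) = 0)
    (hibp : ∀ (i : Fin 2) (θ : E2 × ℝ → ℝ) (C : ℝ≥0), LipschitzWith C θ → HasCompactSupport θ →
      ∫ z, lineDeriv ℝ θ z ((0 : E2), (1 : ℝ)) * u i.castSucc z = - ∫ z, θ z * G i z)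
    (hN : ∀ (i : Fin 2) (θ : E2 × ℝ → ℝ) (C : ℝ≥0), LipschitzWith C θ → HasCompactSupport θ →
      (∀ z, σ ≤ ‖z.1‖ → θ z = 0) → tsupport θ ⊆ {z | a z.1 < z.2 ∧ z.2 < b z.1} →
      ∀ B, (∀ z, |θ z| ≤ B) → |∫ z, lineDeriv ℝ θ z ((0 : E2), (1 : ℝ)) * G i z| ≤ B * N) :
    |W 2| * (9 / 64 * Real.pi * σ ^ 6) ≤ 9 / 4 * σ ^ 3 * h ^ 2 * N +
      Real.pi / 2 * h * σ ^ 6 * (|W 0| + |W 1|) +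
      4 * Real.pi * σ ^ 5 * h ^ 2 * (|A 0 2| + |A 1 2|) := by
  have hal' : IsBddLip a := ⟨⟨_, hal⟩, _, ha⟩
  have hbl' : IsBddLip b := ⟨⟨_, hbl⟩, h / 4 + h, fun y => by
    have := abs_le.1 (hb y); rw [abs_le]; constructor <;> linarith⟩
  -- Midline and half-width: the gap is `|s - c| < d`, with `h/4 ≤ d ≤ 3h/4`.
  set c : E2 → ℝ := fun y => 1 / 2 * (a y + b y) with hc
  set d : E2 → ℝ := fun y => 1 / 2 * (b y - a y) with hd
  have hcl : IsBddLip c := (IsBddLip.const _).mul (hal'.add hbl')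
  have hdl : IsBddLip d := (IsBddLip.const _).mul (hbl'.sub hal')
  have hdδ : ∀ y, h / 4 ≤ d y := fun y => by
    have h1 := abs_le.1 (ha y); have h2 := abs_le.1 (hb y); simp only [hd]; linarith
  have hdD : ∀ y, d y ≤ 3 * h / 4 := fun y => by
    have h1 := abs_le.1 (ha y); have h2 := abs_le.1 (hb y); simp only [hd]; linarith
  have hcC : ∀ y, |c y| ≤ 3 * h / 4 := fun y => by
    have h1 := abs_le.1 (ha y); have h2 := abs_le.1 (hb y); rw [abs_le]
    simp only [hc]; constructor <;> linarith
  have hd0 : ∀ y, 0 ≤ d y := fun y => by have := hdδ y; linarith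
  have hb1 : ∀ y, 3 * h / 4 ≤ b y := fun y => by have := abs_le.1 (hb y); linarith
  have hb2 : ∀ y, b y ≤ 5 * h / 4 := fun y => by have := abs_le.1 (hb y); linarith
  have hgap : {z : E2 × ℝ | |z.2 - c z.1| < d z.1} = {z | a z.1 < z.2 ∧ z.2 < b z.1} := by
    ext z
    simp only [mem_ofPred_eq, abs_lt, hc, hd]
    constructor <;> rintro ⟨h1, h2⟩ <;> constructor <;> linarith
  let p : Fin 2 → E2 → ℝ := capGrad σ
  have hpl : ∀ i, IsBddLip (p i) := isBddLip_capGrad hσ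
  let χ : ℝ → ℝ := fun s => gapCutoff hh s
  have hχl : IsBddLip χ := isBddLip_gapCutoff hh
  let ψ : E2 → ℝ := fun y => capWeight σ y * capWeight σ y
  have hψl : IsBddLip ψ := (isBddLip_capWeight hσ).mul (isBddLip_capWeight hσ)
  have hψ0 : ∀ y, σ ≤ ‖y‖ → ψ y = 0 := fun y hy => by simp [ψ, capWeight_eq_zero hσ hy]
  have hp0 : ∀ i y, σ ≤ ‖y‖ → p i y = 0 := fun i y hy => capGrad_eq_zero hσ i hy
  -- moments over the gap
  let T : Fin 2 → E2 × ℝ → ℝ := fun i z =>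
    {z : E2 × ℝ | |z.2 - c z.1| < d z.1}.indicator (fun z => p i z.1 * (c z.1 - z.2)) z * G i z
  have hT : ∀ i, |∫ z, T i z| ≤ 9 / 8 * σ ^ 3 * h ^ 2 * N := fun i => by
    have := abs_integral_moment_le (σ := σ) (P := 4 * σ ^ 3) (δ := h / 4) (Dm := 3 * h / 4)
      (Cm := 3 * h / 4) (N := N) (by positivity) (hpl i) (hp0 i) (abs_capGrad_le hσ i) hcl hdl
      hdδ hdD hcC (hG i) (by rw [hgap]; exact hN i)
    refine this.trans (le_of_eq ?_)
    ring
  let K : Set (E2 × ℝ) := Metric.closedBall (0 : E2) σ ×ˢ Metric.closedBall (0 : ℝ) (3 * h / 2)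
  have hK : IsCompact K := (isCompact_closedBall _ _).prod (isCompact_closedBall _ _)
  have hTi : ∀ i, Integrable (T i) := fun i => by
    have hcont : Continuous fun z : E2 × ℝ => p i z.1 * (c z.1 - z.2) := by
      have := (hpl i).continuous; have := hcl.continuous; fun_prop
    have h1 : IntegrableOn (fun z => p i z.1 * (c z.1 - z.2) * G i z) K :=
      ((hG i).integrableOn_isCompact hK).continuousOn_mul hcont.continuousOn hK
    have hopen : IsOpen {z : E2 × ℝ | |z.2 - c z.1| < d z.1} := by
      have := hdl.continuous; have := hcl.continuous
      exact isOpen_lt (by fun_prop) (by fun_prop)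
    have h2 := (integrable_indicator_iff (hopen.measurableSet.inter hK.measurableSet)).2
      (h1.mono_set (inter_subset_right (s := {z : E2 × ℝ | |z.2 - c z.1| < d z.1})))
    refine h2.congr (Eventually.of_forall fun z => ?_)
    simp only [T]
    by_cases hz : |z.2 - c z.1| < d z.1
    · rw [indicator_of_mem (s := {z : E2 × ℝ | |z.2 - c z.1| < d z.1}) hz]
      by_cases hy : ‖z.1‖ ≤ σ
      · have hzK : z ∈ K := by
          refine ⟨by simpa using hy, ?_⟩
          rw [mem_closedBall_zero_iff, Real.norm_eq_abs]
          have h1 := hcC z.1; have h2 := hdD z.1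
          have h4 : |z.2| - |c z.1| ≤ |z.2 - c z.1| := abs_sub_abs_le_abs_sub _ _
          linarith
        rw [indicator_of_mem (show z ∈ {z : E2 × ℝ | |z.2 - c z.1| < d z.1} ∩ K from ⟨hz, hzK⟩)]
      · have : p i z.1 = 0 := hp0 i z.1 (not_le.1 hy).le
        simp [this]
    · rw [indicator_of_notMem (s := {z : E2 × ℝ | |z.2 - c z.1| < d z.1}) hz,
        indicator_of_notMem fun h => hz h.1]
      simp
  -- the flux test function
  let θ : E2 × ℝ → ℝ := fun z => ψ z.1 * χ z.2
  have hθl : IsBddLip θ := hψl.fst.mul hχl.snd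
  have hχ0 : ∀ s, 3 * h / 2 < |s| → χ s = 0 := fun s hs => gapCutoff_eq_zero hh (by
    rcases lt_abs.1 hs with h1 | h1
    · right; linarith
    · left; linarith)
  have hθc : HasCompactSupport θ := hasCompactSupport_of_bounds σ (3 * h / 2)
    (fun z hz => by simp [θ, hψ0 _ hz.le]) fun z hz => by simp [θ, hχ0 _ hz]
  have hθd : ∀ i z, lineDeriv ℝ θ z (EuclideanSpace.single i 1, (0 : ℝ)) = p i z.1 * χ z.2 := by
    intro i z
    apply HasLineDerivAt.lineDeriv
    unfold HasLineDerivAt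
    have := (hasDerivAt_capWeight_sq (σ := σ) z.1 i).mul_const (χ z.2)
    refine this.congr_of_eventuallyEq (Eventually.of_forall fun t => ?_)
    simp [θ, ψ, sq]
  have hθd3 : ∀ z, lineDeriv ℝ θ z ((0 : E2), (1 : ℝ)) = ψ z.1 * deriv χ z.2 := by
    intro z
    apply HasLineDerivAt.lineDeriv
    apply hasLineDerivAt_vertical
    exact (hasDerivAt_gapCutoff hh z.2).const_mul (ψ z.1)
  obtain ⟨Cθ, hCθ⟩ := hθl.1
  have F0 := hdiv θ Cθ hCθ hθc
  have I0 := fun e i => integrable_lineDeriv_mul hCθ hθc (hu i) e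
  -- the test functions for the vertical derivative
  obtain ⟨⟨Cc, hCc⟩, -⟩ := id hcl
  let w : E2 × ℝ → ℝ := fun z => clamp (d z.1) (z.2 - c z.1)
  have hw : IsBddLip w := hdl.fst.clamp (fun z => hd0 z.1)
      (LipschitzWith.prod_snd.sub (hCc.comp LipschitzWith.prod_fst))
  -- In the gap `χ = 1` and the vertical derivative of `M` is `-p`. Adding the integration by parts
  -- for `M` to the flux identity therefore cancels the flux `p u` and leaves the first moment `p (c
  -- - s) G`. Truncating `w` at `± d` makes `M` Lipschitz on the whole space, so that no boundary
  -- terms arise at the graphs.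
  let M : Fin 2 → E2 × ℝ → ℝ := fun i z => p i z.1 * (χ z.2 * -w z)
  have hMl : ∀ i, IsBddLip (M i) := fun i => (hpl i).fst.mul (hχl.snd.mul hw.neg)
  have hMc : ∀ i, HasCompactSupport (M i) := fun i => hasCompactSupport_of_bounds σ (3 * h / 2)
    (fun z hz => by simp [M, hp0 i _ hz.le]) fun z hz => by simp [M, hχ0 _ hz]
  have F1 : ∀ i, ∫ z, (lineDeriv ℝ (M i) z ((0 : E2), (1 : ℝ)) * u i.castSucc z + M i z * G i z)
      = 0 := fun i => by
    obtain ⟨C, hC⟩ := (hMl i).1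
    rw [integral_add (integrable_lineDeriv_mul hC (hMc i) (hu _) _)
      (integrable_mul_of_hasCompactSupport hC.continuous (hMc i) (hG i)), hibp i _ C hC (hMc i)]
    ring
  have I1 : ∀ i, Integrable fun z =>
      lineDeriv ℝ (M i) z ((0 : E2), (1 : ℝ)) * u i.castSucc z + M i z * G i z := fun i => by
    obtain ⟨C, hC⟩ := (hMl i).1
    exact (integrable_lineDeriv_mul hC (hMc i) (hu _) _).add
      (integrable_mul_of_hasCompactSupport hC.continuous (hMc i) (hG i))
  have hMd : ∀ i (z : E2 × ℝ), |z.2 - c z.1| < d z.1 → lineDeriv ℝ (M i) z ((0 : E2), (1 : ℝ)) =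
      p i z.1 * (deriv χ z.2 * -(z.2 - c z.1) - χ z.2) := fun i z hz => by
    apply HasLineDerivAt.lineDeriv
    apply hasLineDerivAt_vertical
    have hs : HasDerivAt (fun s => s - c z.1) 1 z.2 := (hasDerivAt_id _).sub_const _
    have hwd : HasDerivAt (fun s => w (z.1, s)) (1 * 1) z.2 :=
      HasDerivAt.comp (h₂ := clamp (d z.1)) z.2 (hasDerivAt_clamp_of_lt hz) hs
    refine (((hasDerivAt_gapCutoff hh z.2).mul hwd.neg).const_mul (p i z.1)).congr_deriv ?_
    have hwz : w (z.1, z.2) = z.2 - c z.1 := clamp_of_abs_le hz.le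
    simp only [Pi.neg_apply, hwz, χ]; ring
  have hMd' : ∀ i (z : E2 × ℝ), d z.1 < |z.2 - c z.1| → lineDeriv ℝ (M i) z ((0 : E2), (1 : ℝ)) =
      p i z.1 * (deriv χ z.2 * -w z) := fun i z hz => by
    apply HasLineDerivAt.lineDeriv
    apply hasLineDerivAt_vertical
    have hs : HasDerivAt (fun s => s - c z.1) 1 z.2 := (hasDerivAt_id _).sub_const _
    have hwd : HasDerivAt (fun s => w (z.1, s)) (0 * 1) z.2 :=
      HasDerivAt.comp (h₂ := clamp (d z.1)) z.2 (hasDerivAt_clamp_of_gt (hd0 _) hz) hs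
    refine (((hasDerivAt_gapCutoff hh z.2).mul hwd.neg).const_mul (p i z.1)).congr_deriv ?_
    simp only [Pi.neg_apply, χ]; ring
  -- the sum of the two identities
  let L : E2 × ℝ → ℝ := fun z =>
    ((lineDeriv ℝ θ z (EuclideanSpace.single 0 1, (0 : ℝ)) * u 0 z +
      lineDeriv ℝ θ z (EuclideanSpace.single 1 1, (0 : ℝ)) * u 1 z) +
      lineDeriv ℝ θ z ((0 : E2), (1 : ℝ)) * u 2 z) +
    ((lineDeriv ℝ (M 0) z ((0 : E2), (1 : ℝ)) * u (Fin.castSucc 0) z + M 0 z * G 0 z) +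
     (lineDeriv ℝ (M 1) z ((0 : E2), (1 : ℝ)) * u (Fin.castSucc 1) z + M 1 z * G 1 z))
  have hLi : Integrable L := (((I0 _ 0).add (I0 _ 1)).add (I0 _ 2)).add ((I1 0).add (I1 1))
  have hL0 : ∫ z, L z = 0 := by
    simp only [L]
    rw [integral_add (((I0 _ 0).fun_add (I0 _ 1)).fun_add (I0 _ 2)) ((I1 0).fun_add (I1 1)),
      integral_add ((I0 _ 0).fun_add (I0 _ 1)) (I0 _ 2), integral_add (I0 _ 0) (I0 _ 1),
      integral_add (I1 0) (I1 1), F0, F1, F1]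
    ring
  let α : Fin 3 → E2 → ℝ := fun i y => W i + A i 0 * y 0 + A i 1 * y 1
  -- The form of the integrand `L` inside the body, where `w = d` and the field is affine.
  let Bd : E2 → ℝ → ℝ := fun y s =>
    (χ s * (p 0 y * (α 0 y + A 0 2 * (s - h)) + p 1 y * (α 1 y + A 1 2 * (s - h)))
        - d y * (p 0 y * (deriv χ s * (α 0 y + A 0 2 * (s - h)) + χ s * A 0 2)
          + p 1 y * (deriv χ s * (α 1 y + A 1 2 * (s - h)) + χ s * A 1 2))
        + ψ y * deriv χ s * α 2 y)
  let E : E2 × ℝ → ℝ := {z : E2 × ℝ | b z.1 < z.2}.indicator fun z => Bd z.1 z.2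
  have hA22 : A 2 2 = 0 := by have := hA 2 2; linarith
  -- For `|y| ≥ σ` the weights vanish; below the wall the field or the cutoff vanishes; in the gap
  -- `χ = 1` and `χ' = 0`; above the gap the field is rigid until the cutoff ends at `3h/2`.
  have hLE : ∀ᵐ z : E2 × ℝ, L z = T 0 z + T 1 z + E z := by
    filter_upwards [hout, hbody, ae_snd_ne_of_continuous hal'.continuous,
      ae_snd_ne_of_continuous hbl'.continuous] with z ho hbd ha' hb'
    have hza := abs_le.1 (ha z.1)
    have hzb := abs_le.1 (hb z.1)
    have hcd : ∀ {s t : ℝ}, χ s = 0 → deriv χ s = 0 → Bd z.1 s = 0 := fun h1 h2 => by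
      simp only [Bd, h1, h2]; ring
    by_cases hy : σ ≤ ‖z.1‖
    · have hM0 : ∀ i, M i z = 0 := fun i => by simp [M, hp0 i _ hy]
      have hMd0 : ∀ i, lineDeriv ℝ (M i) z ((0 : E2), (1 : ℝ)) = 0 := fun i => by
        rcases lt_trichotomy |z.2 - c z.1| (d z.1) with h1 | h1 | h1
        · rw [hMd i z h1, hp0 i _ hy, zero_mul]
        · exfalso
          rcases (abs_eq (hd0 _)).1 h1 with h1 | h1
          · exact hb' (by simp only [hc, hd] at h1; linarith)
          · exact ha' (by simp only [hc, hd] at h1; linarith)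
        · rw [hMd' i z h1, hp0 i _ hy, zero_mul]
      simp only [L, hM0, hMd0, hθd, hθd3, hp0 _ _ hy, hψ0 _ hy, T, E, Bd, indicator_apply]
      simp
    · rw [not_le] at hy
      rcases lt_or_gt_of_ne ha' with h1 | h1
      · have hng : ¬ |z.2 - c z.1| < d z.1 := fun h => by
          have := (abs_lt.1 h).1; simp only [hc, hd] at this; linarith
        have hnb : ¬ b z.1 < z.2 := by linarith
        have hTE : T 0 z + T 1 z + E z = 0 := by
          simp only [T, E]
          rw [indicator_of_notMem (s := {z : E2 × ℝ | |z.2 - c z.1| < d z.1}) hng,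
            indicator_of_notMem (s := {z : E2 × ℝ | |z.2 - c z.1| < d z.1}) hng,
            indicator_of_notMem (s := {z : E2 × ℝ | b z.1 < z.2}) hnb]
          ring
        rw [hTE]
        by_cases h2 : -(h / 2) < z.2
        · obtain ⟨hu0, hG0⟩ := ho hy h2 h1
          simp only [L, hu0, hG0]; ring
        · have hχz : χ z.2 = 0 := gapCutoff_eq_zero hh (Or.inl (not_lt.1 h2))
          have hχd : deriv χ z.2 = 0 := deriv_gapCutoff_eq_zero hh (Or.inl (not_lt.1 h2))
          have hg' : d z.1 < |z.2 - c z.1| := lt_abs.2 (Or.inr (by simp only [hc, hd]; linarith))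
          simp only [L, hMd' _ z hg', hθd, hθd3, M, hχz, hχd]; ring
      · rcases lt_or_gt_of_ne hb' with h2 | h2
        · have hg : |z.2 - c z.1| < d z.1 := by
            rw [abs_lt]; simp only [hc, hd]; constructor <;> linarith
          have hχz : χ z.2 = 1 := gapCutoff_eq_one hh (by linarith) (by linarith)
          have hχd : deriv χ z.2 = 0 :=
            deriv_gapCutoff_eq_zero_of_mem hh (by linarith) (by linarith)
          have hwz : w z = z.2 - c z.1 := clamp_of_abs_le hg.le
          simp only [T, E]
          rw [indicator_of_mem (s := {z : E2 × ℝ | |z.2 - c z.1| < d z.1}) hg,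
            indicator_of_mem (s := {z : E2 × ℝ | |z.2 - c z.1| < d z.1}) hg,
            indicator_of_notMem (s := {z : E2 × ℝ | b z.1 < z.2}) (by simpa using h2.le)]
          simp only [L, hMd _ z hg, hθd, hθd3, M, hχz, hχd, hwz, Fin.castSucc_zero,
            Fin.castSucc_one]
          ring
        · have hng : ¬ |z.2 - c z.1| < d z.1 := fun h => by
            have := (abs_lt.1 h).2; simp only [hc, hd] at this; linarith
          have hg' : d z.1 < |z.2 - c z.1| := lt_abs.2 (Or.inl (by simp only [hc, hd]; linarith))
          have hwz : w z = d z.1 := clamp_of_le (hd0 _) (by simp only [hc, hd]; linarith)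
          simp only [T, E]
          rw [indicator_of_notMem (s := {z : E2 × ℝ | |z.2 - c z.1| < d z.1}) hng,
            indicator_of_notMem (s := {z : E2 × ℝ | |z.2 - c z.1| < d z.1}) hng,
            indicator_of_mem (s := {z : E2 × ℝ | b z.1 < z.2}) h2]
          by_cases h3 : z.2 < 3 * h / 2
          · obtain ⟨hu1, hG1⟩ := hbd hy h2 h3
            simp only [L, hMd' _ z hg', hθd, hθd3, M, hwz, hu1, hG1, Bd, α, hA22,
              Fin.castSucc_zero, Fin.castSucc_one]
            ring
          · have hχz : χ z.2 = 0 := gapCutoff_eq_zero hh (Or.inr (not_lt.1 h3))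
            have hχd : deriv χ z.2 = 0 := deriv_gapCutoff_eq_zero hh (Or.inr (not_lt.1 h3))
            simp only [L, hMd' _ z hg', hθd, hθd3, M, hχz, hχd, Bd]; ring
  have hEi : Integrable E := by
    refine ((hLi.sub (hTi 0)).sub (hTi 1)).congr ?_
    filter_upwards [hLE] with z hz
    simp only [Pi.sub_apply]; rw [hz]; ring
  have hE : ∫ z, E z = - ((∫ z, T 0 z) + ∫ z, T 1 z) := by
    have h1 : ∫ z, L z = ∫ z, (T 0 z + T 1 z + E z) := integral_congr_ae hLE
    rw [hL0, integral_add ((hTi 0).fun_add (hTi 1)) hEi, integral_add (hTi 0) (hTi 1)] at h1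
    linarith
  -- the contribution of the body, line by line
  let κ : ℝ := 5 * h / 4 + ∫ s in (5 * h / 4)..(3 * h / 2), χ s
  let Y : E2 → ℝ := fun y => ∫ s in (b y)..(3 * h / 2), χ s * (s - h)
  let mid : E2 → ℝ := fun y => (p 0 y * A 0 2 + p 1 y * A 1 2) * (Y y + d y * (b y - h))
  have hinner : ∀ y, ∫ s, E (y, s) = W 0 * (p 0 y * (κ - c y)) + W 1 * (p 1 y * (κ - c y)) +
      mid y - (W 2 * ψ y + A 2 0 * (ψ y * y 0) + A 2 1 * (ψ y * y 1)) := fun y => by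
    have h1 : (fun s => E (y, s)) = (Ioi (b y)).indicator (Bd y) := by
      ext s; simp [E, indicator_apply]
    rw [h1, integral_indicator measurableSet_Ioi]
    have hby := hb2 y
    have h2 : ∫ s in Ioi (b y), Bd y s = ∫ s in Ioc (b y) (3 * h / 2), Bd y s := by
      refine setIntegral_eq_of_subset_of_forall_sdiff_eq_zero measurableSet_Ioi
        Ioc_subset_Ioi_self fun s hs => ?_
      have hs3 : 3 * h / 2 ≤ s := by
        by_contra hcon
        exact hs.2 ⟨hs.1, (not_le.1 hcon).le⟩
      have hχz : χ s = 0 := gapCutoff_eq_zero hh (Or.inr hs3)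
      have hχd : deriv χ s = 0 := deriv_gapCutoff_eq_zero hh (Or.inr hs3)
      simp only [Bd, hχz, hχd]; ring
    rw [h2, ← intervalIntegral.integral_of_le (by linarith)]
    have h3 := integral_rigid_profile hh (d := d y) (hb1 y) (hb2 y) (p 0 y) (p 1 y) (ψ y)
      (α 0 y) (α 1 y) (α 2 y) (A 0 2) (A 1 2)
    refine h3.trans ?_
    -- Rotation about the vertical axis drops out: `p` is radial and `A` is antisymmetric.
    have hp : p 0 y * α 0 y + p 1 y * α 1 y = p 0 y * W 0 + p 1 y * W 1 := by
      have e0 : A 0 0 = 0 := by have := hA 0 0; linarith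
      have e1 : A 1 1 = 0 := by have := hA 1 1; linarith
      have e2 : A 0 1 = - A 1 0 := hA 0 1
      simp only [p, α, capGrad, e0, e1, e2]; ring
    rw [hp]
    simp only [mid, κ, Y, χ, α, hc, hd]
    ring
  have hcont_c := hcl.continuous
  have hcont_p := fun i => (hpl i).continuous
  have hcont_ψ := hψl.continuous
  have hcy : ∀ i : Fin 2, Continuous fun y : E2 => y i := fun i => by fun_prop
  have J0 : ∀ i, Integrable fun y => p i y * (κ - c y) := fun i =>
    integrable_of_support_ball (σ := σ) (by have := hcont_p i; fun_prop)
      fun y hy => by rw [hp0 i y hy, zero_mul]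
  have J1 : Integrable ψ := integrable_of_support_ball (σ := σ) hcont_ψ hψ0
  have J2 : ∀ i : Fin 2, Integrable fun y => ψ y * y i := fun i =>
    integrable_of_support_ball (σ := σ) (hcont_ψ.mul (hcy i))
      fun y hy => by rw [hψ0 y hy, zero_mul]
  have JR : Integrable fun y =>
      W 2 * ψ y + A 2 0 * (ψ y * y 0) + A 2 1 * (ψ y * y 1) :=
    ((J1.const_mul _).add ((J2 0).const_mul _)).add ((J2 1).const_mul _)
  have JI : Integrable fun y => ∫ s, E (y, s) := hEi.integral_prod_left
  -- Integrability of `mid` is read off from `hinner`, as the only term there not yet known to be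
  -- integrable; no regularity of `Y` is needed.
  have Jm : Integrable mid := by
    refine (((JI.sub ((J0 0).const_mul (W 0))).sub ((J0 1).const_mul (W 1))).add JR).congr
      (Eventually.of_forall fun y => ?_)
    simp only [Pi.sub_apply, Pi.add_apply, hinner y]; ring
  -- The weight is even, so the linear part of the vertical velocity has no flux.
  have hodd : ∀ i : Fin 2, ∫ y, ψ y * y i = 0 := fun i => by
    refine integral_eq_zero_of_odd fun y => ?_
    simp [ψ, capWeight_neg]
  have htot : ∫ z, E z = W 0 * (∫ y, p 0 y * (κ - c y)) + W 1 * (∫ y, p 1 y * (κ - c y)) +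
      (∫ y, mid y) - W 2 * ∫ y, ψ y := by
    rw [Measure.volume_eq_prod, integral_prod _ hEi]
    simp only [hinner]
    rw [integral_sub ((((J0 0).const_mul _).fun_add ((J0 1).const_mul _)).fun_add Jm) JR,
      integral_add (((J0 0).const_mul _).fun_add ((J0 1).const_mul _)) Jm,
      integral_add ((J0 0).const_mul _) ((J0 1).const_mul _),
      integral_add ((J1.const_mul _).fun_add ((J2 0).const_mul _)) ((J2 1).const_mul _),
      integral_add (J1.const_mul _) ((J2 0).const_mul _)]
    simp only [integral_const_mul, hodd]
    ring
  -- As `p` is odd, `κ` drops out and only the odd part of `c` counts. It is of size `h σ` by `hao`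
  -- and `hbo`, against `h` for `c` itself: this is the gain of a factor `σ`.
  have hWt : ∀ i, |∫ y, p i y * (κ - c y)| ≤ Real.pi * σ ^ 2 * (1 / 2 * h * σ ^ 4) := fun i => by
    have h1 : ∫ y, p i y * (κ - c y) = ∫ y, 1 / 2 * (p i y * (c (-y) - c y)) := by
      have h2 := integral_neg_eq_self (fun y => p i y * (κ - c y)) (volume : Measure E2)
      have h3 : Integrable fun y => p i (-y) * (κ - c (-y)) := (J0 i).comp_neg
      have h4 : ∫ y, 1 / 2 * (p i y * (c (-y) - c y)) =
          ∫ y, (1 / 2 * (p i y * (κ - c y)) + 1 / 2 * (p i (-y) * (κ - c (-y)))) := by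
        congr 1; ext y
        have : p i (-y) = - p i y := capGrad_neg i y
        rw [this]; ring
      rw [h4, integral_add ((J0 i).const_mul _) (h3.const_mul _), integral_const_mul,
        integral_const_mul, h2]
      ring
    rw [h1]
    refine abs_integral_le_of_support_ball hσ.le (fun y hy => by rw [hp0 i y hy]; ring)
      fun y hy => ?_
    rw [abs_mul, abs_mul]
    have h5 : |c (-y) - c y| ≤ h * σ / 4 := by
      have e1 := abs_le.1 (hao y hy)
      have e2 := abs_le.1 (hbo y hy)
      rw [abs_le]; simp only [hc]; constructor <;> linarith
    have h6 : |p i y| ≤ 4 * σ ^ 3 := abs_capGrad_le hσ i y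
    calc |(1 / 2 : ℝ)| * (|p i y| * |c (-y) - c y|)
        ≤ 1 / 2 * (4 * σ ^ 3 * (h * σ / 4)) := by
          rw [abs_of_pos (by norm_num : (0 : ℝ) < 1 / 2)]
          gcongr
      _ = _ := by ring
  -- No cancellation is needed here: the factors `s - h` and `d (b - h)` already make the vertical
  -- integral `O(h²)`.
  have hmid : |∫ y, mid y| ≤ Real.pi * σ ^ 2 * (4 * σ ^ 3 * (|A 0 2| + |A 1 2|) * h ^ 2) := by
    refine abs_integral_le_of_support_ball hσ.le
      (fun y hy => by simp only [mid, hp0 _ y hy]; ring) fun y hy => ?_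
    simp only [mid]
    rw [abs_mul]
    have h6 : ∀ i, |p i y| ≤ 4 * σ ^ 3 := fun i => abs_capGrad_le hσ i y
    refine mul_le_mul ?_ ?_ (abs_nonneg _) (by positivity)
    · calc |p 0 y * A 0 2 + p 1 y * A 1 2| ≤ |p 0 y| * |A 0 2| + |p 1 y| * |A 1 2| := by
            rw [← abs_mul, ← abs_mul]; exact abs_add_le _ _
        _ ≤ 4 * σ ^ 3 * |A 0 2| + 4 * σ ^ 3 * |A 1 2| := by
            gcongr <;> exact h6 _
        _ = _ := by ring
    · have e1 : |Y y| ≤ 3 / 8 * h ^ 2 := abs_integral_gapCutoff_mul_le hh (hb1 y) (hb2 y)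
      have e2 : |d y * (b y - h)| ≤ 3 * h / 4 * (h / 4) := by
        rw [abs_mul, abs_of_nonneg (hd0 y)]
        exact mul_le_mul (hdD y) (hb y) (abs_nonneg _) (by positivity)
      calc |Y y + d y * (b y - h)| ≤ |Y y| + |d y * (b y - h)| := abs_add_le _ _
        _ ≤ 3 / 8 * h ^ 2 + 3 * h / 4 * (h / 4) := add_le_add e1 e2
        _ ≤ h ^ 2 := by nlinarith
  have hψint : 9 / 64 * Real.pi * σ ^ 6 ≤ ∫ y, ψ y := by
    have := le_integral_capWeight_sq hσ
    simpa [ψ, sq] using this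
  have hfin : W 2 * ∫ y, ψ y = W 0 * (∫ y, p 0 y * (κ - c y)) + W 1 * (∫ y, p 1 y * (κ - c y)) +
      (∫ y, mid y) + (∫ z, T 0 z) + ∫ z, T 1 z := by linarith
  have hψpos : 0 ≤ ∫ y, ψ y := le_trans (by positivity) hψint
  have habs : |W 2| * ∫ y, ψ y ≤ |W 0| * |∫ y, p 0 y * (κ - c y)| +
      |W 1| * |∫ y, p 1 y * (κ - c y)| + |∫ y, mid y| + |∫ z, T 0 z| + |∫ z, T 1 z| := by
    rw [← abs_of_nonneg hψpos, ← abs_mul, hfin, ← abs_mul, ← abs_mul]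
    refine (abs_add_le _ _).trans (add_le_add ?_ le_rfl)
    refine (abs_add_le _ _).trans (add_le_add ?_ le_rfl)
    refine (abs_add_le _ _).trans (add_le_add ?_ le_rfl)
    exact abs_add_le _ _
  calc |W 2| * (9 / 64 * Real.pi * σ ^ 6) ≤ |W 2| * ∫ y, ψ y := by gcongr
    _ ≤ _ := habs
    _ ≤ |W 0| * (Real.pi * σ ^ 2 * (1 / 2 * h * σ ^ 4)) +
        |W 1| * (Real.pi * σ ^ 2 * (1 / 2 * h * σ ^ 4)) +
        Real.pi * σ ^ 2 * (4 * σ ^ 3 * (|A 0 2| + |A 1 2|) * h ^ 2) +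
        9 / 8 * σ ^ 3 * h ^ 2 * N + 9 / 8 * σ ^ 3 * h ^ 2 * N := by
        gcongr
        · exact hWt 0
        · exact hWt 1
        · exact hT 0
        · exact hT 1
    _ = _ := by ring

/-! ### Approximate evenness of `C³` graphs. -/

/-- Taylor expansion of order two, with the remainder controlled by the third derivative. -/
theorem abs_sub_half_iteratedFDeriv_two_le {g : E2 → ℝ} {K r : ℝ}
    (hg : ContDiffOn ℝ 3 g (Metric.ball 0 r))
    (h0 : g 0 = 0) (h1 : iteratedFDeriv ℝ 1 g 0 = 0)
    (h3 : ∀ x ∈ Metric.ball (0 : E2) r, ‖iteratedFDeriv ℝ 3 g x‖ ≤ K) {y : E2}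
    (hy : y ∈ Metric.ball (0 : E2) r) :
    |g y - 1 / 2 * iteratedFDeriv ℝ 2 g 0 fun _ => y| ≤ K / 6 * ‖y‖ ^ 3 := by
  let l : ℝ →L[ℝ] E2 := ContinuousLinearMap.toSpanSingleton ℝ y
  have hl : ∀ t, l t = t • y := fun t => rfl
  let I : Set ℝ := l ⁻¹' Metric.ball 0 r
  have hIo : IsOpen I := Metric.isOpen_ball.preimage l.continuous
  have hf : ContDiffOn ℝ 3 (g ∘ l) I := hg.comp l.contDiff.contDiffOn fun x hx => hx
  have hder : ∀ n : ℕ, n ≤ 3 → ∀ t ∈ I,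
      iteratedDeriv n (g ∘ l) t = iteratedFDeriv ℝ n g (t • y) fun _ => y := by
    intro n hn t ht
    have e1 := l.iteratedFDerivWithin_comp_right (f := g) (s := Metric.ball 0 r) hg
      Metric.isOpen_ball.uniqueDiffOn hIo.uniqueDiffOn (x := t) ht (i := n) (by exact_mod_cast hn)
    rw [iteratedFDerivWithin_of_isOpen n hIo ht,
      iteratedFDerivWithin_of_isOpen n Metric.isOpen_ball ht] at e1
    rw [iteratedDeriv_eq_iteratedFDeriv, e1]
    simp [hl]
  have hsub : uIcc (0 : ℝ) 1 ⊆ I := fun t ht => by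
    rw [uIcc_of_le zero_le_one] at ht
    simp only [I, mem_preimage, hl, mem_ball_zero_iff, norm_smul, Real.norm_eq_abs,
      abs_of_nonneg ht.1] at hy ⊢
    exact (mul_le_of_le_one_left (norm_nonneg _) ht.2).trans_lt hy
  obtain ⟨t, ht, hT⟩ := taylor_mean_remainder_lagrange_iteratedDeriv (n := 2) (f := g ∘ l)
    (zero_ne_one : (0 : ℝ) ≠ 1) (by exact_mod_cast hf.mono hsub)
  have ht' : t ∈ I := hsub (uIoo_subset_uIcc_self ht)
  have h0I : (0 : ℝ) ∈ I := hsub left_mem_uIcc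
  have hw : ∀ k : ℕ, k ≤ 3 → iteratedDerivWithin k (g ∘ l) (uIcc 0 1) 0 =
      iteratedDeriv k (g ∘ l) 0 := fun k hk =>
    iteratedDerivWithin_eq_iteratedDeriv (uniqueDiffOn_uIcc zero_ne_one)
      ((hf.contDiffAt (hIo.mem_nhds h0I)).of_le (by exact_mod_cast hk)) left_mem_uIcc
  rw [taylor_within_apply] at hT
  simp only [Finset.sum_range_succ, Finset.sum_range_zero] at hT
  rw [hw 0 (by norm_num), hw 1 (by norm_num), hw 2 (by norm_num), hder 0 (by norm_num) _ h0I,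
    hder 1 (by norm_num) _ h0I, hder 2 (by norm_num) _ h0I, hder (2 + 1) (by norm_num) _ ht'] at hT
  simp only [zero_smul, h1] at hT
  have hn := (iteratedFDeriv ℝ 3 g (t • y)).le_opNorm fun _ => y
  simp only [Finset.prod_const, Finset.card_univ, Fintype.card_fin] at hn
  have hT2 : g y - 1 / 2 * (iteratedFDeriv ℝ 2 g 0 fun _ => y) =
      (iteratedFDeriv ℝ 3 g (t • y) fun _ => y) / 6 := by
    simp [hl, h0, Nat.factorial] at hT
    norm_num at hT ⊢
    linarith
  rw [hT2, abs_div, abs_of_pos (by norm_num : (0 : ℝ) < 6)]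
  have := h3 (t • y) ht'
  have h5 : ‖iteratedFDeriv ℝ 3 g (t • y)‖ * ‖y‖ ^ 3 ≤ K * ‖y‖ ^ 3 := by gcongr
  rw [Real.norm_eq_abs] at hn
  linarith

/-- A function as in the definition of a uniformly `C³` domain is even up to third order. -/
theorem abs_sub_comp_neg_le {g : E2 → ℝ} {K r : ℝ}
    (hg : ContDiffOn ℝ 3 g (Metric.ball 0 r))
    (hK : ∀ x ∈ Metric.ball (0 : E2) r, ∀ i ≤ 2,
      ‖iteratedFDeriv ℝ i g x‖ ≤ K * ‖x‖ ^ (2 - i))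
    (h3 : ∀ x ∈ Metric.ball (0 : E2) r, ‖iteratedFDeriv ℝ 3 g x‖ ≤ K) {y : E2}
    (hy : y ∈ Metric.ball (0 : E2) r) :
    |g y - g (-y)| ≤ K * ‖y‖ ^ 3 := by
  have hr : (0 : E2) ∈ Metric.ball (0 : E2) r := by
    rw [mem_ball_zero_iff] at hy; simpa using (norm_nonneg y).trans_lt hy
  have h0 : g 0 = 0 := by
    have := hK 0 hr 0 (by norm_num)
    simpa using this
  have h1 : iteratedFDeriv ℝ 1 g 0 = 0 := by
    have := hK 0 hr 1 (by norm_num)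
    rw [norm_zero, show 2 - 1 = 1 from rfl, pow_one, mul_zero] at this
    exact norm_le_zero_iff.1 this
  have e1 := abs_sub_half_iteratedFDeriv_two_le hg h0 h1 h3 hy
  have hy' : -y ∈ Metric.ball (0 : E2) r := by simpa using hy
  have e2 := abs_sub_half_iteratedFDeriv_two_le hg h0 h1 h3 hy'
  -- The quadratic Taylor term is even, so the difference consists of the two cubic remainders.
  have e3 : (iteratedFDeriv ℝ 2 g 0 fun _ => -y) = iteratedFDeriv ℝ 2 g 0 fun _ => y := by
    have := (iteratedFDeriv ℝ 2 g 0).map_smul_univ (fun _ => (-1 : ℝ)) fun _ => y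
    simpa using this
  rw [e3, norm_neg] at e2
  have hKn : 0 ≤ K := (norm_nonneg _).trans (h3 0 hr)
  have : 0 ≤ K * ‖y‖ ^ 3 := by positivity
  rw [abs_le] at e1 e2 ⊢
  constructor <;> linarith [e1.1, e1.2, e2.1, e2.2]

theorem lipschitzOnWith_of_iteratedFDeriv_one_le {g : E2 → ℝ} {K r : ℝ}
    (hg : ContDiffOn ℝ 3 g (Metric.ball 0 r))
    (hK : ∀ x ∈ Metric.ball (0 : E2) r, ‖iteratedFDeriv ℝ 1 g x‖ ≤ K * ‖x‖) (hK0 : 0 ≤ K) :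
    LipschitzOnWith (Real.toNNReal (K * r)) g (Metric.ball 0 r) := by
  refine (convex_ball (0 : E2) r).lipschitzOnWith_of_nnnorm_fderiv_le (𝕜 := ℝ) (fun x hx => ?_)
    fun x hx => ?_
  · exact (hg.contDiffAt (Metric.isOpen_ball.mem_nhds hx)).differentiableAt (by simp)
  · rw [← NNReal.coe_le_coe, coe_nnnorm]
    have hx' := mem_ball_zero_iff.1 hx
    rw [Real.coe_toNNReal _ (mul_nonneg hK0 ((norm_nonneg _).trans hx'.le))]
    have := hK x hx
    rw [norm_iteratedFDeriv_one] at this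
    refine this.trans ?_
    gcongr

/-! ### Common coordinates at a closest pair of points. -/

/-- The projection `x ↦ x'` of three-space onto the plane. -/
noncomputable def planePart (x : E3) : E2 := !₂[x 0, x 1]

theorem joinPt_planePart (x : E3) : joinPt (planePart x) (x 2) = x := by
  ext i; fin_cases i <;> simp [joinPt, planePart]

@[simp] theorem joinPt_apply_two (y : E2) (s : ℝ) : joinPt y s 2 = s := by simp [joinPt]

@[simp] theorem planePart_joinPt (y : E2) (s : ℝ) : planePart (joinPt y s) = y := by
  ext i; fin_cases i <;> simp [joinPt, planePart]

theorem joinPt_add (y y' : E2) (s s' : ℝ) :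
    joinPt (y + y') (s + s') = joinPt y s + joinPt y' s' := by
  ext i; fin_cases i <;> simp [joinPt]

theorem joinPt_smul (c : ℝ) (y : E2) (s : ℝ) : joinPt (c • y) (c * s) = c • joinPt y s := by
  ext i; fin_cases i <;> simp [joinPt]

theorem joinPt_neg (y : E2) (s : ℝ) : joinPt (-y) (-s) = - joinPt y s := by
  ext i; fin_cases i <;> simp [joinPt]

theorem inner_joinPt (y y' : E2) (s s' : ℝ) :
    inner ℝ (joinPt y s) (joinPt y' s') = inner ℝ y y' + s * s' := by
  simp [joinPt, PiLp.inner_apply, Fin.sum_univ_three, Fin.sum_univ_two]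
  ring

theorem norm_joinPt_sq (y : E2) (s : ℝ) : ‖joinPt y s‖ ^ 2 = ‖y‖ ^ 2 + s ^ 2 := by
  rw [← real_inner_self_eq_norm_sq, inner_joinPt, real_inner_self_eq_norm_sq]; ring

theorem norm_joinPt_zero_left (s : ℝ) : ‖joinPt 0 s‖ = |s| := by
  have := norm_joinPt_sq 0 s
  rw [norm_zero] at this
  rw [← abs_of_nonneg (norm_nonneg (joinPt 0 s)), ← sq_eq_sq_iff_abs_eq_abs]
  linarith

theorem norm_joinPt_zero_right (y : E2) : ‖joinPt y 0‖ = ‖y‖ := by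
  have := norm_joinPt_sq y 0
  rw [← abs_of_nonneg (norm_nonneg (joinPt y 0)), ← abs_of_nonneg (norm_nonneg y),
    ← sq_eq_sq_iff_abs_eq_abs]
  linarith

/-- In the ball around `q` touching the origin, a short segment in each direction pointing into
the ball. -/
theorem exists_small_smul {q w : E3} (hw : 0 < inner ℝ w q) {r ε K : ℝ} (hr : 0 < r) (hε : 0 < ε)
    (h2 : w 2 ≠ 0) :
    ∃ s : ℝ, 0 < s ∧ ‖s • w - q‖ < ‖q‖ ∧ ‖s • planePart w‖ < r ∧ |s * w 2| < ε ∧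
      K * ‖s • planePart w‖ ^ 2 < s * |w 2| := by
  have t1 : Tendsto (fun s : ℝ => s * ‖w‖ ^ 2) (𝓝[>] 0) (𝓝 0) := by
    have : Tendsto (fun s : ℝ => s * ‖w‖ ^ 2) (𝓝 0) (𝓝 (0 * ‖w‖ ^ 2)) :=
      (continuous_id.mul continuous_const).tendsto 0
    rw [zero_mul] at this
    exact this.mono_left nhdsWithin_le_nhds
  have t2 : Tendsto (fun s : ℝ => s * ‖planePart w‖) (𝓝[>] 0) (𝓝 0) := by
    have : Tendsto (fun s : ℝ => s * ‖planePart w‖) (𝓝 0) (𝓝 (0 * ‖planePart w‖)) :=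
      (continuous_id.mul continuous_const).tendsto 0
    rw [zero_mul] at this
    exact this.mono_left nhdsWithin_le_nhds
  have t3 : Tendsto (fun s : ℝ => s * |w 2|) (𝓝[>] 0) (𝓝 0) := by
    have : Tendsto (fun s : ℝ => s * |w 2|) (𝓝 0) (𝓝 (0 * |w 2|)) :=
      (continuous_id.mul continuous_const).tendsto 0
    rw [zero_mul] at this
    exact this.mono_left nhdsWithin_le_nhds
  have t4 : Tendsto (fun s : ℝ => s * (K * ‖planePart w‖ ^ 2)) (𝓝[>] 0) (𝓝 0) := by
    have : Tendsto (fun s : ℝ => s * (K * ‖planePart w‖ ^ 2)) (𝓝 0)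
        (𝓝 (0 * (K * ‖planePart w‖ ^ 2))) :=
      (continuous_id.mul continuous_const).tendsto 0
    rw [zero_mul] at this
    exact this.mono_left nhdsWithin_le_nhds
  have hev := ((t1.eventually_lt_const (show 0 < 2 * inner ℝ w q by positivity)).and
    ((t2.eventually_lt_const hr).and ((t3.eventually_lt_const hε).and
    ((t4.eventually_lt_const (abs_pos.2 h2)).and self_mem_nhdsWithin))))
  obtain ⟨s, h1, h2', h3, h4, hs⟩ := hev.exists
  have hs : 0 < s := hs
  refine ⟨s, hs, ?_, ?_, ?_, ?_⟩
  · have hsq : ‖s • w - q‖ ^ 2 < ‖q‖ ^ 2 := by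
      rw [norm_sub_sq_real, norm_smul, real_inner_smul_left, Real.norm_of_nonneg hs.le]
      nlinarith
    exact lt_of_pow_lt_pow_left₀ 2 (norm_nonneg _) hsq
  · rwa [norm_smul, Real.norm_of_nonneg hs.le]
  · rwa [abs_mul, abs_of_pos hs]
  · rw [norm_smul, Real.norm_of_nonneg hs.le, mul_pow]
    have : s * (s * (K * ‖planePart w‖ ^ 2)) < s * |w 2| := by gcongr
    linarith

theorem smul_eq_joinPt (s : ℝ) (w : E3) : s • w = joinPt (s • planePart w) (s * w 2) := by
  rw [joinPt_smul, joinPt_planePart]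

/-- A ball inside a domain above a graph touching it at the origin lies on the vertical axis. -/
theorem eq_joinPt_of_interior_ball {D : Set E3} {g : E2 → ℝ} {K r ε : ℝ} (hr : 0 < r) (hε : 0 < ε)
    (hg : ∀ y, ‖y‖ < r → |g y| ≤ K * ‖y‖ ^ 2)
    (hD : ∀ y, ‖y‖ < r → ∀ s : ℝ, |s| < ε → joinPt y s ∈ D → g y < s)
    {q : E3} (hball : ∀ x, ‖x - q‖ < ‖q‖ → x ∈ D) : q = joinPt 0 ‖q‖ := by
  by_contra hne
  set e := joinPt 0 1 with he
  have he1 : ‖e‖ = 1 := by rw [he, norm_joinPt_zero_left]; simp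
  have hqe : q ≠ ‖q‖ • e := fun h => hne (by rw [he, ← joinPt_smul] at h; simpa using h)
  have hin : inner ℝ q e < ‖q‖ := by
    have h1 : inner ℝ q e ≤ ‖q‖ * ‖e‖ := real_inner_le_norm q e
    rw [he1, mul_one] at h1
    refine lt_of_le_of_ne h1 fun h2 => hqe ?_
    have := (inner_eq_norm_mul_iff_real (x := q) (y := e)).1 (by rw [h2, he1, mul_one])
    rw [he1, one_smul] at this
    exact this
  have hq2 : inner ℝ q e = q 2 := by
    conv_lhs => rw [← joinPt_planePart q, he, inner_joinPt]
    simp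
  -- If `q` were off the upper axis, `w` would point into the ball and strictly downwards. Short
  -- multiples of `w` would then lie in `D` yet below the graph, which is only quadratically deep.
  set w := q - ‖q‖ • e with hw
  have hw2 : w 2 < 0 := by
    have : w 2 = q 2 - ‖q‖ := by simp [hw, he]
    rw [this, ← hq2]; linarith
  have hqpos : 0 < ‖q‖ := norm_pos_iff.2 fun h => hqe (by rw [h]; simp)
  have hwq : 0 < inner ℝ w q := by
    rw [hw, inner_sub_left, real_inner_smul_left, real_inner_comm, real_inner_self_eq_norm_sq,
      real_inner_comm]
    nlinarith
  obtain ⟨s, hs, h1, h2, h3, h4⟩ := exists_small_smul (K := K) hwq hr hε hw2.ne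
  have hmem := hball _ h1
  rw [smul_eq_joinPt] at hmem
  have h5 := hD _ h2 _ h3 hmem
  have h6 := (abs_le.1 (hg _ h2)).1
  rw [abs_of_neg hw2] at h4
  linarith

/-- A ball disjoint from a domain above a graph touching it at the origin lies on the vertical
axis. -/
theorem eq_joinPt_of_exterior_ball {D : Set E3} {g : E2 → ℝ} {K r ε : ℝ} (hr : 0 < r) (hε : 0 < ε)
    (hg : ∀ y, ‖y‖ < r → |g y| ≤ K * ‖y‖ ^ 2)
    (hD : ∀ y, ‖y‖ < r → ∀ s : ℝ, |s| < ε → g y < s → joinPt y s ∈ D)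
    {q : E3} (hball : ∀ x, ‖x - q‖ < ‖q‖ → x ∉ D) : q = joinPt 0 (-‖q‖) := by
  by_contra hne
  set e := joinPt 0 1 with he
  have he1 : ‖e‖ = 1 := by rw [he, norm_joinPt_zero_left]; simp
  have hqe : -q ≠ ‖q‖ • e := fun h => hne (by
    rw [he, ← joinPt_smul, smul_zero, mul_one] at h
    have := congrArg (fun x => -x) h
    simp only [neg_neg] at this
    exact this.trans (by rw [← joinPt_neg, neg_zero]))
  have hin : inner ℝ (-q) e < ‖q‖ := by
    have h1 : inner ℝ (-q) e ≤ ‖-q‖ * ‖e‖ := real_inner_le_norm (-q) e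
    rw [he1, mul_one, norm_neg] at h1
    refine lt_of_le_of_ne h1 fun h2 => hqe ?_
    have := (inner_eq_norm_mul_iff_real (x := -q) (y := e)).1 (by rw [h2, he1, mul_one, norm_neg])
    rw [he1, one_smul, norm_neg] at this
    exact this
  rw [inner_neg_left] at hin
  have hq2 : inner ℝ q e = q 2 := by
    conv_lhs => rw [← joinPt_planePart q, he, inner_joinPt]
    simp
  -- The mirror image: `w` points into the ball and strictly upwards, so short multiples of it lie
  -- above the graph, in `D`.
  set w := q + ‖q‖ • e with hw
  have hw2 : 0 < w 2 := by
    have : w 2 = q 2 + ‖q‖ := by simp [hw, he]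
    rw [this, ← hq2]; linarith
  have hqpos : 0 < ‖q‖ := norm_pos_iff.2 fun h => hqe (by rw [h]; simp)
  have hwq : 0 < inner ℝ w q := by
    rw [hw, inner_add_left, real_inner_smul_left, real_inner_comm, real_inner_self_eq_norm_sq,
      real_inner_comm]
    nlinarith
  obtain ⟨s, hs, h1, h2, h3, h4⟩ := exists_small_smul (K := K) hwq hr hε hw2.ne'
  refine hball _ h1 ?_
  rw [smul_eq_joinPt]
  refine hD _ h2 _ h3 ?_
  have h6 := (abs_le.1 (hg _ h2)).2
  rw [abs_of_pos hw2] at h4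
  linarith

section setDist

theorem setDist_le {A B : Set E3} {p q : E3} (hp : p ∈ A) (hq : q ∈ B) :
    setDist A B ≤ dist p q :=
  csInf_le ⟨0, by rintro _ ⟨x, _, y, _, rfl⟩; exact dist_nonneg⟩ ⟨p, hp, q, hq, rfl⟩

theorem setDist_le_of_mem_closure {A B : Set E3} {p q : E3} (hp : p ∈ closure A) (hq : q ∈ B) :
    setDist A B ≤ dist p q := by
  have hc : IsClosed {x | setDist A B ≤ dist x q} :=
    isClosed_le continuous_const (continuous_id.dist continuous_const)
  exact closure_minimal (fun x hx => setDist_le hx hq) hc hp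

theorem setDist_nonneg (A B : Set E3) : 0 ≤ setDist A B :=
  Real.sInf_nonneg (by rintro _ ⟨x, _, y, _, rfl⟩; exact dist_nonneg)

end setDist

/-- A connected set meeting the open set `D` but not its boundary stays in `D`. It puts the ball of
radius `h` about `P` inside `Ω`. -/
theorem ball_subset_of_disjoint_frontier {D : Set E3} (hD : IsOpen D) {p : E3} {r : ℝ}
    (hp : p ∈ D) (hr : ∀ x ∈ frontier D, r ≤ dist p x) : Metric.ball p r ⊆ D := by
  rcases le_or_gt r 0 with h | h
  · rw [Metric.ball_eq_empty.2 h]; exact empty_subset _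
  have hc : IsPreconnected (Metric.ball p r) := (convex_ball p r).isPreconnected
  refine hc.subset_of_closure_inter_subset hD ⟨p, Metric.mem_ball_self h, hp⟩ ?_
  rintro x ⟨hx, hxb⟩
  by_contra hxD
  have : x ∈ frontier D := by
    rw [hD.frontier_eq]; exact ⟨hx, hxD⟩
  have h1 := hr x this
  rw [Metric.mem_ball, dist_comm] at hxb
  linarith

/-- A function on the plane which is quadratically small at the origin and even up to third
order. -/
structure IsGapGraph (K ρ : ℝ) (g : E2 → ℝ) : Prop where
  lipschitz : ∃ L : ℝ≥0, LipschitzOnWith L g (Metric.ball 0 ρ)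
  abs_le : ∀ y, ‖y‖ < ρ → |g y| ≤ K * ‖y‖ ^ 2
  abs_sub_le : ∀ y, ‖y‖ < ρ → |g y - g (-y)| ≤ K * ‖y‖ ^ 3

/-- Retains of the `C³` chart only the properties used later; these survive a rotation of the
horizontal plane, which is what merging two charts requires. -/
theorem IsUniformlyC3With.exists_graph {K₁ σ₁ K ρ δ : ℝ} {D : Set E3}
    (hD : IsUniformlyC3With K₁ σ₁ D) (hK : K₁ ≤ K) (hρ : ρ ≤ σ₁) (hδ : δ ≤ K₁ * σ₁ ^ 2)
    (hK₁ : 0 ≤ K₁) {x₀ : E3} (hx : x₀ ∈ frontier D) :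
    ∃ (R : E3 ≃ᵃⁱ[ℝ] E3) (g : E2 → ℝ), R 0 = x₀ ∧ IsGapGraph K ρ g ∧
      ∀ y, ‖y‖ < ρ → ∀ s : ℝ, |s| < δ → (R (joinPt y s) ∈ D ↔ g y < s) := by
  obtain ⟨R, g, h0, hc, h2, h3, hm⟩ := hD x₀ hx
  have hb : ∀ {y : E2}, ‖y‖ < ρ → y ∈ Metric.ball (0 : E2) σ₁ := fun h =>
    mem_ball_zero_iff.2 (h.trans_le hρ)
  refine ⟨R, g, h0, ⟨⟨_, (lipschitzOnWith_of_iteratedFDeriv_one_le hc (fun x hx => ?_) hK₁).mono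
    (Metric.ball_subset_ball hρ)⟩, fun y hy => ?_, fun y hy => ?_⟩, fun y hy s hs => ?_⟩
  · simpa using h2 x hx 1 (by norm_num)
  · have := h2 y (hb hy) 0 (by norm_num)
    rw [norm_iteratedFDeriv_zero, Real.norm_eq_abs] at this
    exact this.trans (by gcongr)
  · exact (abs_sub_comp_neg_le hc h2 h3 (hb hy)).trans (by gcongr)
  · exact hm y (hb hy) s (hs.trans_le hδ)

/-- Common coordinates for two disjoint-boundary domains at a closest pair of boundary points. -/
theorem exists_gap_frame {Ω S : Set E3} (hΩ : IsOpen Ω) (hSΩ : S ⊆ Ω)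
    {K₁ σ₁ K₂ σ₂ K ρ δ : ℝ} (hΩr : IsUniformlyC3With K₁ σ₁ Ω) (hSr : IsUniformlyC3With K₂ σ₂ S)
    (hK₁ : 0 ≤ K₁) (hK₂ : 0 ≤ K₂) (hK₁K : K₁ ≤ K) (hK₂K : K₂ ≤ K) (hρ₁ : ρ ≤ σ₁) (hρ₂ : ρ ≤ σ₂)
    (hδ₁ : δ ≤ K₁ * σ₁ ^ 2) (hδ₂ : δ ≤ K₂ * σ₂ ^ 2) (hρ : 0 < ρ) (hδ : 0 < δ)
    {P Q : E3} (hPQ : IsClosestPair Ω S P Q) {h : ℝ} (hh : setDist S (frontier Ω) = h)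
    (hpos : 0 < h) :
    ∃ (R : E3 ≃ᵃⁱ[ℝ] E3) (a b : E2 → ℝ), R 0 = Q ∧ R (joinPt 0 h) = P ∧
      IsGapGraph K ρ a ∧ IsGapGraph K ρ b ∧
      (∀ y, ‖y‖ < ρ → ∀ s : ℝ, |s| < δ → (R (joinPt y s) ∈ Ω ↔ a y < s)) ∧
      (∀ y, ‖y‖ < ρ → ∀ s : ℝ, |s - h| < δ → (R (joinPt y s) ∈ S ↔ b y < s - h)) := by
  obtain ⟨hP, hQ, hd⟩ := hPQ
  rw [hh] at hd
  obtain ⟨R, a, hR0, ha, haΩ⟩ := hΩr.exists_graph hK₁K hρ₁ hδ₁ hK₁ hQ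
  obtain ⟨R', g, hR'0, hg, hgS⟩ := hSr.exists_graph hK₂K hρ₂ hδ₂ hK₂ hP
  have hPcl : P ∈ closure S := frontier_subset_closure hP
  have hPd : ∀ x ∈ frontier Ω, h ≤ dist P x := fun x hx => by
    rw [← hh]; exact setDist_le_of_mem_closure hPcl hx
  have hPΩ : P ∈ Ω := by
    by_contra hc
    have : P ∈ frontier Ω := by
      rw [hΩ.frontier_eq]; exact ⟨closure_mono hSΩ hPcl, hc⟩
    have := hPd P this
    rw [dist_self] at this
    linarith
  have hball := ball_subset_of_disjoint_frontier hΩ hPΩ hPd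
  have hRs : R.symm Q = 0 := by rw [← hR0]; simp
  have hRs' : R'.symm P = 0 := by rw [← hR'0]; simp
  have hnq : ‖R.symm P‖ = h := by
    rw [← hd, ← R.symm.dist_map, hRs, dist_zero_right]
  have hnq' : ‖R'.symm Q‖ = h := by
    rw [← hd, dist_comm, ← R'.symm.dist_map, hRs', dist_zero_right]
  -- The ball of radius `h` about `P` lies in `Ω` and touches the wall at the origin of the wall
  -- chart.
  have e1 : R.symm P = joinPt 0 h := by
    have := eq_joinPt_of_interior_ball (D := R ⁻¹' Ω) (q := R.symm P) hρ hδ ha.abs_le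
      (fun y hy s hs hm => (haΩ y hy s hs).1 hm) fun x hx => hball (by
        rw [hnq] at hx
        rw [Metric.mem_ball, ← R.symm.dist_map, R.symm_apply_apply, dist_eq_norm]
        exact hx)
    rwa [hnq] at this
  -- The ball of radius `h` about `Q` misses `S` and touches it at the origin of the body chart.
  have e2 : R'.symm Q = joinPt 0 (-h) := by
    have := eq_joinPt_of_exterior_ball (D := R' ⁻¹' S) (q := R'.symm Q) hρ hδ hg.abs_le
      (fun y hy s hs hm => (hgS y hy s hs).2 hm) fun x hx hxS => by
        rw [hnq'] at hx
        have h1 : h ≤ dist (R' x) Q := by rw [← hh]; exact setDist_le hxS hQ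
        rw [← R'.symm.dist_map, R'.symm_apply_apply, dist_eq_norm] at h1
        linarith
    rwa [hnq'] at this
  have hRP : R (joinPt 0 h) = P := by rw [← e1]; simp
  -- The linear part of the change of charts fixes the vertical axis, hence acts as an isometry `O`
  -- of the horizontal plane. As `O` is linear and norm preserving, `g ∘ O` inherits the size and
  -- evenness bounds of `g`.
  let l : E3 ≃ₗᵢ[ℝ] E3 := (R.trans R'.symm).linearIsometryEquiv
  have hU : ∀ x, R'.symm (R x) = l x + joinPt 0 (-h) := fun x => by
    have := (R.trans R'.symm).map_vadd 0 x
    simp only [vadd_eq_add, add_zero, AffineIsometryEquiv.coe_trans, Function.comp_apply, hR0,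
      e2] at this
    exact this
  have hlh : l (joinPt 0 h) = joinPt 0 h := by
    have := hU (joinPt 0 h)
    rw [hRP, hRs'] at this
    have h2 : joinPt 0 (-h) = - joinPt 0 h := by rw [← joinPt_neg, neg_zero]
    rw [h2, ← sub_eq_add_neg] at this
    exact (sub_eq_zero.1 this.symm)
  have hl2 : ∀ x, l x 2 = x 2 := fun x => by
    have h1 : inner ℝ (l x) (l (joinPt 0 h)) = inner ℝ x (joinPt 0 h) := l.inner_map_map _ _
    have h2 : ∀ z : E3, inner ℝ z (joinPt 0 h) = z 2 * h := fun z => by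
      conv_lhs => rw [← joinPt_planePart z, inner_joinPt]
      simp
    rw [hlh, h2, h2] at h1
    exact mul_right_cancel₀ hpos.ne' h1
  let O : E2 → E2 := fun y => planePart (l (joinPt y 0))
  have hO : ∀ y, l (joinPt y 0) = joinPt (O y) 0 := fun y => by
    have := joinPt_planePart (l (joinPt y 0))
    rw [hl2, joinPt_apply_two] at this
    exact this.symm
  have hOs : ∀ y s, l (joinPt y s) = joinPt (O y) s := fun y s => by
    have h1 : joinPt y s = joinPt y 0 + (s / h) • joinPt 0 h := by
      rw [← joinPt_smul, ← joinPt_add]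
      congr 1
      · simp
      · field_simp; simp
    rw [h1, map_add, map_smul, hlh, hO, ← joinPt_smul, ← joinPt_add]
    congr 1
    · simp
    · field_simp; simp
  have hOn : ∀ y, ‖O y‖ = ‖y‖ := fun y => by
    rw [← norm_joinPt_zero_right, ← hO, l.norm_map, norm_joinPt_zero_right]
  have hOneg : ∀ y, O (-y) = - O y := fun y => by
    have h1 : joinPt (-y) 0 = - joinPt y 0 := by rw [← joinPt_neg, neg_zero]
    have h2 : l (joinPt (-y) 0) = - l (joinPt y 0) := by rw [h1, map_neg]
    rw [hO, hO, ← joinPt_neg] at h2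
    simpa using congrArg planePart h2
  have hOsub : ∀ y y', dist (O y) (O y') = dist y y' := fun y y' => by
    have h1 : joinPt (y - y') 0 = joinPt y 0 - joinPt y' 0 := by
      rw [sub_eq_add_neg, sub_eq_add_neg, ← joinPt_neg, ← joinPt_add]; simp
    have h2 : l (joinPt (y - y') 0) = l (joinPt y 0) - l (joinPt y' 0) := by rw [h1, map_sub]
    have h4 : joinPt (O y) 0 - joinPt (O y') 0 = joinPt (O y + - O y') 0 := by
      rw [sub_eq_add_neg, ← joinPt_neg, ← joinPt_add]; simp
    rw [hO, hO, hO] at h2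
    have h3 : O (y - y') = O y + - O y' := by simpa using congrArg planePart (h2.trans h4)
    rw [dist_eq_norm, dist_eq_norm, sub_eq_add_neg, ← h3, hOn]
  refine ⟨R, a, fun y => g (O y), hR0, hRP, ha, ⟨?_, fun y hy => ?_, fun y hy => ?_⟩, haΩ,
    fun y hy s hs => ?_⟩
  · obtain ⟨L, hL⟩ := hg.lipschitz
    refine ⟨L, LipschitzOnWith.of_dist_le_mul fun y hy y' hy' => ?_⟩
    rw [mem_ball_zero_iff] at hy hy'
    rw [← hOsub y y']
    exact hL.dist_le_mul _ (by rw [mem_ball_zero_iff, hOn]; exact hy) _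
      (by rw [mem_ball_zero_iff, hOn]; exact hy')
  · rw [← hOn y] at hy ⊢
    exact hg.abs_le _ hy
  · simp only [hOneg]
    rw [← hOn y] at hy ⊢
    exact hg.abs_sub_le _ hy
  · rw [← hgS (O y) (by rw [hOn]; exact hy) (s - h) hs]
    have h1 : R'.symm (R (joinPt y s)) = joinPt (O y) (s - h) := by
      rw [hU, hOs, ← joinPt_add]
      congr 1
      simp
    rw [← h1, AffineIsometryEquiv.apply_symm_apply]

/-! ### Integration by parts in cylindrical coordinates. -/

theorem continuous_joinPt : Continuous fun z : E2 × ℝ => joinPt z.1 z.2 := by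
  refine (PiLp.continuous_toLp 2 _).comp (continuous_pi fun i => ?_)
  fin_cases i
  · exact (EuclideanSpace.proj (0 : Fin 2)).continuous.comp continuous_fst
  · exact (EuclideanSpace.proj (1 : Fin 2)).continuous.comp continuous_fst
  · exact continuous_snd

theorem continuous_planePart : Continuous planePart := by
  refine (PiLp.continuous_toLp 2 _).comp (continuous_pi fun i => ?_)
  fin_cases i
  · exact (EuclideanSpace.proj (0 : Fin 3)).continuous
  · exact (EuclideanSpace.proj (1 : Fin 3)).continuous

/-- Cylindrical coordinates attached to a Euclidean frame. -/
noncomputable def frameHomeo (R : E3 ≃ᵃⁱ[ℝ] E3) : E2 × ℝ ≃ₜ E3 where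
  toFun z := R (joinPt z.1 z.2)
  invFun x := (planePart (R.symm x), R.symm x 2)
  left_inv z := by simp
  right_inv x := by simp [joinPt_planePart]
  continuous_toFun := R.continuous.comp continuous_joinPt
  continuous_invFun := (continuous_planePart.comp R.symm.continuous).prodMk
    ((EuclideanSpace.proj (2 : Fin 3)).continuous.comp R.symm.continuous)

section coordinates

variable {R : E3 ≃ᵃⁱ[ℝ] E3}

theorem frameHomeo_apply (z : E2 × ℝ) : frameHomeo R z = R (joinPt z.1 z.2) := rfl

theorem frameHomeo_add (z w : E2 × ℝ) :
    frameHomeo R (z + w) = frameHomeo R z + R.linearIsometryEquiv (joinPt w.1 w.2) := by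
  rw [frameHomeo_apply, frameHomeo_apply, Prod.fst_add, Prod.snd_add, joinPt_add, add_comm,
    ← vadd_eq_add, R.map_vadd, vadd_eq_add, add_comm]

theorem measurePreserving_joinPt : MeasurePreserving fun z : E2 × ℝ => joinPt z.1 z.2 := by
  have h1 : MeasurePreserving (fun z : E2 × ℝ => ((WithLp.ofLp z.1 : Fin 2 → ℝ), z.2)) :=
    (PiLp.volume_preserving_ofLp (Fin 2)).prod (MeasurePreserving.id volume)
  have h2 : MeasurePreserving (fun z : (Fin 2 → ℝ) × ℝ => (z.2, z.1)) :=
    Measure.measurePreserving_swap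
  have h3 := (volume_preserving_piFinSuccAbove (fun _ : Fin 3 => ℝ) (Fin.last 2)).symm
  have h4 := PiLp.volume_preserving_toLp (Fin 3)
  convert h4.comp (h3.comp (h2.comp h1)) using 1
  funext z
  ext i
  fin_cases i
  · simp [joinPt, Fin.insertNthEquiv]; rfl
  · simp [joinPt, Fin.insertNthEquiv]; rfl
  · simp [joinPt, Fin.insertNthEquiv]

theorem measurePreserving_frameHomeo (R : E3 ≃ᵃⁱ[ℝ] E3) : MeasurePreserving (frameHomeo R) := by
  have h : MeasurePreserving R := by
    have h1 := R.linearIsometryEquiv.measurePreserving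
    have h2 := (measurePreserving_add_right (volume : Measure E3) (R 0)).comp h1
    have h3 : (fun x => x + R 0) ∘ R.linearIsometryEquiv = R := by
      funext x
      have := R.map_vadd 0 x
      simp only [vadd_eq_add, add_zero] at this
      exact this.symm
    rwa [h3] at h2
  exact h.comp measurePreserving_joinPt

theorem lipschitzWith_frameHomeo_symm (R : E3 ≃ᵃⁱ[ℝ] E3) : LipschitzWith 1 (frameHomeo R).symm := by
  have h : LipschitzWith 1 fun x : E3 => (planePart x, x 2) := by
    refine LipschitzWith.of_dist_le_mul fun x y => ?_
    have h1 := norm_joinPt_sq (planePart x - planePart y) (x 2 - y 2)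
    have h2 : joinPt (planePart x - planePart y) (x 2 - y 2) = x - y := by
      rw [sub_eq_add_neg, sub_eq_add_neg, joinPt_add, joinPt_neg, joinPt_planePart,
        joinPt_planePart, sub_eq_add_neg]
    rw [h2] at h1
    rw [NNReal.coe_one, one_mul, Prod.dist_eq, dist_eq_norm, dist_eq_norm, dist_eq_norm,
      Real.norm_eq_abs]
    refine max_le (abs_le_of_sq_le_sq' ?_ (norm_nonneg _)).2
      (abs_le_of_sq_le_sq (by nlinarith [sq_nonneg ‖planePart x - planePart y‖]) (norm_nonneg _) |>
        fun h => abs_le.2 (abs_le.1 h))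
    nlinarith [sq_nonneg (x 2 - y 2)]
  have := h.comp R.symm.isometry.lipschitz
  rw [one_mul] at this
  exact this

theorem lineDeriv_comp_frameHomeo_symm (θ : E2 × ℝ → ℝ) (z w : E2 × ℝ) :
    lineDeriv ℝ (θ ∘ (frameHomeo R).symm) (frameHomeo R z)
      (R.linearIsometryEquiv (joinPt w.1 w.2)) = lineDeriv ℝ θ z w := by
  unfold lineDeriv
  congr 1
  funext t
  have : frameHomeo R z + t • R.linearIsometryEquiv (joinPt w.1 w.2) = frameHomeo R (z + t • w) := by
    rw [frameHomeo_add, Prod.smul_fst, Prod.smul_snd, smul_eq_mul, joinPt_smul, map_smul]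
  rw [this, Function.comp_apply, Homeomorph.symm_apply_apply]

theorem HasCompactSupport.comp_frameHomeo_symm {θ : E2 × ℝ → ℝ} (hθ : HasCompactSupport θ) :
    HasCompactSupport (θ ∘ (frameHomeo R).symm) :=
  hθ.comp_homeomorph _

theorem integral_comp_frameHomeo (R : E3 ≃ᵃⁱ[ℝ] E3) (f : E3 → ℝ) :
    ∫ z, f (frameHomeo R z) = ∫ x, f x :=
  (measurePreserving_frameHomeo R).integral_comp (frameHomeo R).measurableEmbedding f

variable {Ω : Set E3} {v : E3 → E3} {G : E3 → E3 →L[ℝ] E3}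

theorem locallyIntegrable_comp_frameHomeo {V : Type*} [NormedAddCommGroup V] [NormedSpace ℝ V]
    {f : E3 → V} (hΩ : MeasurableSet Ω) (hf : MemLp f 2 (volume.restrict Ω)) (T : V →L[ℝ] ℝ)
    (R : E3 ≃ᵃⁱ[ℝ] E3) : LocallyIntegrable fun z => T (Ω.indicator f (frameHomeo R z)) :=
  (T.comp_memLp' (((memLp_indicator_iff_restrict hΩ).2 hf).comp_measurePreserving
    (measurePreserving_frameHomeo R))).locallyIntegrable (by norm_num)

theorem MemW012.locallyIntegrable_inner (hΩ : MeasurableSet Ω) (hv : MemW012 Ω v G)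
    (R : E3 ≃ᵃⁱ[ℝ] E3) (w : E3) :
    LocallyIntegrable fun z => inner ℝ w (Ω.indicator v (frameHomeo R z)) :=
  locallyIntegrable_comp_frameHomeo hΩ hv.1 (innerSL ℝ w) R

theorem MemW012.locallyIntegrable_inner_gradient (hΩ : MeasurableSet Ω) (hv : MemW012 Ω v G)
    (R : E3 ≃ᵃⁱ[ℝ] E3) (w e : E3) :
    LocallyIntegrable fun z => inner ℝ w (Ω.indicator G (frameHomeo R z) e) :=
  locallyIntegrable_comp_frameHomeo hΩ hv.2.1
    ((innerSL ℝ w).comp (ContinuousLinearMap.apply ℝ E3 e)) R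

theorem MemW012.integral_lineDeriv_comp_frameHomeo (hΩ : MeasurableSet Ω) (hv : MemW012 Ω v G)
    {θ : E2 × ℝ → ℝ} {C : ℝ≥0} (hθ : LipschitzWith C θ) (hc : HasCompactSupport θ)
    (R : E3 ≃ᵃⁱ[ℝ] E3) (p : E2 × ℝ) (w : E3) :
    ∫ z, lineDeriv ℝ θ z p * inner ℝ w (Ω.indicator v (frameHomeo R z)) =
      - ∫ z, θ z * inner ℝ w (Ω.indicator G (frameHomeo R z)
        (R.linearIsometryEquiv (joinPt p.1 p.2))) := by
  have key := hv.integral_lineDeriv_mul (hθ.comp (lipschitzWith_frameHomeo_symm R))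
    (HasCompactSupport.comp_frameHomeo_symm hc) (R.linearIsometryEquiv (joinPt p.1 p.2)) w
  rw [← integral_indicator hΩ, ← integral_indicator hΩ, ← integral_comp_frameHomeo R,
    ← integral_comp_frameHomeo R] at key
  convert key using 2
  · funext z
    by_cases hz : frameHomeo R z ∈ Ω
    · rw [indicator_of_mem hz, indicator_of_mem hz, lineDeriv_comp_frameHomeo_symm]
    · rw [indicator_of_notMem hz, indicator_of_notMem hz, inner_zero_right, mul_zero]
  · congr 1
    funext z
    by_cases hz : frameHomeo R z ∈ Ω
    · rw [indicator_of_mem hz, indicator_of_mem hz, Function.comp_apply,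
        Homeomorph.symm_apply_apply]
    · rw [indicator_of_notMem hz, indicator_of_notMem hz, zero_apply,
        inner_zero_right, mul_zero]

/-- The trace does not depend on the orthonormal basis, so the divergence keeps its form in a
rotated frame. -/
theorem sum_inner_frame (A : E3 →L[ℝ] E3) (L : E3 ≃ₗᵢ[ℝ] E3) :
    ∑ i : Fin 3, inner ℝ (L (EuclideanSpace.single i 1)) (A (L (EuclideanSpace.single i 1))) =
      ∑ i : Fin 3, (A (EuclideanSpace.single i 1)) i := by
  have h1 := LinearMap.trace_eq_sum_inner (A : E3 →ₗ[ℝ] E3)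
    ((EuclideanSpace.basisFun (Fin 3) ℝ).map L)
  have h2 := LinearMap.trace_eq_sum_inner (A : E3 →ₗ[ℝ] E3) (EuclideanSpace.basisFun (Fin 3) ℝ)
  rw [h1] at h2
  simpa [EuclideanSpace.inner_single_left] using h2

/-- The coordinate directions of the frame space. -/
noncomputable def frameDir (i : Fin 3) : E2 × ℝ :=
  (planePart (EuclideanSpace.single i 1), (EuclideanSpace.single i (1 : ℝ) : E3) 2)

theorem joinPt_frameDir (i : Fin 3) :
    joinPt (frameDir i).1 (frameDir i).2 = EuclideanSpace.single i 1 := joinPt_planePart _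

theorem frameDir_zero : frameDir 0 = (EuclideanSpace.single 0 1, (0 : ℝ)) := by
  refine Prod.ext ?_ (by simp [frameDir])
  ext i; fin_cases i <;> simp [frameDir, planePart]

theorem frameDir_one : frameDir 1 = (EuclideanSpace.single 1 1, (0 : ℝ)) := by
  refine Prod.ext ?_ (by simp [frameDir])
  ext i; fin_cases i <;> simp [frameDir, planePart]

theorem frameDir_two : frameDir 2 = ((0 : E2), (1 : ℝ)) := by
  refine Prod.ext ?_ (by simp [frameDir])
  ext i; fin_cases i <;> simp [frameDir, planePart]

theorem MemW012.sum_integral_lineDeriv_frameDir (hΩ : MeasurableSet Ω) (hv : MemW012 Ω v G)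
    (hd : DivFree Ω G) {θ : E2 × ℝ → ℝ} {C : ℝ≥0} (hθ : LipschitzWith C θ)
    (hc : HasCompactSupport θ) (R : E3 ≃ᵃⁱ[ℝ] E3) :
    ∑ i : Fin 3, ∫ z, lineDeriv ℝ θ z (frameDir i) *
      inner ℝ (R.linearIsometryEquiv (EuclideanSpace.single i 1))
        (Ω.indicator v (frameHomeo R z)) = 0 := by
  simp only [hv.integral_lineDeriv_comp_frameHomeo hΩ hθ hc R, joinPt_frameDir]
  rw [Finset.sum_neg_distrib, neg_eq_zero, ← integral_finsetSum]
  · refine integral_eq_zero_of_ae ?_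
    have h1 : ∀ᵐ x, x ∈ Ω → ∑ i : Fin 3, (G x (EuclideanSpace.single i 1)) i = 0 :=
      (ae_restrict_iff' hΩ).1 hd
    filter_upwards [(measurePreserving_frameHomeo R).quasiMeasurePreserving.ae h1] with z hz
    simp only [Pi.zero_apply, ← Finset.mul_sum, sum_inner_frame]
    by_cases hzΩ : frameHomeo R z ∈ Ω
    · rw [indicator_of_mem hzΩ, hz hzΩ, mul_zero]
    · simp [indicator_of_notMem hzΩ]
  · intro i _
    exact integrable_mul_of_hasCompactSupport hθ.continuous hc
      (hv.locallyIntegrable_inner_gradient hΩ R _ _)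

end coordinates

theorem integrableOn_smul_of_tsupport_subset {V : Type*} [NormedAddCommGroup V] [NormedSpace ℝ V]
    {U : Set E3} {f : E3 → V} (hf : LocallyIntegrableOn f U) {φ : E3 → ℝ} (hφ : Continuous φ)
    {k : Set E3} (hk : IsCompact k) (hkU : k ⊆ U) (hs : ∀ x, x ∉ k → φ x = 0) :
    IntegrableOn (fun x => φ x • f x) U := by
  have h1 : IntegrableOn (fun x => φ x • f x) k :=
    (hf.integrableOn_compact_subset hkU hk).continuousOn_smul hφ.continuousOn hk
  have h2 : Integrable fun x => φ x • f x := by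
    refine (integrableOn_iff_integrable_of_support_subset fun z hz => ?_).1 h1
    by_contra h
    exact hz (by simp [hs z h])
  exact h2.integrableOn

theorem locallyIntegrableOn_clm_comp {V W : Type*} [NormedAddCommGroup V] [NormedSpace ℝ V]
    [NormedAddCommGroup W] [NormedSpace ℝ W] {U : Set E3} {f : E3 → V}
    (hf : LocallyIntegrableOn f U) (T : V →L[ℝ] W) : LocallyIntegrableOn (fun x => T (f x)) U :=
  fun x hx => by
    obtain ⟨t, ht, h⟩ := hf x hx
    exact ⟨t, ht, T.integrable_comp h⟩

theorem HasWeakGradient.integral_fderiv_mul_inner {U : Set E3} {G : E3 → E3 →L[ℝ] E3}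
    {H : E3 → E3 →L[ℝ] E3 →L[ℝ] E3} (hH : HasWeakGradient U G H) {φ : E3 → ℝ}
    (hφ : ContDiff ℝ ∞ φ) (hc : HasCompactSupport φ) (hs : tsupport φ ⊆ U) (e w : E3) :
    ∫ x in U, fderiv ℝ φ x e * inner ℝ w (G x e) = - ∫ x in U, φ x * inner ℝ w (H x e e) := by
  obtain ⟨hG, hHl, hi⟩ := hH
  have key := hi φ hφ hc hs e
  have hHe : LocallyIntegrableOn (fun x => H x e) U :=
    locallyIntegrableOn_clm_comp hHl (ContinuousLinearMap.apply ℝ (E3 →L[ℝ] E3) e)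
  let T : (E3 →L[ℝ] E3) →L[ℝ] ℝ := (innerSL ℝ w).comp (ContinuousLinearMap.apply ℝ E3 e)
  have i1 : IntegrableOn (fun x => fderiv ℝ φ x e • G x) U :=
    integrableOn_smul_of_tsupport_subset hG
      ((hφ.continuous_fderiv (by simp)).clm_apply continuous_const) hc.isCompact hs
      fun x hx => by
        have := image_eq_zero_of_notMem_tsupport (f := fderiv ℝ φ)
          (fun h => hx (tsupport_fderiv_subset ℝ h))
        rw [this]; simp
  have i2 : IntegrableOn (fun x => φ x • H x e) U :=
    integrableOn_smul_of_tsupport_subset hHe hφ.continuous hc.isCompact hs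
      fun x hx => image_eq_zero_of_notMem_tsupport hx
  have h1 := T.integral_comp_comm i1
  have h2 := T.integral_comp_comm i2
  have h3 := congrArg T key
  rw [map_neg, ← h1, ← h2] at h3
  simpa [T] using h3

/-- Moving the derivative from `θ` to the gradient produces `H`, of which only the `L¹` norm over
the set carrying `θ` is needed. This supplies the constant `N` of `gap_flux_estimate`. -/
theorem abs_integral_lineDeriv_gradient_le {F C : Set E3} (hF : IsOpen F) (hCF : C ⊆ F) {G : E3 → E3 →L[ℝ] E3} {H : E3 → E3 →L[ℝ] E3 →L[ℝ] E3}
    (hH : HasWeakGradient F G H) {θ : E3 → ℝ} {L : ℝ≥0} (hθ : LipschitzWith L θ)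
    (hc : HasCompactSupport θ) (hs : tsupport θ ⊆ F) (hθC : ∀ x, x ∉ C → θ x = 0) {B : ℝ}
    (hB : ∀ x, |θ x| ≤ B) {N : ℝ} (hN : ∫⁻ x in C, ‖H x‖ₑ ≤ ENNReal.ofReal N) (hN0 : 0 ≤ N)
    {e w : E3} (he : ‖e‖ ≤ 1) (hw : ‖w‖ ≤ 1) :
    |∫ x in F, lineDeriv ℝ θ x e * inner ℝ w (G x e)| ≤ B * N := by
  have hB0 : 0 ≤ B := (abs_nonneg _).trans (hB 0)
  have hg : LocallyIntegrableOn (fun x => inner ℝ w (G x e)) F :=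
    locallyIntegrableOn_clm_comp hH.1 ((innerSL ℝ w).comp (ContinuousLinearMap.apply ℝ E3 e))
  have hh : LocallyIntegrableOn (fun x => inner ℝ w (H x e e)) F :=
    locallyIntegrableOn_clm_comp hH.2.1 ((innerSL ℝ w).comp ((ContinuousLinearMap.apply ℝ E3 e).comp
      (ContinuousLinearMap.apply ℝ (E3 →L[ℝ] E3) e)))
  rw [integral_lineDeriv_mul_of_forall_contDiff hF hg hh e
    (fun φ h1 h2 h3 => hH.integral_fderiv_mul_inner h1 h2 h3 e w) hθ hc hs, abs_neg,
    setIntegral_eq_of_subset_of_forall_sdiff_eq_zero hF.measurableSet hCF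
      (fun x hx => by rw [hθC x hx.2, zero_mul])]
  have h1 : ∀ x, ‖θ x * inner ℝ w (H x e e)‖ₑ ≤ ENNReal.ofReal B * ‖H x‖ₑ := fun x => by
    rw [enorm_mul]
    gcongr
    · rw [← ofReal_norm]
      exact ENNReal.ofReal_le_ofReal (hB x)
    · rw [← ofReal_norm, ← ofReal_norm]
      refine ENNReal.ofReal_le_ofReal ?_
      calc ‖inner ℝ w (H x e e)‖ ≤ ‖w‖ * ‖H x e e‖ := norm_inner_le_norm _ _
        _ ≤ 1 * (‖H x‖ * 1 * 1) := by
          gcongr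
          exact ((H x e).le_of_opNorm_le_of_le ((H x).le_of_opNorm_le_of_le le_rfl he) he)
        _ = ‖H x‖ := by ring
  have h2 : ‖∫ x in C, θ x * inner ℝ w (H x e e)‖ₑ ≤ ENNReal.ofReal (B * N) :=
    calc _ ≤ ∫⁻ x in C, ‖θ x * inner ℝ w (H x e e)‖ₑ := enorm_integral_le_lintegral_enorm _
      _ ≤ ∫⁻ x in C, ENNReal.ofReal B * ‖H x‖ₑ := lintegral_mono h1
      _ = ENNReal.ofReal B * ∫⁻ x in C, ‖H x‖ₑ := lintegral_const_mul' _ _ ENNReal.ofReal_ne_top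
      _ ≤ ENNReal.ofReal B * ENNReal.ofReal N := by gcongr
      _ = _ := (ENNReal.ofReal_mul hB0).symm
  rw [← ofReal_norm] at h2
  exact (ENNReal.ofReal_le_ofReal_iff (by positivity)).1 h2

section frame

variable {R : E3 ≃ᵃⁱ[ℝ] E3} {P Q : E3} {h : ℝ}

theorem frame_sub (hQ : R 0 = Q) (x : E3) : R x - Q = R.linearIsometryEquiv x := by
  have := R.map_vadd 0 x
  simp only [vadd_eq_add, add_zero, hQ] at this
  rw [this, add_sub_cancel_right]

theorem frame_unit (hQ : R 0 = Q) (hP : R (joinPt 0 h) = P) (hh : 0 < h) :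
    ‖P - Q‖⁻¹ • (P - Q) = R.linearIsometryEquiv (joinPt 0 1) := by
  rw [← hP, frame_sub hQ, R.linearIsometryEquiv.norm_map, norm_joinPt_zero_left, abs_of_pos hh,
    ← map_smul, ← joinPt_smul, smul_zero, inv_mul_cancel₀ hh.ne']

theorem axialCoord_frameHomeo (hQ : R 0 = Q) (hP : R (joinPt 0 h) = P) (hh : 0 < h)
    (z : E2 × ℝ) : axialCoord P Q (frameHomeo R z) = z.2 := by
  rw [axialCoord, frame_unit hQ hP hh, frameHomeo_apply, frame_sub hQ,
    LinearIsometryEquiv.inner_map_map, inner_joinPt]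
  simp

theorem radialCoord_frameHomeo (hQ : R 0 = Q) (hP : R (joinPt 0 h) = P) (hh : 0 < h)
    (z : E2 × ℝ) : radialCoord P Q (frameHomeo R z) = ‖z.1‖ := by
  rw [radialCoord, axialCoord_frameHomeo hQ hP hh, frame_unit hQ hP hh, frameHomeo_apply,
    frame_sub hQ, ← map_smul, ← map_sub, LinearIsometryEquiv.norm_map,
    ← norm_joinPt_zero_right z.1, sub_eq_add_neg, ← joinPt_smul, ← joinPt_neg, ← joinPt_add]
  simp

theorem frame_dist (hQ : R 0 = Q) (hP : R (joinPt 0 h) = P) (hh : 0 < h) : dist P Q = h := by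
  rw [dist_eq_norm, ← hP, frame_sub hQ, LinearIsometryEquiv.norm_map, norm_joinPt_zero_left,
    abs_of_pos hh]

theorem frameHomeo_mem_cylinder (hQ : R 0 = Q) (hP : R (joinPt 0 h) = P) (hh : 0 < h) {K σ : ℝ}
    (z : E2 × ℝ) : frameHomeo R z ∈ cylinder K P Q σ ↔
      z ∈ Metric.ball (0 : E2) σ ×ˢ Ioo (-(K * σ ^ 2)) (h + 2 * K * σ ^ 2) := by
  simp only [cylinder, mem_ofPred_eq, radialCoord_frameHomeo hQ hP hh,
    axialCoord_frameHomeo hQ hP hh, frame_dist hQ hP hh, mem_prod, mem_ball_zero_iff, mem_Ioo]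

theorem preimage_cylinder (hQ : R 0 = Q) (hP : R (joinPt 0 h) = P) (hh : 0 < h) {K σ : ℝ} :
    frameHomeo R ⁻¹' cylinder K P Q σ =
      Metric.ball (0 : E2) σ ×ˢ Ioo (-(K * σ ^ 2)) (h + 2 * K * σ ^ 2) :=
  Set.ext fun z => frameHomeo_mem_cylinder hQ hP hh z

theorem isOpen_cylinder (hQ : R 0 = Q) (hP : R (joinPt 0 h) = P) (hh : 0 < h) {K σ : ℝ} :
    IsOpen (cylinder K P Q σ) := by
  rw [← (frameHomeo R).isOpen_preimage, preimage_cylinder hQ hP hh]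
  exact Metric.isOpen_ball.prod isOpen_Ioo

theorem volume_cylinder (hQ : R 0 = Q) (hP : R (joinPt 0 h) = P) (hh : 0 < h) {K σ : ℝ}
    (hσ : 0 ≤ σ) : volume (cylinder K P Q σ) =
      ENNReal.ofReal (Real.pi * σ ^ 2 * (h + 3 * K * σ ^ 2)) := by
  rw [← (measurePreserving_frameHomeo R).measure_preimage
    (isOpen_cylinder hQ hP hh).measurableSet.nullMeasurableSet, preimage_cylinder hQ hP hh,
    Measure.volume_eq_prod, Measure.prod_prod, Real.volume_Ioo,
    EuclideanSpace.volume_ball_fin_two, show h + 2 * K * σ ^ 2 - -(K * σ ^ 2) = h + 3 * K * σ ^ 2 by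
    ring, ENNReal.ofReal_mul (p := Real.pi * σ ^ 2) (by positivity), mul_comm Real.pi,
    ENNReal.ofReal_mul (p := σ ^ 2) (by positivity), ENNReal.ofReal_pow hσ]

end frame

/-! ### The estimate of the normal velocity. -/

theorem lintegral_enorm_le_of_volume_le {V : Type*} [NormedAddCommGroup V] {f : E3 → V} {C : Set E3}
    (hf : AEStronglyMeasurable f (volume.restrict C)) {m : ℝ} (hm : 0 ≤ m)
    (hC : volume C ≤ ENNReal.ofReal m) :
    ∫⁻ x in C, ‖f x‖ₑ ≤ ENNReal.ofReal √m * eLpNorm f 2 (volume.restrict C) := by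
  have h1 := eLpNorm_le_eLpNorm_mul_rpow_measure_univ (μ := volume.restrict C) (p := 1) (q := 2)
    (by norm_num) hf
  rw [eLpNorm_one_eq_lintegral_enorm, Measure.restrict_apply_univ, mul_comm] at h1
  refine h1.trans ?_
  gcongr
  norm_num
  rw [Real.sqrt_eq_rpow, ← ENNReal.ofReal_rpow_of_nonneg hm (by norm_num)]
  exact ENNReal.rpow_le_rpow hC (by norm_num)

theorem inner_cross_self (w x : E3) : inner ℝ (cross w x) x = 0 := by
  simp only [cross, PiLp.inner_apply, cross_apply, Fin.sum_univ_three, RCLike.inner_apply,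
    conj_trivial]
  simp
  ring

theorem cross_add (w x y : E3) : cross w (x + y) = cross w x + cross w y := by
  simp [cross]

theorem cross_smul (w : E3) (c : ℝ) (x : E3) : cross w (c • x) = c • cross w x := by
  simp [cross]

theorem norm_cross_le (w x : E3) : ‖cross w x‖ ≤ ‖w‖ * ‖x‖ := by
  refine abs_le_of_sq_le_sq' ?_ (by positivity) |>.2
  rw [mul_pow, EuclideanSpace.real_norm_sq_eq, EuclideanSpace.real_norm_sq_eq,
    EuclideanSpace.real_norm_sq_eq]
  simp only [cross, cross_apply, Fin.sum_univ_three]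
  simp
  nlinarith [sq_nonneg (w 0 * x 0 + w 1 * x 1 + w 2 * x 2)]

/-- The linear map `x ↦ w × x`. -/
noncomputable def crossCLM (w : E3) : E3 →L[ℝ] E3 :=
  LinearMap.mkContinuous ⟨⟨cross w, cross_add w⟩, cross_smul w⟩ ‖w‖ (norm_cross_le w)

@[simp] theorem crossCLM_apply (w x : E3) : crossCLM w x = cross w x := rfl

theorem cross_sub (w x y : E3) : cross w (x - y) = cross w x - cross w y :=
  map_sub (crossCLM w) x y

/-- Polarization of `inner_cross_self`; it yields the antisymmetry of `A` in the flux estimate. -/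
theorem inner_cross_swap (w x y : E3) : inner ℝ x (cross w y) = - inner ℝ y (cross w x) := by
  have h := inner_cross_self w (x + y)
  rw [cross_add, inner_add_left, inner_add_right, inner_add_right, inner_cross_self,
    inner_cross_self, real_inner_comm y, real_inner_comm x] at h
  linarith

/-- The flux estimate takes graphs defined and bounded on the whole plane; beyond `|y| = σ` their
values are irrelevant, since the weights vanish there. -/
theorem IsGapGraph.exists_extension {K ρ σ r : ℝ} {g : E2 → ℝ} (hg : IsGapGraph K ρ g)
    (hσ : σ < ρ) (hr : K * σ ^ 2 ≤ r) (hK : 0 ≤ K) (hr0 : 0 ≤ r) :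
    ∃ (L : ℝ≥0) (f : E2 → ℝ), LipschitzWith L f ∧ (∀ y, |f y| ≤ r) ∧ ∀ y, ‖y‖ ≤ σ → f y = g y := by
  obtain ⟨L, hL⟩ := hg.lipschitz
  obtain ⟨f, hf, hfg⟩ := hL.extend_real
  refine ⟨L, fun y => clamp r (f y), (hf.const_min r).const_max (-r),
    fun y => abs_clamp_le hr0 _, fun y hy => ?_⟩
  have h1 : f y = g y := (hfg (mem_ball_zero_iff.2 (hy.trans_lt hσ))).symm
  have h2 : |g y| ≤ r := (hg.abs_le y (hy.trans_lt hσ)).trans (le_trans (by gcongr) hr)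
  simp only [h1, clamp_of_abs_le h2]

/-- Lying strictly below the graph is an open condition, so an entire neighbourhood misses `S`. The
closure matters because the fluid region is `Ω` without `closure S`. -/
theorem notMem_closure_of_frame {S : Set E3} {R : E3 ≃ᵃⁱ[ℝ] E3} {b : E2 → ℝ} {ρ h δ : ℝ}
    (hb : ContinuousOn b (Metric.ball 0 ρ))
    (hS : ∀ y, ‖y‖ < ρ → ∀ s : ℝ, |s - h| < δ → (R (joinPt y s) ∈ S ↔ b y < s - h))
    {z : E2 × ℝ} (hz : ‖z.1‖ < ρ) (hz2 : |z.2 - h| < δ) (hzb : z.2 - h < b z.1) :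
    frameHomeo R z ∉ closure S := by
  have hc : ContinuousOn (fun z : E2 × ℝ => b z.1 - (z.2 - h))
      (Prod.fst ⁻¹' Metric.ball (0 : E2) ρ) :=
    (hb.comp continuousOn_fst fun _ h => h).sub (by fun_prop)
  have ho := (hc.isOpen_inter_preimage (Metric.isOpen_ball.preimage continuous_fst)
    isOpen_Ioi (t := Ioi 0)).inter
    (isOpen_lt (f := fun z : E2 × ℝ => |z.2 - h|) (g := fun _ => δ) (by fun_prop) (by fun_prop))
  have ho' := (frameHomeo R).isOpenMap _ ho
  intro hcl
  obtain ⟨x, ⟨z', ⟨⟨h1, h2⟩, h3⟩, rfl⟩, hxS⟩ := mem_closure_iff.1 hcl _ ho'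
    (mem_image_of_mem _ ⟨⟨mem_ball_zero_iff.2 hz, sub_pos.2 hzb⟩, hz2⟩)
  have h4 := (hS z'.1 (mem_ball_zero_iff.1 h1) z'.2 h3).1 hxS
  have h5 : 0 < b z'.1 - (z'.2 - h) := h2
  linarith

theorem norm_fst_le_of_mem_tsupport {θ : E2 × ℝ → ℝ} {σ : ℝ} (h : ∀ z, σ ≤ ‖z.1‖ → θ z = 0)
    {z : E2 × ℝ} (hz : z ∈ tsupport θ) : ‖z.1‖ ≤ σ := by
  have : tsupport θ ⊆ {z : E2 × ℝ | ‖z.1‖ ≤ σ} :=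
    closure_minimal (fun z hz => by
      by_contra hc
      exact hz (h z (not_le.1 hc).le)) (isClosed_le (by fun_prop) (by fun_prop))
  exact this hz

/-- The normal velocity of a rigid body at the point closest to the wall is controlled by the
second derivatives of the flow in the gap. -/
theorem normal_velocity_estimate {Ω S : Set E3} (hΩ : IsOpen Ω) (hS : IsOpen S) (hSΩ : S ⊆ Ω)
    {v : E3 → E3} {G : E3 → E3 →L[ℝ] E3} {H : E3 → E3 →L[ℝ] E3 →L[ℝ] E3}
    (hv : MemW012 Ω v G) (hd : DivFree Ω G) (hH : HasWeakGradient (fluid Ω S) G H) {c w x₀ : E3}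
    (hrig : ∀ᵐ x ∂(volume.restrict S), v x = c + cross w (x - x₀))
    {K ρ δ h σ : ℝ} (hK : 0 < K) (hh : 0 < h) (hσ : 0 < σ) (hKσ : K * σ ^ 2 = h / 4) (hσρ : σ < ρ)
    (hδ : 3 * h / 2 < δ) {R : E3 ≃ᵃⁱ[ℝ] E3} {a b : E2 → ℝ} {P Q : E3} (hQ : R 0 = Q)
    (hP : R (joinPt 0 h) = P) (ha : IsGapGraph K ρ a) (hb : IsGapGraph K ρ b)
    (hRΩ : ∀ y, ‖y‖ < ρ → ∀ s : ℝ, |s| < δ → (R (joinPt y s) ∈ Ω ↔ a y < s))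
    (hRS : ∀ y, ‖y‖ < ρ → ∀ s : ℝ, |s - h| < δ → (R (joinPt y s) ∈ S ↔ b y < s - h))
    {m : ℝ} (hm0 : 0 ≤ m)
    (hm : eLpNorm H 2 (volume.restrict (cylinder K P Q σ ∩ fluid Ω S)) ≤ ENNReal.ofReal m) :
    |inner ℝ (R.linearIsometryEquiv (joinPt 0 1)) (c + cross w (P - x₀))| *
        (9 / 64 * Real.pi * σ ^ 6) ≤
      9 / 4 * σ ^ 3 * h ^ 2 * (√(Real.pi * σ ^ 2 * (7 * h / 4)) * m) +
        Real.pi * h * σ ^ 6 * ‖c + cross w (P - x₀)‖ + 8 * Real.pi * σ ^ 5 * h ^ 2 * ‖w‖ := by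
  set L := R.linearIsometryEquiv with hL
  set V := c + cross w (P - x₀) with hV
  let e : Fin 3 → E3 := fun i => L (EuclideanSpace.single i 1)
  have he : ∀ i, ‖e i‖ = 1 := fun i => by simp [e]
  have he2 : e 2 = L (joinPt 0 1) := by
    have := joinPt_frameDir 2
    rw [frameDir_two] at this
    simp only [e, ← this]
  obtain ⟨La, a', hal, ha1, ha2⟩ := ha.exists_extension hσρ hKσ.le hK.le (by positivity)
  obtain ⟨Lb, b', hbl, hb1, hb2⟩ := hb.exists_extension hσρ hKσ.le hK.le (by positivity)
  have hΩm := hΩ.measurableSet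
  have hF : IsOpen (fluid Ω S) := hΩ.sdiff isClosed_closure
  have hcyl := isOpen_cylinder hQ hP hh (K := K) (σ := σ)
  have hσ3 : K * σ ^ 3 = h * σ / 4 := by linear_combination σ * hKσ
  have hqmp := (measurePreserving_frameHomeo R).quasiMeasurePreserving
  have hPdiff : ∀ z : E2 × ℝ, frameHomeo R z - P =
      z.1 0 • e 0 + z.1 1 • e 1 + (z.2 - h) • e 2 := fun z => by
    have h1 : frameHomeo R z = P + L (joinPt z.1 (z.2 - h)) := by
      have h2 := frameHomeo_add (R := R) (0, h) (z.1, z.2 - h)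
      have h3 : ((0 : E2), h) + (z.1, z.2 - h) = z := by simp
      rw [h3] at h2
      rw [h2, frameHomeo_apply, hP]
    rw [h1, add_sub_cancel_left]
    simp only [e, ← map_smul, ← map_add]
    congr 1
    ext i
    fin_cases i <;> simp [joinPt]
  -- In the frame `e` centred on the axis, `W` holds the components of the velocity at `P` and `A`
  -- is the matrix of `x ↦ w × x`; both fields are extended by zero outside `Ω`.
  have key := gap_flux_estimate (h := h) (σ := σ) (N := √(Real.pi * σ ^ 2 * (7 * h / 4)) * m) hh hσ
    (a := a') (b := fun y => b' y + h) hal (hbl.add (LipschitzWith.const h)) ha1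
    (fun y => by simpa using hb1 y)
    (fun y hy => by
      rw [ha2 y hy.le, ha2 (-y) (by simpa using hy.le)]
      refine (ha.abs_sub_le y (hy.trans hσρ)).trans (le_trans ?_ hσ3.le)
      gcongr)
    (fun y hy => by
      rw [hb2 y hy.le, hb2 (-y) (by simpa using hy.le), add_sub_add_right_eq_sub]
      refine (hb.abs_sub_le y (hy.trans hσρ)).trans (le_trans ?_ hσ3.le)
      gcongr)
    (u := fun i z => inner ℝ (e i) (Ω.indicator v (frameHomeo R z)))
    (G := fun i z => inner ℝ (e i.castSucc) (Ω.indicator G (frameHomeo R z) (e 2)))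
    (W := fun i => inner ℝ (e i) V) (A := fun i j => inner ℝ (e i) (cross w (e j)))
    (fun i j => inner_cross_swap _ _ _)
    (fun i => hv.locallyIntegrable_inner hΩm R _)
    (fun i => hv.locallyIntegrable_inner_gradient hΩm R _ _)
    (Eventually.of_forall fun z hz1 hz2 hz3 => by
      have h1 : frameHomeo R z ∉ Ω := fun hmem => by
        have h4 := abs_le.1 (ha1 z.1)
        have := (hRΩ z.1 (hz1.trans hσρ) z.2 (abs_lt.2 ⟨by linarith, by linarith⟩)).1 hmem
        rw [← ha2 z.1 hz1.le] at this
        linarith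
      simp [indicator_of_notMem h1])
    (by
      have r1 : ∀ᵐ x, x ∈ S → v x = c + cross w (x - x₀) :=
        (ae_restrict_iff' hS.measurableSet).1 hrig
      have r2 : ∀ i : Fin 2, ∀ᵐ x, x ∈ S →
          inner ℝ (e i.castSucc) (G x (e 2)) - inner ℝ (e i.castSucc) (crossCLM w (e 2)) = 0 :=
        fun i => hv.ae_eq_of_ae_eq_affine hS hSΩ (c := c - cross w x₀)
          (hrig.mono fun x hx => by rw [hx, cross_sub, crossCLM_apply]; abel) _ _
      filter_upwards [hqmp.ae r1, hqmp.ae (ae_all_iff.2 r2)] with z h1 h2 hz1 hz2 hz3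
      have h4 := abs_le.1 (hb1 z.1)
      have hzS : frameHomeo R z ∈ S :=
        (hRS z.1 (hz1.trans hσρ) z.2 (abs_lt.2 ⟨by linarith, by linarith⟩)).2 (by
          rw [← hb2 z.1 hz1.le]; linarith)
      rw [indicator_of_mem (hSΩ hzS), indicator_of_mem (hSΩ hzS)]
      refine ⟨fun i => ?_, fun i => ?_⟩
      · have h5 : frameHomeo R z - x₀ = (P - x₀) + (frameHomeo R z - P) := by abel
        rw [h1 hzS, h5, hPdiff, cross_add, ← add_assoc, ← hV, cross_add, cross_add, cross_smul,
          cross_smul, cross_smul]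
        simp only [inner_add_right, inner_smul_right]
        ring
      · exact sub_eq_zero.1 (h2 i hzS))
    (fun θ C hθ hc => by
      have := hv.sum_integral_lineDeriv_frameDir hΩm hd hθ hc R
      rw [Fin.sum_univ_three, frameDir_zero, frameDir_one, frameDir_two] at this
      exact this)
    (fun i θ C hθ hc => by
      have := hv.integral_lineDeriv_comp_frameHomeo hΩm hθ hc R (frameDir 2) (e i.castSucc)
      rw [joinPt_frameDir, frameDir_two] at this
      exact this)
    (fun i θ C hθ hc h0 hs B hB => by
      classical
      have ht : ∀ x ∈ tsupport (θ ∘ (frameHomeo R).symm), x ∈ fluid Ω S := fun x hx => by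
        have hx' : (frameHomeo R).symm x ∈ tsupport θ :=
          tsupport_comp_subset_preimage θ (frameHomeo R).symm.continuous hx
        obtain ⟨z, rfl⟩ := (frameHomeo R).surjective x
        rw [Homeomorph.symm_apply_apply] at hx'
        have hz1 := norm_fst_le_of_mem_tsupport h0 hx'
        obtain ⟨hz2, hz3⟩ := hs hx'
        have h4 := abs_le.1 (ha1 z.1)
        have h5 := abs_le.1 (hb1 z.1)
        refine ⟨(hRΩ z.1 (hz1.trans_lt hσρ) z.2 (abs_lt.2 ⟨by linarith, by linarith⟩)).2
          (by rwa [← ha2 z.1 hz1]), ?_⟩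
        obtain ⟨Lb', hLb'⟩ := hb.lipschitz
        refine notMem_closure_of_frame hLb'.continuousOn hRS (hz1.trans_lt hσρ)
          (abs_lt.2 ⟨by linarith, by linarith⟩) ?_
        rw [← hb2 z.1 hz1]
        linarith
      have hC : ∀ x, x ∉ cylinder K P Q σ ∩ fluid Ω S → (θ ∘ (frameHomeo R).symm) x = 0 :=
        fun x hx => by
          by_contra hne
          refine hx ⟨?_, ht x (subset_tsupport _ hne)⟩
          obtain ⟨z, rfl⟩ := (frameHomeo R).surjective x
          rw [Function.comp_apply, Homeomorph.symm_apply_apply] at hne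
          obtain ⟨hz2, hz3⟩ := hs (subset_tsupport _ hne)
          have h4 := abs_le.1 (ha1 z.1)
          have h5 := abs_le.1 (hb1 z.1)
          refine (frameHomeo_mem_cylinder hQ hP hh z).2 ⟨mem_ball_zero_iff.2 ?_, ?_, ?_⟩
          · by_contra hc; exact hne (h0 z (not_lt.1 hc))
          · linarith
          · linarith
      have hN : ∫⁻ x in cylinder K P Q σ ∩ fluid Ω S, ‖H x‖ₑ ≤
          ENNReal.ofReal (√(Real.pi * σ ^ 2 * (7 * h / 4)) * m) := by
        rw [ENNReal.ofReal_mul (by positivity)]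
        refine (lintegral_enorm_le_of_volume_le (f := H) (m := Real.pi * σ ^ 2 * (7 * h / 4)) ?_
          (by positivity) ?_).trans (mul_le_mul_right hm _)
        · exact hH.2.1.aestronglyMeasurable.mono_measure
            (Measure.restrict_mono inter_subset_right le_rfl)
        · refine (measure_mono inter_subset_left).trans ?_
          rw [volume_cylinder hQ hP hh hσ.le]
          refine ENNReal.ofReal_le_ofReal ?_
          -- The height of the cylinder is `h + 3Kσ²`, and `Kσ² = h/4`.
          rw [show h + 3 * K * σ ^ 2 = 7 * h / 4 by linear_combination 3 * hKσ]
      have := abs_integral_lineDeriv_gradient_le hF inter_subset_right hH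
        (hθ.comp (lipschitzWith_frameHomeo_symm R)) (HasCompactSupport.comp_frameHomeo_symm hc) ht
        hC (fun x => hB _) hN (by positivity) (he 2).le (he i.castSucc).le
      convert this using 2
      rw [← integral_indicator hF.measurableSet, ← integral_comp_frameHomeo R]
      congr 1
      funext z
      by_cases hz : frameHomeo R z ∈ tsupport (θ ∘ (frameHomeo R).symm)
      · have hzF := ht _ hz
        rw [indicator_of_mem hzF, indicator_of_mem hzF.1]
        have := lineDeriv_comp_frameHomeo_symm (R := R) θ z (frameDir 2)
        rw [joinPt_frameDir, frameDir_two] at this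
        rw [← this]
      · have h6 := lineDeriv_eq_zero_of_notMem_tsupport hz (e 2)
        have := lineDeriv_comp_frameHomeo_symm (R := R) θ z (frameDir 2)
        rw [joinPt_frameDir, frameDir_two] at this
        rw [← this]
        simp only [e] at h6
        rw [h6, zero_mul, indicator_apply, h6, zero_mul, ite_self])
  have hin : ∀ i, |inner ℝ (e i) V| ≤ ‖V‖ := fun i => by
    have := abs_real_inner_le_norm (e i) V
    rwa [he, one_mul] at this
  have hA : ∀ i, |inner ℝ (e i) (cross w (e 2))| ≤ ‖w‖ := fun i => by
    have := abs_real_inner_le_norm (e i) (cross w (e 2))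
    have h2 := norm_cross_le w (e 2)
    rw [he, one_mul] at this
    rw [he, mul_one] at h2
    exact this.trans h2
  rw [← he2]
  refine key.trans ?_
  have h1 := hin 0
  have h2 := hin 1
  have h3 := hA 0
  have h4 := hA 1
  calc _ ≤ 9 / 4 * σ ^ 3 * h ^ 2 * (√(Real.pi * σ ^ 2 * (7 * h / 4)) * m) +
        Real.pi / 2 * h * σ ^ 6 * (‖V‖ + ‖V‖) + 4 * Real.pi * σ ^ 5 * h ^ 2 * (‖w‖ + ‖w‖) := by
        gcongr
    _ = _ := by ring

/-- All constants come from the two sets of regularity constants and are chosen before `S`, so the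
bound is uniform over all positions of the body. -/
theorem exists_gap_velocity_bound {Ω : Set E3} (hΩ : IsOpen Ω) {K₁ σ₁ K₂ σ₂ : ℝ} (hK₁ : 0 < K₁)
    (hσ₁ : 0 < σ₁) (hK₂ : 0 < K₂) (hσ₂ : 0 < σ₂) (hΩr : IsUniformlyC3With K₁ σ₁ Ω) :
    ∃ K c₀ h₀ C : ℝ, 0 < K ∧ 0 < c₀ ∧ 0 < h₀ ∧ 0 < C ∧ ∀ (S : Set E3) (v : E3 → E3)
      (G : E3 → E3 →L[ℝ] E3) (H : E3 → E3 →L[ℝ] E3 →L[ℝ] E3) (c w x₀ P Q : E3) (h m : ℝ),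
      IsOpen S → S ⊆ Ω → IsUniformlyC3With K₂ σ₂ S → MemW012 Ω v G → DivFree Ω G →
      HasWeakGradient (fluid Ω S) G H →
      (∀ᵐ x ∂(volume.restrict S), v x = c + cross w (x - x₀)) →
      IsClosestPair Ω S P Q → setDist S (frontier Ω) = h → 0 < h → h < h₀ → 0 ≤ m →
      eLpNorm H 2 (volume.restrict (cylinder K P Q (c₀ * h ^ ((1 : ℝ) / 2)) ∩ fluid Ω S)) ≤
        ENNReal.ofReal m →
      |inner ℝ (‖P - Q‖⁻¹ • (P - Q)) (c + cross w (P - x₀))| ≤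
        C * h * (h ^ ((1 : ℝ) / 2) * m + ‖c + cross w (P - x₀)‖ + ‖w‖) := by
  set K := max K₁ K₂
  set ρ := min σ₁ σ₂
  set δ := min (K₁ * σ₁ ^ 2) (K₂ * σ₂ ^ 2)
  have hK : 0 < K := lt_max_of_lt_left hK₁
  have hρ : 0 < ρ := lt_min hσ₁ hσ₂
  have hδ : 0 < δ := lt_min (by positivity) (by positivity)
  -- The choice of `c₀` makes `Kσ² = h/4`; the threshold gives `σ < ρ` and `3h/2 < δ`. The three
  -- summands of the last constant arise on dividing the three terms of `normal_velocity_estimate`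
  -- by `9/64 π σ⁶`, with `h = 4Kσ²` and `σ < ρ`.
  refine ⟨K, 1 / (2 * √K), min (4 * K * ρ ^ 2) (δ / 2), 64 * K + 64 / 9 + 2048 / 9 * K * ρ, hK,
    by positivity, lt_min (by positivity) (by positivity), by positivity, ?_⟩
  intro S v G H c w x₀ P Q h m hS hSΩ hSr hv hd hH hrig hPQ hdist hh hh0 hm hHm
  obtain ⟨R, a, b, hQ, hP, ha, hb, hRΩ, hRS⟩ := exists_gap_frame hΩ hSΩ hΩr hSr hK₁.le hK₂.le
    (le_max_left _ _) (le_max_right _ _) (min_le_left σ₁ σ₂) (min_le_right σ₁ σ₂)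
    (min_le_left (K₁ * σ₁ ^ 2) (K₂ * σ₂ ^ 2)) (min_le_right _ _) hρ hδ hPQ hdist hh
  set σ := 1 / (2 * √K) * h ^ ((1 : ℝ) / 2) with hσdef
  set r := h ^ ((1 : ℝ) / 2) with hr
  have hrpos : 0 < r := Real.rpow_pos_of_pos hh _
  have hr2 : r ^ 2 = h := by rw [hr, ← Real.sqrt_eq_rpow, Real.sq_sqrt hh.le]
  have hσ : 0 < σ := by positivity
  have hσ2 : K * σ ^ 2 = h / 4 := by
    rw [hσdef, mul_pow, hr2, div_pow, mul_pow, Real.sq_sqrt hK.le]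
    field_simp
    norm_num
  have hσρ : σ < ρ := by
    have h1 : h < 4 * K * ρ ^ 2 := hh0.trans_le (min_le_left _ _)
    have h2 : K * σ ^ 2 < K * ρ ^ 2 := by linarith
    exact lt_of_pow_lt_pow_left₀ 2 hρ.le (lt_of_mul_lt_mul_left h2 hK.le)
  have h32 : 3 * h / 2 < δ := by
    have := hh0.trans_le (min_le_right (4 * K * ρ ^ 2) (δ / 2))
    linarith
  have key := normal_velocity_estimate hΩ hS hSΩ hv hd hH hrig hK hh hσ hσ2 hσρ h32 hQ hP ha hb
    hRΩ hRS hm hHm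
  rw [← frame_unit hQ hP hh] at key
  set V := ‖c + cross w (P - x₀)‖
  have hV : 0 ≤ V := norm_nonneg _
  have hw : 0 ≤ ‖w‖ := norm_nonneg _
  have hpos : 0 < 9 / 64 * Real.pi * σ ^ 6 := by positivity
  refine le_of_mul_le_mul_right (key.trans ?_) hpos
  have hπ := Real.pi_gt_three
  -- Uses `7/4 ≤ π`.
  have t1 : √(Real.pi * σ ^ 2 * (7 * h / 4)) ≤ Real.pi * σ * r := by
    have h1 : (Real.pi * σ * r) ^ 2 = Real.pi * (Real.pi * σ ^ 2 * h) := by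
      linear_combination (Real.pi ^ 2 * σ ^ 2) * hr2
    have h2 : 0 ≤ Real.pi * σ ^ 2 * h := by positivity
    rw [Real.sqrt_le_left (by positivity), h1]
    nlinarith
  have e1 : 9 / 4 * σ ^ 3 * h ^ 2 * (√(Real.pi * σ ^ 2 * (7 * h / 4)) * m) ≤
      (64 * K * h * (r * m)) * (9 / 64 * Real.pi * σ ^ 6) :=
    calc _ ≤ 9 / 4 * σ ^ 3 * h ^ 2 * (Real.pi * σ * r * m) := by gcongr
      _ = _ := by linear_combination (-9 * σ ^ 4 * h * Real.pi * r * m) * hσ2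
  have e3 : 8 * Real.pi * σ ^ 5 * h ^ 2 * ‖w‖ ≤
      (2048 / 9 * K * ρ * h * ‖w‖) * (9 / 64 * Real.pi * σ ^ 6) :=
    calc _ = 32 * Real.pi * K * σ * σ ^ 6 * h * ‖w‖ := by
            linear_combination (-32 * σ ^ 5 * h * Real.pi * ‖w‖) * hσ2
      _ ≤ 32 * Real.pi * K * ρ * σ ^ 6 * h * ‖w‖ := by gcongr
      _ = _ := by ring
  have e4 : (64 * K * h * (r * m)) + 64 / 9 * h * V + 2048 / 9 * K * ρ * h * ‖w‖ ≤
      (64 * K + 64 / 9 + 2048 / 9 * K * ρ) * h * (r * m + V + ‖w‖) := by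
    have p1 : 0 ≤ 64 * K * h * (V + ‖w‖) := by positivity
    have p2 : 0 ≤ 64 / 9 * h * (r * m + ‖w‖) := by positivity
    have p3 : 0 ≤ 2048 / 9 * K * ρ * h * (r * m + V) := by positivity
    linarith
  calc _ ≤ ((64 * K * h * (r * m)) + 64 / 9 * h * V + 2048 / 9 * K * ρ * h * ‖w‖) *
        (9 / 64 * Real.pi * σ ^ 6) := by linarith
    _ ≤ _ := mul_le_mul_of_nonneg_right e4 hpos.le

/-! ### Rigid motions driven by bounded velocities. -/

theorem ae_Ioo_of_forall_lt {p : ℝ → Prop} {T : ℝ}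
    (h : ∀ t' ∈ Ioo 0 T, ∀ᵐ t, t ∈ Ioo 0 t' → p t) : ∀ᵐ t, t ∈ Ioo 0 T → p t := by
  -- Rational end points leave only countably many null sets.
  have h1 : ∀ q : ℚ, ∀ᵐ t, (q : ℝ) ∈ Ioo 0 T → t ∈ Ioo 0 (q : ℝ) → p t := fun q => by
    by_cases hq : (q : ℝ) ∈ Ioo 0 T
    · filter_upwards [h q hq] with t ht _ using ht
    · exact Eventually.of_forall fun t h => (hq h).elim
  filter_upwards [ae_all_iff.2 h1] with t ht htT
  obtain ⟨q, hq1, hq2⟩ := exists_rat_btwn htT.2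
  exact ht q ⟨htT.1.trans hq1, hq2⟩ ⟨htT.1, hq1⟩

theorem IsTrajectory.ae_hasDerivAt {T : ℝ} {v : ℝ → E3 → E3} {x : ℝ → E3}
    (hx : IsTrajectory T v x) : ∀ᵐ t, t ∈ Ioo 0 T → HasDerivAt x (v t (x t)) t := by
  refine ae_Ioo_of_forall_lt fun t' ht' => ?_
  have h1 := (hx t' ⟨ht'.1.le, ht'.2⟩).1
  filter_upwards [h1.ae_hasDerivAt_integral] with t ht hm
  rw [uIcc_of_le ht'.1.le] at ht
  have h2 := (ht ⟨hm.1.le, hm.2.le⟩ 0 ⟨le_rfl, ht'.1.le⟩).const_add (x 0)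
  refine h2.congr_of_eventuallyEq ?_
  filter_upwards [Ioo_mem_nhds hm.1 hm.2] with s hs
  exact (hx s ⟨hs.1.le, hs.2.trans ht'.2⟩).2

/-- The square of the norm is absolutely continuous with derivative `2⟨d, f⟩ = 0` almost everywhere.
The functions `D i` continue the components of `d` beyond `[0, t]`, so that two-sided derivatives
make sense at every time. -/
theorem norm_eq_of_inner_eq_zero {d f : ℝ → E3} {t : ℝ} (ht : 0 ≤ t)
    (hf : IntervalIntegrable f volume 0 t)
    (hd : ∀ s ∈ Icc 0 t, d s = d 0 + ∫ r in (0 : ℝ)..s, f r)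
    (h0 : ∀ s ∈ Icc 0 t, inner ℝ (d s) (f s) = 0) : ‖d t‖ = ‖d 0‖ := by
  let D : Fin 3 → ℝ → ℝ := fun i s => d 0 i + ∫ r in (0 : ℝ)..s, f r i
  have hfi : ∀ i, IntervalIntegrable (fun r => f r i) volume 0 t := fun i =>
    ⟨(EuclideanSpace.proj i : E3 →L[ℝ] ℝ).integrable_comp hf.1,
      (EuclideanSpace.proj i : E3 →L[ℝ] ℝ).integrable_comp hf.2⟩
  have hsub : ∀ s ∈ Icc 0 t, uIcc 0 s ⊆ uIcc 0 t := fun s hs =>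
    uIcc_subset_uIcc_left (by rw [uIcc_of_le ht]; exact hs)
  have hD : ∀ i, ∀ s ∈ Icc 0 t, D i s = d s i := fun i s hs => by
    have h1 := (EuclideanSpace.proj i : E3 →L[ℝ] ℝ).intervalIntegral_comp_comm
      (hf.mono_set (hsub s hs))
    rw [hd s hs]
    simp only [D, PiLp.add_apply]
    congr 1
  have hAC : ∀ i, AbsolutelyContinuousOnInterval (D i) 0 t := fun i => by
    refine AbsolutelyContinuousOnInterval.add ?_
      ((hfi i).absolutelyContinuousOnInterval_intervalIntegral (by simp))
    exact (LipschitzWith.const (d 0 i)).lipschitzOnWith.absolutelyContinuousOnInterval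
  have hF : AbsolutelyContinuousOnInterval
      (fun s => D 0 s * D 0 s + D 1 s * D 1 s + D 2 s * D 2 s) 0 t :=
    (((hAC 0).fun_mul (hAC 0)).add ((hAC 1).fun_mul (hAC 1))).add ((hAC 2).fun_mul (hAC 2))
  obtain ⟨C, hC⟩ := hF.const_of_ae_hasDerivAt_zero (by
    filter_upwards [(hfi 0).ae_hasDerivAt_integral, (hfi 1).ae_hasDerivAt_integral,
      (hfi 2).ae_hasDerivAt_integral] with s h1 h2 h3 hs
    have k1 := (h1 hs 0 (by simp)).const_add (d 0 0)
    have k2 := (h2 hs 0 (by simp)).const_add (d 0 1)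
    have k3 := (h3 hs 0 (by simp)).const_add (d 0 2)
    refine (((k1.mul k1).add (k2.mul k2)).add (k3.mul k3)).congr_deriv ?_
    rw [uIcc_of_le ht] at hs
    have h4 := h0 s hs
    simp only [PiLp.inner_apply, Fin.sum_univ_three, RCLike.inner_apply, conj_trivial] at h4
    have e0 := hD 0 s hs
    have e1 := hD 1 s hs
    have e2 := hD 2 s hs
    simp only [D] at e0 e1 e2
    rw [e0, e1, e2]
    linarith)
  have hn : ∀ s ∈ Icc 0 t, ‖d s‖ ^ 2 = C := fun s hs => by
    rw [EuclideanSpace.real_norm_sq_eq, Fin.sum_univ_three, ← hD 0 s hs, ← hD 1 s hs, ← hD 2 s hs,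
      ← hC s (by rw [uIcc_of_le ht]; exact hs)]
    ring
  have h5 := (hn t ⟨ht, le_rfl⟩).trans (hn 0 ⟨le_rfl, ht⟩).symm
  exact (pow_left_inj₀ (norm_nonneg _) (norm_nonneg _) two_ne_zero).1 h5

section motion

variable {Ω S₀ : Set E3} {T : ℝ} {ustar om xstar : ℝ → E3} {X : ℝ → E3 → E3}

theorem rigidVelocity_sub (t : ℝ) (x y : E3) : rigidVelocity ustar om xstar t x -
    rigidVelocity ustar om xstar t y = cross (om t) (x - y) := by
  simp only [rigidVelocity, cross_sub]
  abel

theorem IsBodyMotion.dist_eq (hX : IsBodyMotion Ω S₀ T ustar om xstar X) {x y : E3} (hx : x ∈ S₀)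
    (hy : y ∈ S₀) {t : ℝ} (ht : t ∈ Ico 0 T) : dist (X t x) (X t y) = dist x y := by
  have h1 := hX.trajectory x hx
  have h2 := hX.trajectory y hy
  have h0 : (0 : ℝ) ≤ t := ht.1
  have := norm_eq_of_inner_eq_zero (d := fun s => X s x - X s y)
    (f := fun s => rigidVelocity ustar om xstar s (X s x) - rigidVelocity ustar om xstar s (X s y))
    h0 ((h1 t ht).1.sub (h2 t ht).1) (fun s hs => by
      have hs' : s ∈ Ico 0 T := ⟨hs.1, hs.2.trans_lt ht.2⟩
      rw [intervalIntegral.integral_sub (h1 s hs').1 (h2 s hs').1, 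
        show X s x = _ from (h1 s hs').2, show X s y = _ from (h2 s hs').2]
      abel)
    (fun s hs => by
      rw [rigidVelocity_sub, real_inner_comm]
      exact inner_cross_self _ _)
  simp only [hX.initial x hx, hX.initial y hy] at this
  rw [dist_eq_norm, dist_eq_norm, this]

end motion

/-- A distance preserving map on a set containing a simplex with orthogonal edges is the
restriction of a Euclidean motion. -/
theorem exists_affineIsometryEquiv_extension {S : Set E3} {f : E3 → E3}
    (hf : ∀ x ∈ S, ∀ y ∈ S, dist (f x) (f y) = dist x y) {x₀ : E3} (hx₀ : x₀ ∈ S) {r : ℝ}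
    (hr : 0 < r) (hS : ∀ i, x₀ + r • EuclideanSpace.single i (1 : ℝ) ∈ S) :
    ∃ A : E3 ≃ᵃⁱ[ℝ] E3, (∀ y ∈ S, A y = f y) ∧ ∀ y, A y = f x₀ + ∑ i, (y - x₀) i • r⁻¹ •
      (f (x₀ + r • EuclideanSpace.single i (1 : ℝ)) - f x₀) := by
  -- Polarization: distances determine the inner products of difference vectors.
  have hinner : ∀ x ∈ S, ∀ y ∈ S,
      inner ℝ (f x - f x₀) (f y - f x₀) = inner ℝ (x - x₀) (y - x₀) := fun x hx y hy => by
    have h1 := hf x hx x₀ hx₀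
    have h2 := hf y hy x₀ hx₀
    have h3 := hf x hx y hy
    rw [dist_eq_norm, dist_eq_norm] at h1 h2 h3
    have h4 := norm_sub_sq_real (f x - f x₀) (f y - f x₀)
    have h5 := norm_sub_sq_real (x - x₀) (y - x₀)
    rw [sub_sub_sub_cancel_right] at h4 h5
    rw [h1, h2, h3] at h4
    linarith
  let q : Fin 3 → E3 := fun i => r⁻¹ • (f (x₀ + r • EuclideanSpace.single i (1 : ℝ)) - f x₀)
  have hq : ∀ i, ∀ y ∈ S, inner ℝ (q i) (f y - f x₀) = (y - x₀) i := fun i y hy => by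
    simp only [q]
    rw [inner_smul_left, hinner _ (hS i) _ hy, add_sub_cancel_left, inner_smul_left,
      EuclideanSpace.inner_single_left]
    simp [hr.ne']
  have hon : Orthonormal ℝ q := by
    rw [orthonormal_iff_ite]
    intro i j
    have h1 := hq i _ (hS j)
    rw [add_sub_cancel_left] at h1
    have h2 : q j = r⁻¹ • (f (x₀ + r • EuclideanSpace.single j (1 : ℝ)) - f x₀) := rfl
    rw [h2, inner_smul_right, h1]
    simp only [PiLp.smul_apply, PiLp.single_apply, smul_eq_mul]
    rw [inv_mul_cancel_left₀ hr.ne']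
  let b : OrthonormalBasis (Fin 3) ℝ E3 :=
    (basisOfOrthonormalOfCardEqFinrank hon (by simp)).toOrthonormalBasis (by simpa using hon)
  have hb : ∀ i, b i = q i := fun i => by simp [b]
  let L : E3 ≃ₗᵢ[ℝ] E3 := b.repr.symm
  have hL : ∀ y, L y = ∑ i, y i • q i := fun y => by
    have := b.sum_repr (L y)
    simp only [L, LinearIsometryEquiv.apply_symm_apply, hb] at this
    exact this.symm
  let A : E3 ≃ᵃⁱ[ℝ] E3 := AffineIsometryEquiv.mk' (fun y => f x₀ + L (y - x₀)) L x₀ (fun y => by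
    simp [add_comm])
  have hA : ∀ y, A y = f x₀ + L (y - x₀) := fun y => rfl
  refine ⟨A, fun y hy => ?_, fun y => by rw [hA, hL]⟩
  have h1 : L (y - x₀) = f y - f x₀ := by
    rw [LinearIsometryEquiv.symm_apply_eq]
    ext i
    rw [b.repr_apply_apply, hb, hq i y hy]
  rw [hA, h1, add_sub_cancel]

section motion

variable {Ω S₀ : Set E3} {T : ℝ} {ustar om xstar : ℝ → E3} {X : ℝ → E3 → E3}

/-- The motion of all space is determined by four particles, so one null set of times serves every
`y`. This matters because the closest point varies with time and lies on the boundary, outside `S₀`.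
-/
theorem IsBodyMotion.exists_affine (hX : IsBodyMotion Ω S₀ T ustar om xstar X) (hS : IsOpen S₀)
    (hne : S₀.Nonempty) : ∃ A : ℝ → E3 ≃ᵃⁱ[ℝ] E3, (∀ t ∈ Ico 0 T, ∀ y ∈ S₀, A t y = X t y) ∧
      ∀ᵐ t, t ∈ Ioo 0 T → ∀ y,
        HasDerivAt (fun s => A s y) (rigidVelocity ustar om xstar t (A t y)) t := by
  obtain ⟨x₀, hx₀⟩ := hne
  obtain ⟨ε, hε, hball⟩ := Metric.isOpen_iff.1 hS x₀ hx₀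
  set r := ε / 2
  have hr : 0 < r := half_pos hε
  have hp : ∀ i, x₀ + r • EuclideanSpace.single i (1 : ℝ) ∈ S₀ := fun i => hball (by
    rw [Metric.mem_ball, dist_eq_norm, add_sub_cancel_left, norm_smul]
    simp [abs_of_pos hr]
    exact half_lt_self hε)
  have key : ∀ t, ∃ A : E3 ≃ᵃⁱ[ℝ] E3, t ∈ Ico 0 T → (∀ y ∈ S₀, A y = X t y) ∧
      ∀ y, A y = X t x₀ + ∑ i, (y - x₀) i • r⁻¹ •
        (X t (x₀ + r • EuclideanSpace.single i (1 : ℝ)) - X t x₀) := fun t => by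
    by_cases ht : t ∈ Ico 0 T
    · obtain ⟨A, hA⟩ := exists_affineIsometryEquiv_extension
        (fun x hx y hy => hX.dist_eq hx hy ht) hx₀ hr hp
      exact ⟨A, fun _ => hA⟩
    · exact ⟨.refl ℝ E3, fun h => (ht h).elim⟩
  choose A hA using key
  refine ⟨A, fun t ht => (hA t ht).1, ?_⟩
  filter_upwards [(hX.trajectory x₀ hx₀).ae_hasDerivAt,
    ae_all_iff.2 fun i => (hX.trajectory _ (hp i)).ae_hasDerivAt] with t h0 h1 ht y
  have hd : HasDerivAt (fun s => X s x₀ + ∑ i, (y - x₀) i • r⁻¹ •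
      (X s (x₀ + r • EuclideanSpace.single i (1 : ℝ)) - X s x₀)) _ t :=
    (h0 ht).add (HasDerivAt.fun_sum fun i _ =>
      (((h1 i ht).sub (h0 ht)).const_smul r⁻¹).const_smul ((y - x₀) i))
  refine (hd.congr_of_eventuallyEq ?_).congr_deriv ?_
  · filter_upwards [Ioo_mem_nhds ht.1 ht.2] with s hs
    exact (hA s ⟨hs.1.le, hs.2⟩).2 y
  · have h3 : A t y - X t x₀ = ∑ i, (y - x₀) i • r⁻¹ •
        (X t (x₀ + r • EuclideanSpace.single i (1 : ℝ)) - X t x₀) := by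
      rw [(hA t ⟨ht.1.le, ht.2⟩).2 y, add_sub_cancel_left]
    have h4 := rigidVelocity_sub (ustar := ustar) (om := om) (xstar := xstar) t (A t y) (X t x₀)
    rw [sub_eq_iff_eq_add'] at h4
    rw [h4, h3, ← crossCLM_apply, map_sum]
    congr 1
    refine Finset.sum_congr rfl fun i _ => ?_
    rw [map_smul, map_smul, crossCLM_apply, rigidVelocity_sub]

theorem MemLp.exists_norm_le_of_top {f : ℝ → E3} {T : ℝ}
    (hf : MemLp f ⊤ (volume.restrict (Ioo 0 T))) : ∃ M : ℝ, 0 ≤ M ∧ ∀ᵐ t, t ∈ Ioo 0 T → ‖f t‖ ≤ M := by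
  refine ⟨(eLpNormEssSup f (volume.restrict (Ioo 0 T))).toReal, ENNReal.toReal_nonneg, ?_⟩
  have h1 : eLpNormEssSup f (volume.restrict (Ioo 0 T)) < ⊤ := by
    rw [← eLpNorm_exponent_top]; exact hf.2
  filter_upwards [(ae_restrict_iff' measurableSet_Ioo).1
    (ae_le_eLpNormEssSup (f := f) (μ := volume.restrict (Ioo 0 T)))] with t ht htT
  have := ENNReal.toReal_mono h1.ne (ht htT)
  rwa [toReal_enorm] at this

/-- Since `xstar` stays in the closed body, the lever arm is at most the diameter of `S₀`, which the
motion preserves. -/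
theorem IsBodyMotion.exists_velocity_bound (hX : IsBodyMotion Ω S₀ T ustar om xstar X)
    (hb : Bornology.IsBounded S₀) : ∃ Λ : ℝ, 0 ≤ Λ ∧ ∀ᵐ t, t ∈ Ioo 0 T →
      ‖om t‖ ≤ Λ ∧ ∀ x ∈ closure (X t '' S₀), ‖rigidVelocity ustar om xstar t x‖ ≤ Λ := by
  obtain ⟨M₁, h10, h1⟩ := MemLp.exists_norm_le_of_top hX.ustar_bounded
  obtain ⟨M₂, h20, h2⟩ := MemLp.exists_norm_le_of_top hX.omega_bounded
  have hd0 : 0 ≤ Metric.diam S₀ := Metric.diam_nonneg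
  refine ⟨M₁ + M₂ * Metric.diam S₀ + M₂, by positivity, ?_⟩
  filter_upwards [h1, h2] with t k1 k2 ht
  have ht' : t ∈ Ico 0 T := ⟨ht.1.le, ht.2⟩
  refine ⟨(k2 ht).trans (by nlinarith), fun x hx => ?_⟩
  have hdist : ∀ p ∈ X t '' S₀, ∀ q ∈ X t '' S₀, dist p q ≤ Metric.diam S₀ := by
    rintro _ ⟨p, hp, rfl⟩ _ ⟨q, hq, rfl⟩
    rw [hX.dist_eq hp hq ht']
    exact Metric.dist_le_diam_of_mem hb hp hq
  have hbd : Bornology.IsBounded (closure (X t '' S₀)) :=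
    (Metric.isBounded_iff.2 ⟨_, fun p hp q hq => hdist p hp q hq⟩).closure
  have h3 : ‖x - xstar t‖ ≤ Metric.diam S₀ := by
    rw [← dist_eq_norm]
    refine (Metric.dist_le_diam_of_mem hbd hx (hX.xstar_mem t ht')).trans ?_
    rw [Metric.diam_closure]
    exact Metric.diam_le_of_forall_dist_le hd0 hdist
  calc ‖rigidVelocity ustar om xstar t x‖ ≤ ‖ustar t‖ + ‖cross (om t) (x - xstar t)‖ :=
        norm_add_le _ _
    _ ≤ M₁ + M₂ * Metric.diam S₀ := by
        gcongr
        · exact k1 ht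
        · exact (norm_cross_le _ _).trans (by gcongr; exact k2 ht)
    _ ≤ _ := by linarith

theorem IsBodyMotion.dist_le (hX : IsBodyMotion Ω S₀ T ustar om xstar X) {Λ : ℝ}
    (hΛ : ∀ᵐ t, t ∈ Ioo 0 T →
      ‖om t‖ ≤ Λ ∧ ∀ x ∈ closure (X t '' S₀), ‖rigidVelocity ustar om xstar t x‖ ≤ Λ)
    {x : E3} (hx : x ∈ S₀) {s t : ℝ} (hs : s ∈ Ico 0 T) (ht : t ∈ Ico 0 T) :
    dist (X t x) (X s x) ≤ Λ * |t - s| := by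
  have h1 := hX.trajectory x hx t ht
  have h2 := hX.trajectory x hx s hs
  rw [dist_eq_norm, show X t x = _ from h1.2, show X s x = _ from h2.2, add_sub_add_left_eq_sub,
    intervalIntegral.integral_interval_sub_left h1.1 h2.1]
  refine intervalIntegral.norm_integral_le_of_norm_le_const_ae ?_
  filter_upwards [hΛ] with r hr hm
  rw [mem_uIoc] at hm
  have hr' : r ∈ Ioo 0 T := by
    rcases hm with hm | hm
    · exact ⟨hs.1.trans_lt hm.1, hm.2.trans_lt ht.2⟩
    · exact ⟨ht.1.trans_lt hm.1, hm.2.trans_lt hs.2⟩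
  exact (hr hr').2 _ (subset_closure (mem_image_of_mem _ hx))

theorem IsUniformlyC3With.image {K σ : ℝ} {D : Set E3} (hD : IsUniformlyC3With K σ D)
    (A : E3 ≃ᵃⁱ[ℝ] E3) : IsUniformlyC3With K σ (A '' D) := by
  intro x hx
  have h1 : A.toHomeomorph '' frontier D = frontier (A.toHomeomorph '' D) :=
    A.toHomeomorph.image_frontier D
  have hx' : x ∈ A.toHomeomorph '' frontier D := by rw [h1]; exact hx
  obtain ⟨y, hy, rfl⟩ := hx'
  obtain ⟨R, g, h0, hc, h2, h3, h4⟩ := hD y hy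
  refine ⟨R.trans A, g, by simp [h0], hc, h2, h3, fun z hz s hs => ?_⟩
  rw [← h4 z hz s hs, AffineIsometryEquiv.coe_trans, Function.comp_apply,
    A.injective.mem_set_image]

end motion

/-! ### The distance to the wall as a function of time. -/

theorem exists_isClosestPair {Ω S : Set E3} (hS : IsOpen S) (hne : S.Nonempty)
    (hb : Bornology.IsBounded S) (hf : (frontier Ω).Nonempty) (hpos : 0 < setDist S (frontier Ω)) :
    ∃ P Q, IsClosestPair Ω S P Q := by
  obtain ⟨P, hP, hmin⟩ := (hb.isCompact_closure).exists_isMinOn hne.closure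
    (Metric.continuous_infDist_pt (frontier Ω)).continuousOn
  obtain ⟨Q, hQ, hPQ⟩ := isClosed_frontier.exists_infDist_eq_dist hf P
  have hd : dist P Q = setDist S (frontier Ω) := by
    refine le_antisymm (le_csInf (hne.image2 hf) ?_) (setDist_le_of_mem_closure hP hQ)
    rintro _ ⟨p, hp, q, hq, rfl⟩
    rw [← hPQ]
    exact (hmin (subset_closure hp)).trans (Metric.infDist_le_dist_of_mem hq)
  refine ⟨P, Q, ⟨hP, fun hi => ?_⟩, hQ, hd⟩
  rw [hS.interior_eq] at hi
  -- If `P` were interior, moving it slightly towards `Q` would bring the body closer to the wall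
  -- than its distance.
  have hc : Tendsto (fun s : ℝ => P + s • (Q - P)) (𝓝[>] 0) (𝓝 P) := by
    have : Continuous fun s : ℝ => P + s • (Q - P) := by fun_prop
    have h0 := this.tendsto 0
    simp only [zero_smul, add_zero] at h0
    exact h0.mono_left nhdsWithin_le_nhds
  obtain ⟨s, hs, hs0, hs1⟩ := ((hc.eventually (hS.mem_nhds hi)).and
    (Ioo_mem_nhdsGT (zero_lt_one (α := ℝ)))).exists
  have h1 := setDist_le hs hQ
  have h2 : P + s • (Q - P) - Q = (1 - s) • (P - Q) := by
    rw [sub_smul, one_smul, smul_sub, smul_sub]; abel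
  rw [dist_eq_norm, h2, norm_smul, Real.norm_of_nonneg (by linarith), ← dist_eq_norm, hd] at h1
  nlinarith

theorem setDist_image_le {S F : Set E3} {f g : E3 → E3} {c : ℝ} (hS : S.Nonempty) (hF : F.Nonempty)
    (h : ∀ x ∈ S, dist (f x) (g x) ≤ c) : setDist (f '' S) F ≤ setDist (g '' S) F + c := by
  rw [← sub_le_iff_le_add]
  refine le_csInf ((hS.image g).image2 hF) ?_
  rintro _ ⟨_, ⟨x, hx, rfl⟩, q, hq, rfl⟩
  have h1 : setDist (f '' S) F ≤ dist (f x) q := setDist_le (mem_image_of_mem _ hx) hq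
  have h2 := dist_triangle (f x) (g x) q
  have h3 := h x hx
  linarith

section motion

variable {Ω S₀ : Set E3} {T : ℝ} {ustar om xstar : ℝ → E3} {X : ℝ → E3 → E3}

theorem IsBodyMotion.gap_le (hX : IsBodyMotion Ω S₀ T ustar om xstar X) {Λ : ℝ}
    (hΛ : ∀ᵐ t, t ∈ Ioo 0 T →
      ‖om t‖ ≤ Λ ∧ ∀ x ∈ closure (X t '' S₀), ‖rigidVelocity ustar om xstar t x‖ ≤ Λ)
    (hne : S₀.Nonempty) (hf : (frontier Ω).Nonempty) {s t : ℝ} (hs : s ∈ Ico 0 T)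
    (ht : t ∈ Ico 0 T) : gap Ω S₀ X t ≤ gap Ω S₀ X s + Λ * |t - s| :=
  setDist_image_le hne hf fun _ hx => hX.dist_le hΛ hx hs ht

theorem IsBodyMotion.lipschitzOnWith_gap (hX : IsBodyMotion Ω S₀ T ustar om xstar X) {Λ : ℝ}
    (hΛ : ∀ᵐ t, t ∈ Ioo 0 T →
      ‖om t‖ ≤ Λ ∧ ∀ x ∈ closure (X t '' S₀), ‖rigidVelocity ustar om xstar t x‖ ≤ Λ)
    (hΛ0 : 0 ≤ Λ) (hne : S₀.Nonempty) (hf : (frontier Ω).Nonempty) :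
    LipschitzOnWith ⟨Λ, hΛ0⟩ (gap Ω S₀ X) (Ico 0 T) :=
  LipschitzOnWith.of_le_add_mul _ fun t ht s hs => by
    rw [Real.dist_eq]
    exact hX.gap_le hΛ hne hf hs ht

/-- Freeze the particle at `P` and the point `Q`. The function `‖A s p - Q‖² - gap(s)²` is
nonnegative and vanishes at `s = t`, so its derivative there is zero. The gap is differentiable
almost everywhere because it is Lipschitz; no regularity of `P` and `Q` in time is needed. -/
theorem IsBodyMotion.ae_hasDerivAt_gap (hX : IsBodyMotion Ω S₀ T ustar om xstar X) {Λ : ℝ}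
    (hΛ : ∀ᵐ t, t ∈ Ioo 0 T →
      ‖om t‖ ≤ Λ ∧ ∀ x ∈ closure (X t '' S₀), ‖rigidVelocity ustar om xstar t x‖ ≤ Λ)
    (hΛ0 : 0 ≤ Λ) (hS : IsOpen S₀) (hne : S₀.Nonempty) (hf : (frontier Ω).Nonempty) :
    ∀ᵐ t, t ∈ Ioo 0 T → ∀ P Q, IsClosestPair Ω (X t '' S₀) P Q → 0 < gap Ω S₀ X t →
      HasDerivAt (gap Ω S₀ X)
        (inner ℝ (‖P - Q‖⁻¹ • (P - Q)) (rigidVelocity ustar om xstar t P)) t := by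
  obtain ⟨A, hA, hAd⟩ := hX.exists_affine hS hne
  have himg : ∀ t ∈ Ico 0 T, X t '' S₀ = A t '' S₀ := fun t ht =>
    image_congr fun y hy => (hA t ht y hy).symm
  filter_upwards [hAd, (hX.lipschitzOnWith_gap hΛ hΛ0 hne hf).ae_differentiableWithinAt_of_mem_real]
    with t h1 h2 ht P Q hPQ hpos
  have ht' : t ∈ Ico 0 T := ⟨ht.1.le, ht.2⟩
  have hd : DifferentiableAt ℝ (gap Ω S₀ X) t :=
    (h2 ht').differentiableAt (Ico_mem_nhds ht.1 ht.2)
  obtain ⟨hP, hQ, hdist⟩ := hPQ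
  have hdist' : dist P Q = gap Ω S₀ X t := hdist
  obtain ⟨p, hp, rfl⟩ : ∃ p ∈ closure S₀, A t p = P := by
    have h3 : (A t).toHomeomorph '' closure S₀ = closure ((A t).toHomeomorph '' S₀) :=
      (A t).toHomeomorph.image_closure S₀
    have h4 : P ∈ (A t).toHomeomorph '' closure S₀ := by
      rw [h3]
      rw [himg t ht'] at hP
      exact frontier_subset_closure hP
    exact h4
  have hv := (h1 ht p).sub_const Q
  have hq := hv.norm_sq.sub (hd.hasDerivAt.pow 2)
  have hmin : IsLocalMin ((fun s => ‖A s p - Q‖ ^ 2) - (gap Ω S₀ X) ^ 2) t := by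
    have h0 : ((fun s => ‖A s p - Q‖ ^ 2) - (gap Ω S₀ X) ^ 2) t = 0 := by
      simp only [Pi.sub_apply, Pi.pow_apply]
      rw [← dist_eq_norm, hdist', sub_self]
    filter_upwards [Ioo_mem_nhds ht.1 ht.2] with s hs
    rw [h0]
    simp only [Pi.sub_apply, Pi.pow_apply]
    have h5 : gap Ω S₀ X s ≤ ‖A s p - Q‖ := by
      rw [← dist_eq_norm, gap, himg s ⟨hs.1.le, hs.2⟩]
      refine setDist_le_of_mem_closure ?_ hQ
      exact image_closure_subset_closure_image (A s).continuous (mem_image_of_mem _ hp)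
    have h6 : 0 ≤ gap Ω S₀ X s := setDist_nonneg _ _
    have := pow_le_pow_left₀ h6 h5 2
    linarith
  have h7 := hmin.hasDerivAt_eq_zero hq
  refine hd.hasDerivAt.congr_deriv ?_
  rw [inner_smul_left, ← dist_eq_norm, hdist']
  simp only [map_inv₀, conj_trivial]
  field_simp
  simp at h7
  linarith

end motion

/-! ### The logarithmic differential inequality. -/

theorem ofReal_integral_le_lintegral_ofReal {α : Type*} [MeasurableSpace α] {μ : Measure α}
    (f : α → ℝ) : ENNReal.ofReal (∫ x, f x ∂μ) ≤ ∫⁻ x, ENNReal.ofReal (f x) ∂μ := by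
  by_cases hf : Integrable f μ
  · rw [integral_eq_lintegral_pos_part_sub_lintegral_neg_part hf]
    refine (ENNReal.ofReal_le_ofReal (sub_le_self _ ENNReal.toReal_nonneg)).trans
      ENNReal.ofReal_toReal_le
  · simp [integral_undef hf]

/-- A Lipschitz function whose logarithmic derivative has an integrable lower bound stays
positive. -/
theorem exp_neg_mul_le_of_deriv {h : ℝ → ℝ} {F : ℝ → ℝ≥0∞} {t M : ℝ} {L : ℝ≥0} (ht : 0 ≤ t)
    (hL : LipschitzOnWith L h (Icc 0 t)) (hpos : ∀ s ∈ Icc 0 t, 0 < h s) (hM : 0 ≤ M)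
    (hF : ∀ᵐ s, s ∈ Ioo 0 t → ENNReal.ofReal (-deriv h s) ≤ ENNReal.ofReal (h s) * F s)
    (hint : ∫⁻ s in Ioo 0 t, F s ≤ ENNReal.ofReal M) : h 0 * Real.exp (-M) ≤ h t := by
  obtain ⟨s₀, hs₀, hmin⟩ := isCompact_Icc.exists_isMinOn (nonempty_Icc.2 ht) hL.continuousOn
  have hm := hpos s₀ hs₀
  -- Above its positive minimum `h` sees only a Lipschitz part of the logarithm, so `log ∘ h` is
  -- absolutely continuous.
  have hlog : LipschitzOnWith (Real.toNNReal (h s₀)⁻¹) Real.log (Ici (h s₀)) := by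
    refine LipschitzOnWith.of_le_add_mul _ fun x hx y hy => ?_
    have hx0 : 0 < x := hm.trans_le hx
    have hy0 : 0 < y := hm.trans_le hy
    rw [Real.coe_toNNReal _ (inv_nonneg.2 hm.le), Real.dist_eq]
    have h1 : Real.log x - Real.log y = Real.log (x / y) := (Real.log_div hx0.ne' hy0.ne').symm
    have h2 := Real.log_le_sub_one_of_pos (div_pos hx0 hy0)
    have h3 : x / y - 1 = y⁻¹ * (x - y) := by field_simp
    have h4 : y⁻¹ * (x - y) ≤ (h s₀)⁻¹ * |x - y| :=
      (mul_le_mul_of_nonneg_left (le_abs_self _) (inv_nonneg.2 hy0.le)).trans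
        (mul_le_mul_of_nonneg_right (inv_anti₀ hm hy) (abs_nonneg _))
    linarith
  have hg : LipschitzOnWith (Real.toNNReal (h s₀)⁻¹ * L) (Real.log ∘ h) (uIcc 0 t) := by
    rw [uIcc_of_le ht]
    exact hlog.comp hL fun s hs => hmin hs
  have hAC := hg.absolutelyContinuousOnInterval
  have hFTC := hAC.integral_deriv_eq_sub
  -- Only monotonicity of the integral is applied to `F`, which need not be measurable; later it
  -- involves arbitrary selections `P`, `Q`.
  have hle : ENNReal.ofReal (∫ s in Ioo 0 t, -deriv (Real.log ∘ h) s) ≤ ENNReal.ofReal M := by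
    refine (ofReal_integral_le_lintegral_ofReal _).trans (le_trans (lintegral_mono_ae ?_) hint)
    refine (ae_restrict_iff' measurableSet_Ioo).2 ?_
    filter_upwards [hF, hL.ae_differentiableWithinAt_of_mem_real] with s h1 h2 hs
    have hs' : s ∈ Icc 0 t := Ioo_subset_Icc_self hs
    have hd := ((h2 hs').differentiableAt (Icc_mem_nhds hs.1 hs.2)).hasDerivAt
    have h3 := (hd.log (hpos s hs').ne').deriv
    have h4 : deriv (Real.log ∘ h) s = deriv h s / h s := h3
    rw [h4, ← neg_div, ENNReal.ofReal_div_of_pos (hpos s hs')]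
    exact ENNReal.div_le_of_le_mul' (h1 hs)
  have h5 := (ENNReal.ofReal_le_ofReal_iff hM).1 hle
  rw [integral_neg, ← integral_Ioc_eq_integral_Ioo, ← intervalIntegral.integral_of_le ht,
    hFTC] at h5
  simp only [Function.comp_apply] at h5
  have h6 : Real.log (h 0) + -M ≤ Real.log (h t) := by linarith
  have h7 := Real.exp_le_exp.2 h6
  rwa [Real.exp_add, Real.exp_log (hpos 0 ⟨le_rfl, ht⟩), Real.exp_log (hpos t ⟨ht, le_rfl⟩)] at h7

/-- Removes the restriction `h < h₀`: for `h ≥ h₀` the crude bound `|V| ≤ Λ ≤ h Λ / h₀` is already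
linear in `h`. -/
theorem ofReal_neg_le_of_abs_le {V h r C Λ h₀ : ℝ} (hh : 0 < h) (hh₀ : 0 < h₀) (hC : 0 < C)
    (hΛ : 0 ≤ Λ) (hr : 0 < r) (hV : |V| ≤ Λ) {N : ℝ≥0∞}
    (hsmall : h < h₀ → ∀ m, 0 ≤ m → N ≤ ENNReal.ofReal m → |V| ≤ C * h * (r * m + Λ + Λ)) :
    ENNReal.ofReal (-V) ≤ ENNReal.ofReal h * (ENNReal.ofReal C * (ENNReal.ofReal r * N) +
      ENNReal.ofReal (2 * C * Λ + Λ / h₀)) := by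
  have hV' := (neg_le_abs V)
  have hD : 0 ≤ Λ / h₀ := by positivity
  rcases lt_or_ge h h₀ with hlt | hge
  · by_cases hN : N = ⊤
    · have h1 : ENNReal.ofReal r * N = ⊤ := by
        rw [hN, ENNReal.mul_top]; simpa using hr
      have h2 : ENNReal.ofReal C * ⊤ = ⊤ := by rw [ENNReal.mul_top]; simpa using hC
      rw [h1, h2, top_add, ENNReal.mul_top (by simpa using hh)]
      exact le_top
    · have h1 := hsmall hlt N.toReal ENNReal.toReal_nonneg (ENNReal.ofReal_toReal hN).ge
      have hm : 0 ≤ N.toReal := ENNReal.toReal_nonneg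
      rw [← ENNReal.ofReal_toReal hN, ← ENNReal.ofReal_mul hr.le, ← ENNReal.ofReal_mul hC.le,
        ← ENNReal.ofReal_add (by positivity) (by positivity), ← ENNReal.ofReal_mul hh.le]
      refine ENNReal.ofReal_le_ofReal ?_
      have : 0 ≤ h * (Λ / h₀) := by positivity
      linarith
  · calc ENNReal.ofReal (-V) ≤ ENNReal.ofReal (h * (2 * C * Λ + Λ / h₀)) := by
          refine ENNReal.ofReal_le_ofReal ?_
          have h1 : Λ ≤ h * (Λ / h₀) := by
            rw [mul_div_assoc', le_div_iff₀ hh₀]; nlinarith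
          have h2 : 0 ≤ h * (2 * C * Λ) := by positivity
          linarith
      _ = ENNReal.ofReal h * ENNReal.ofReal (2 * C * Λ + Λ / h₀) := ENNReal.ofReal_mul hh.le
      _ ≤ _ := by gcongr; exact le_add_self

theorem lintegral_affine_le {C D x t : ℝ} (hC : 0 ≤ C) (hD : 0 ≤ D) (hx : 0 ≤ x) (ht : 0 ≤ t)
    {g : ℝ → ℝ≥0∞} (hg : ∫⁻ s in Ioo 0 t, g s ≤ ENNReal.ofReal x) :
    ∫⁻ s in Ioo 0 t, (ENNReal.ofReal C * g s + ENNReal.ofReal D) ≤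
      ENNReal.ofReal (C * x + D * t) := by
  rw [lintegral_add_right _ measurable_const, lintegral_const_mul' _ _ ENNReal.ofReal_ne_top,
    lintegral_const, Measure.restrict_apply_univ, Real.volume_Ioo, sub_zero,
    ENNReal.ofReal_add (by positivity) (by positivity), ENNReal.ofReal_mul hC,
    ENNReal.ofReal_mul hD]
  gcongr

/-- Before a first zero the bound `c` holds, and continuity carries it to that zero. -/
theorem pos_of_lower_bound_of_pos {h : ℝ → ℝ} {t c : ℝ} (hc : 0 < c) (h0 : 0 < h 0)
    (hcont : ContinuousOn h (Icc 0 t)) (hnn : ∀ s ∈ Icc 0 t, 0 ≤ h s)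
    (hlow : ∀ s ∈ Icc 0 t, (∀ r ∈ Icc 0 s, 0 < h r) → c ≤ h s) : ∀ s ∈ Icc 0 t, 0 < h s := by
  by_contra! hcon
  obtain ⟨s₁, hs₁, hle⟩ := hcon
  let Z : Set ℝ := Icc 0 t ∩ h ⁻¹' {0}
  have hZc : IsClosed Z := hcont.preimage_isClosed_of_isClosed isClosed_Icc isClosed_singleton
  have hZ : Z.Nonempty := ⟨s₁, hs₁, le_antisymm hle (hnn s₁ hs₁)⟩
  have hbd : BddBelow Z := ⟨0, fun s hs => hs.1.1⟩
  set s := sInf Z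
  have hsZ : s ∈ Z := hZc.csInf_mem hZ hbd
  have hs0 : h s = 0 := hsZ.2
  have hspos : 0 < s := lt_of_le_of_ne hsZ.1.1 fun he => by rw [← he] at hs0; linarith
  have hbefore : ∀ r ∈ Ico 0 s, 0 < h r := fun r hr => by
    have hrI : r ∈ Icc 0 t := ⟨hr.1, hr.2.le.trans hsZ.1.2⟩
    refine lt_of_le_of_ne (hnn r hrI) fun he => ?_
    exact (csInf_le hbd (show r ∈ Z from ⟨hrI, he.symm⟩)).not_gt hr.2
  have hlow' : ∀ r ∈ Ico 0 s, c ≤ h r := fun r hr =>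
    hlow r ⟨hr.1, hr.2.le.trans hsZ.1.2⟩ fun q hq => hbefore q ⟨hq.1, hq.2.trans_lt hr.2⟩
  have hlim : Tendsto h (𝓝[Ico 0 s] s) (𝓝 (h s)) :=
    (hcont s hsZ.1).mono fun r hr => ⟨hr.1, hr.2.le.trans hsZ.1.2⟩
  have hneBot : (𝓝[Ico 0 s] s).NeBot := by
    rw [nhdsWithin_Ico_eq_nhdsLT hspos]; infer_instance
  have := ge_of_tendsto hlim (eventually_mem_nhdsWithin.mono hlow')
  linarith

/-! ### The lower bound for the gap along a flow. -/

/-- The data of a flow around a moving rigid body. -/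
structure IsFlow (Ω S₀ : Set E3) (T : ℝ) (ustar om xstar : ℝ → E3) (X : ℝ → E3 → E3)
    (u : ℝ → E3 → E3) (Du : ℝ → E3 → E3 →L[ℝ] E3) (D2u : ℝ → E3 → E3 →L[ℝ] E3 →L[ℝ] E3) :
    Prop where
  motion : IsBodyMotion Ω S₀ T ustar om xstar X
  sobolev : ∀ᵐ t ∂(volume.restrict (Ioo 0 T)), MemW012 Ω (u t) (Du t)
  rigid : IsRigidOnBody S₀ T ustar om xstar X u
  divFree : ∀ᵐ t ∂(volume.restrict (Ioo 0 T)), DivFree Ω (Du t)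
  second : ∀ᵐ t ∂(volume.restrict (Ioo 0 T)), HasWeakGradient (fluid Ω (X t '' S₀)) (Du t) (D2u t)

/-- The norm of the second derivatives in the gap, weighted by the square root of its width. -/
noncomputable def gapNorm (K c₀ : ℝ) (Ω S₀ : Set E3) (X : ℝ → E3 → E3)
    (D2u : ℝ → E3 → E3 →L[ℝ] E3 →L[ℝ] E3) (P Q : ℝ → E3) (τ : ℝ) : ℝ≥0∞ :=
  ENNReal.ofReal (gap Ω S₀ X τ ^ ((1 : ℝ) / 2)) *
    eLpNorm (D2u τ) 2 (volume.restrict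
      (cylinder K (P τ) (Q τ) (c₀ * gap Ω S₀ X τ ^ ((1 : ℝ) / 2)) ∩ fluid Ω (X τ '' S₀)))

/-- The bound depends on `t` only through the bound `x` for the integral, so it serves both to
propagate positivity and to exclude `h → 0` at `T`. Only `D` and `Λ` depend on the motion. -/
theorem exists_gap_lower_bound {Ω S₀ : Set E3} (hΩ : IsOpen Ω) (hΩr : IsUniformlyC3 Ω)
    (hS : IsOpen S₀) (hne : S₀.Nonempty) (hb : Bornology.IsBounded S₀) (hSr : IsUniformlyC3 S₀)
    (hf : (frontier Ω).Nonempty) :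
    ∃ K c₀ C : ℝ, 0 < K ∧ 0 < c₀ ∧ 0 < C ∧
      ∀ (T : ℝ) (ustar om xstar : ℝ → E3) (X : ℝ → E3 → E3) (u : ℝ → E3 → E3)
        (Du : ℝ → E3 → E3 →L[ℝ] E3) (D2u : ℝ → E3 → E3 →L[ℝ] E3 →L[ℝ] E3),
        IsFlow Ω S₀ T ustar om xstar X u Du D2u →
        ∃ D Λ : ℝ, ∃ hΛ : 0 ≤ Λ, 0 ≤ D ∧
          LipschitzOnWith ⟨Λ, hΛ⟩ (gap Ω S₀ X) (Ico 0 T) ∧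
          ∀ P Q : ℝ → E3, ∀ t ∈ Ico 0 T, (∀ s ∈ Icc 0 t, 0 < gap Ω S₀ X s) →
            (∀ s ∈ Icc 0 t, IsClosestPair Ω (X s '' S₀) (P s) (Q s)) →
            ∀ x, 0 ≤ x → ∫⁻ s in Ioo 0 t, gapNorm K c₀ Ω S₀ X D2u P Q s ≤ ENNReal.ofReal x →
              gap Ω S₀ X 0 * Real.exp (-(C * x + D * T)) ≤ gap Ω S₀ X t := by
  obtain ⟨K₁, σ₁, hK₁, hσ₁, hΩr⟩ := hΩr
  obtain ⟨K₂, σ₂, hK₂, hσ₂, hSr⟩ := hSr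
  obtain ⟨K, c₀, h₀, C, hK, hc₀, hh₀, hC, hmain⟩ :=
    exists_gap_velocity_bound hΩ hK₁ hσ₁ hK₂ hσ₂ hΩr
  refine ⟨K, c₀, C, hK, hc₀, hC, fun T ustar om xstar X u Du D2u hflow => ?_⟩
  have hX := hflow.motion
  obtain ⟨Λ, hΛ0, hΛ⟩ := hX.exists_velocity_bound hb
  have hLip := hX.lipschitzOnWith_gap hΛ hΛ0 hne hf
  have hD : 0 ≤ 2 * C * Λ + Λ / h₀ := by positivity
  refine ⟨2 * C * Λ + Λ / h₀, Λ, hΛ0, hD, hLip, fun P Q t ht hpos hPQ x hx hint => ?_⟩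
  obtain ⟨A, hA, -⟩ := hX.exists_affine hS hne
  have hsub : Icc 0 t ⊆ Ico 0 T := fun s hs => ⟨hs.1, hs.2.trans_lt ht.2⟩
  have key := exp_neg_mul_le_of_deriv (h := gap Ω S₀ X) (M := C * x + (2 * C * Λ + Λ / h₀) * t)
    (F := fun s => ENNReal.ofReal C * gapNorm K c₀ Ω S₀ X D2u P Q s +
      ENNReal.ofReal (2 * C * Λ + Λ / h₀)) ht.1 (hLip.mono hsub) hpos
    (by have := ht.1; positivity) ?_ (lintegral_affine_le hC.le hD hx ht.1 hint)
  · refine le_trans ?_ key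
    have h1 : (2 * C * Λ + Λ / h₀) * t ≤ (2 * C * Λ + Λ / h₀) * T := by gcongr; exact ht.2.le
    have h2 := hpos 0 ⟨le_rfl, ht.1⟩
    gcongr
  · filter_upwards [hX.ae_hasDerivAt_gap hΛ hΛ0 hS hne hf, hΛ,
      (ae_restrict_iff' measurableSet_Ioo).1 hflow.sobolev,
      (ae_restrict_iff' measurableSet_Ioo).1 hflow.rigid,
      (ae_restrict_iff' measurableSet_Ioo).1 hflow.divFree,
      (ae_restrict_iff' measurableSet_Ioo).1 hflow.second] with s h1 h2 h3 h4 h5 h6 hs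
    have hs' : s ∈ Icc 0 t := Ioo_subset_Icc_self hs
    have hsT : s ∈ Ioo 0 T := ⟨hs.1, hs.2.trans ht.2⟩
    have hsT' : s ∈ Ico 0 T := hsub hs'
    have hcp := hPQ s hs'
    have hgs := hpos s hs'
    rw [(h1 hsT _ _ hcp hgs).deriv]
    have himg : X s '' S₀ = A s '' S₀ := image_congr fun y hy => (hA s hsT' y hy).symm
    have hopen : IsOpen (X s '' S₀) := by
      rw [himg]; exact (A s).toHomeomorph.isOpenMap S₀ hS
    have hreg : IsUniformlyC3With K₂ σ₂ (X s '' S₀) := by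
      rw [himg]; exact hSr.image (A s)
    have hV : ‖rigidVelocity ustar om xstar s (P s)‖ ≤ Λ :=
      (h2 hsT).2 _ (frontier_subset_closure hcp.1)
    refine ofReal_neg_le_of_abs_le hgs hh₀ hC hΛ0 (Real.rpow_pos_of_pos hgs _) ?_
      fun hlt m hm hN => ?_
    · refine (abs_real_inner_le_norm _ _).trans ?_
      have h7 : ‖‖P s - Q s‖⁻¹ • (P s - Q s)‖ ≤ 1 := by
        rw [norm_smul, norm_inv, norm_norm]
        exact inv_mul_le_one
      calc _ ≤ 1 * Λ := by gcongr
        _ = Λ := one_mul _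
    · have := hmain (X s '' S₀) (u s) (Du s) (D2u s) (ustar s) (om s) (xstar s) (P s) (Q s)
        (gap Ω S₀ X s) m hopen (hX.subset s hsT') hreg (h3 hsT) (h5 hsT) (h6 hsT) (h4 hsT) hcp rfl
        hgs hlt hm hN
      refine this.trans ?_
      gcongr
      · exact hV
      · exact (h2 hsT).1

/-- The integral increases with `t`, so if it is unbounded it tends to infinity. -/
theorem tendsto_setLIntegral_Ioo_top {g : ℝ → ℝ≥0∞} {T : ℝ}
    (h : ¬ ∃ x : ℝ, 0 ≤ x ∧ ∀ t < T, ∫⁻ s in Ioo 0 t, g s ≤ ENNReal.ofReal x) :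
    Tendsto (fun t => ∫⁻ s in Ioo 0 t, g s) (𝓝[<] T) (𝓝 ⊤) := by
  rw [ENNReal.tendsto_nhds_top_iff_nnreal]
  intro x
  push Not at h
  obtain ⟨t₀, ht₀, hlt⟩ := h x x.2
  rw [ENNReal.ofReal_coe_nnreal] at hlt
  filter_upwards [Ioo_mem_nhdsLT ht₀] with t ht
  exact hlt.trans_le (lintegral_mono_set (Ioo_subset_Ioo_right ht.1.le))

/-- The gap is at most its initial value plus `Λ T`, and the norm over the cylinder is at most that
over the whole fluid region; hence the bound does not involve `P` and `Q`. -/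
theorem exists_gapNorm_lintegral_le {K c₀ T Λ : ℝ} {Ω S₀ : Set E3} {X : ℝ → E3 → E3}
    {D2u : ℝ → E3 → E3 →L[ℝ] E3 →L[ℝ] E3} (hΛ : 0 ≤ Λ)
    (hL : LipschitzOnWith ⟨Λ, hΛ⟩ (gap Ω S₀ X) (Ico 0 T)) {t : ℝ} (ht : t ∈ Ico 0 T)
    (hint : ∫⁻ s in Ioo 0 t, eLpNorm (D2u s) 2 (volume.restrict (fluid Ω (X s '' S₀))) < ⊤) :
    ∃ x, 0 ≤ x ∧ ∀ (P Q : ℝ → E3), ∀ s ∈ Icc 0 t,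
      ∫⁻ τ in Ioo 0 s, gapNorm K c₀ Ω S₀ X D2u P Q τ ≤ ENNReal.ofReal x := by
  set J := ∫⁻ s in Ioo 0 t, eLpNorm (D2u s) 2 (volume.restrict (fluid Ω (X s '' S₀)))
  set B := (gap Ω S₀ X 0 + Λ * T) ^ ((1 : ℝ) / 2)
  have hg0 : 0 ≤ gap Ω S₀ X 0 := setDist_nonneg _ _
  have hT : 0 ≤ T := ht.1.trans ht.2.le
  refine ⟨B * J.toReal, by positivity, fun P Q s hs => ?_⟩
  calc ∫⁻ τ in Ioo 0 s, gapNorm K c₀ Ω S₀ X D2u P Q τ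
      ≤ ∫⁻ τ in Ioo 0 t, gapNorm K c₀ Ω S₀ X D2u P Q τ :=
        lintegral_mono_set (Ioo_subset_Ioo_right hs.2)
    _ ≤ ∫⁻ τ in Ioo 0 t, ENNReal.ofReal B *
        eLpNorm (D2u τ) 2 (volume.restrict (fluid Ω (X τ '' S₀))) := by
        refine setLIntegral_mono' measurableSet_Ioo fun τ hτ => ?_
        have hτT : τ ∈ Ico 0 T := ⟨hτ.1.le, hτ.2.trans ht.2⟩
        have h1 := hL.dist_le_mul τ hτT 0 ⟨le_rfl, ht.1.trans_lt ht.2⟩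
        rw [Real.dist_eq, Real.dist_eq, sub_zero, abs_of_pos hτ.1] at h1
        have h2 : gap Ω S₀ X τ ≤ gap Ω S₀ X 0 + Λ * T := by
          have h3 : Λ * τ ≤ Λ * T := by gcongr; exact hτT.2.le
          have h4 : gap Ω S₀ X τ - gap Ω S₀ X 0 ≤ Λ * τ := (le_abs_self _).trans h1
          linarith
        refine mul_le_mul' (ENNReal.ofReal_le_ofReal ?_)
          (eLpNorm_mono_measure _ (Measure.restrict_mono inter_subset_right le_rfl))
        exact Real.rpow_le_rpow (setDist_nonneg _ _) h2 (by norm_num)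
    _ = ENNReal.ofReal B * J := lintegral_const_mul' _ _ ENNReal.ofReal_ne_top
    _ = ENNReal.ofReal (B * J.toReal) := by
        rw [ENNReal.ofReal_mul (by positivity), ENNReal.ofReal_toReal hint.ne]

end RigidFluid

/-! ### Positivity of the gap and the blow-up criterion. -/

theorem corollary3p2 (Ω S₀ : Set E3)
    (hΩ_open : IsOpen Ω) (hΩ_conn : IsConnected Ω) (hΩ_reg : IsUniformlyC3 Ω)
    (hS_open : IsOpen S₀) (hS_conn : IsConnected S₀) (hS_bdd : Bornology.IsBounded S₀)
    (hS_reg : IsUniformlyC3 S₀) :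
    ∃ c₀ k : ℝ, 0 < c₀ ∧ 0 < k ∧
      ∀ (T : ℝ) (ustar om xstar : ℝ → E3) (X : ℝ → E3 → E3)
        (u : ℝ → E3 → E3)
        (Du : ℝ → E3 → E3 →L[ℝ] E3)
        (D2u : ℝ → E3 → E3 →L[ℝ] E3 →L[ℝ] E3),
        0 < T →
        IsBodyMotion Ω S₀ T ustar om xstar X →
        MemLinftyL2 T Ω u →
        MemL1W012 T Ω u Du →
        IsRigidOnBody S₀ T ustar om xstar X u →
        (∀ᵐ t ∂(volume.restrict (Ioo 0 T)), DivFree Ω (Du t)) →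
        (∀ᵐ t ∂(volume.restrict (Ioo 0 T)),
          HasWeakGradient (fluid Ω (X t '' S₀)) (Du t) (D2u t)) →
        (∀ t ∈ Ico 0 T, ∫⁻ s in Ioo 0 t,
          eLpNorm (D2u s) 2 (volume.restrict (fluid Ω (X s '' S₀))) < ⊤) →
        0 < gap Ω S₀ X 0 →
        (∀ t ∈ Ico 0 T, 0 < gap Ω S₀ X t) ∧
        (liminf (fun t => gap Ω S₀ X t) (𝓝[<] T) = 0 →
          ∀ P Q : ℝ → E3,
            (∀ t ∈ Ico 0 T, IsClosestPair Ω (X t '' S₀) (P t) (Q t)) →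
            Tendsto
              (fun t => ∫⁻ τ in Ioo 0 t,
                ENNReal.ofReal (gap Ω S₀ X τ ^ ((1 : ℝ) / 2)) *
                  eLpNorm (D2u τ) 2 (volume.restrict
                    (cylinder k (P τ) (Q τ)
                        (c₀ * gap Ω S₀ X τ ^ ((1 : ℝ) / 2)) ∩
                      fluid Ω (X τ '' S₀))))
              (𝓝[<] T) (𝓝 ⊤)) := by
  have hne := hS_conn.nonempty
  -- For empty boundary the infimum over the empty set is `0` by convention, which contradicts the
  -- positive initial gap.
  by_cases hf : (frontier Ω).Nonempty
  swap
  · refine ⟨1, 1, one_pos, one_pos, ?_⟩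
    intro T ustar om xstar X u Du D2u _ _ _ _ _ _ _ _ hpos
    rw [not_nonempty_iff_eq_empty] at hf
    simp [gap, setDist, hf] at hpos
  obtain ⟨K, c₀, C, hK, hc₀, hC, hmain⟩ :=
    exists_gap_lower_bound hΩ_open hΩ_reg hS_open hne hS_bdd hS_reg hf
  refine ⟨c₀, K, hc₀, hK, ?_⟩
  intro T ustar om xstar X u Du D2u hT hX _ hu hrig hdiv hsec hint hpos
  obtain ⟨D, Λ, hΛ, hD, hLip, hlow⟩ := hmain T ustar om xstar X u Du D2u
    ⟨hX, hu.2.2.1, hrig, hdiv, hsec⟩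
  -- The first claim provides no closest points, so some are selected wherever the gap is positive;
  -- elsewhere the values are irrelevant.
  have hpair : ∀ s, ∃ P Q : E3, s ∈ Ico 0 T → 0 < gap Ω S₀ X s →
      IsClosestPair Ω (X s '' S₀) P Q := fun s => by
    by_cases hs : s ∈ Ico 0 T ∧ 0 < gap Ω S₀ X s
    · obtain ⟨A, hA, -⟩ := hX.exists_affine hS_open hne
      have himg : X s '' S₀ = A s '' S₀ := image_congr fun y hy => (hA s hs.1 y hy).symm
      obtain ⟨P, Q, h⟩ := exists_isClosestPair (Ω := Ω) (S := X s '' S₀)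
        (by rw [himg]; exact (A s).toHomeomorph.isOpenMap S₀ hS_open) (hne.image _)
        (by rw [himg]; exact (A s).lipschitz.isBounded_image hS_bdd) hf hs.2
      exact ⟨P, Q, fun _ _ => h⟩
    · exact ⟨0, 0, fun h1 h2 => (hs ⟨h1, h2⟩).elim⟩
  choose P₁ Q₁ hPQ₁ using hpair
  have hposall : ∀ t ∈ Ico 0 T, 0 < gap Ω S₀ X t := fun t ht => by
    obtain ⟨x, hx, hxint⟩ := exists_gapNorm_lintegral_le (K := K) (c₀ := c₀) hΛ hLip ht (hint t ht)
    have hsub : Icc 0 t ⊆ Ico 0 T := fun s hs => ⟨hs.1, hs.2.trans_lt ht.2⟩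
    refine pos_of_lower_bound_of_pos (c := gap Ω S₀ X 0 * Real.exp (-(C * x + D * T)))
      (by positivity) hpos (hLip.continuousOn.mono hsub) (fun s _ => setDist_nonneg _ _)
      (fun s hs hp => ?_) t ⟨ht.1, le_rfl⟩
    have hsub' : Icc 0 s ⊆ Ico 0 T := fun r hr => ⟨hr.1, hr.2.trans_lt (hsub hs).2⟩
    exact hlow P₁ Q₁ s (hsub hs) hp (fun r hr => hPQ₁ r (hsub' hr) (hp r hr)) x hx
      (hxint P₁ Q₁ s hs)
  refine ⟨hposall, fun hlim P Q hPQ => tendsto_setLIntegral_Ioo_top ?_⟩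
  rintro ⟨x, hx, hbound⟩
  set c := gap Ω S₀ X 0 * Real.exp (-(C * x + D * T))
  have hc : 0 < c := by positivity
  have hge : ∀ t ∈ Ico 0 T, c ≤ gap Ω S₀ X t := fun t ht => by
    have hsub : Icc 0 t ⊆ Ico 0 T := fun s hs => ⟨hs.1, hs.2.trans_lt ht.2⟩
    exact hlow P Q t ht (fun s hs => hposall s (hsub hs)) (fun s hs => hPQ s (hsub hs)) x hx
      (hbound t ht.2)
  have hev : ∀ᶠ t in 𝓝[<] T, t ∈ Ico 0 T := by
    filter_upwards [Ioo_mem_nhdsLT hT] with t ht using ⟨ht.1.le, ht.2⟩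
  -- The lower bound passes to the real-valued `liminf` only for a function bounded above near `T`.
  have hbdd : IsBoundedUnder (· ≤ ·) (𝓝[<] T) (fun t => gap Ω S₀ X t) := by
    refine isBoundedUnder_of_eventually_le (a := gap Ω S₀ X 0 + Λ * T) ?_
    filter_upwards [hev] with t ht
    have h1 := hLip.dist_le_mul t ht 0 ⟨le_rfl, hT⟩
    rw [Real.dist_eq, Real.dist_eq, sub_zero, abs_of_nonneg ht.1] at h1
    have h3 : Λ * t ≤ Λ * T := by gcongr; exact ht.2.le
    have h4 : gap Ω S₀ X t - gap Ω S₀ X 0 ≤ Λ * t := (le_abs_self _).trans h1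
    linarith
  have := le_liminf_of_le hbdd.isCoboundedUnder_ge (hev.mono hge)
  rw [hlim] at this
  linarith
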